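/- Let $M$ be a finite-dimensional (Hausdorff) $C^\infty$ manifold, let $H\subseteq TM$ be a smooth vector subbundle and let $K\subseteq TM$ be a smooth vector subbundle supplementary to $H$, i.e. $T_pM=H_p\oplus K_p$ for all $p\in M$. Denote by $P^{H}_p:T_pM\to T_pM/H_p$ the canonical projection, by $P_{H,p}:T_pM\to H_p$ the projection onto $H_p$ along $K_p$, and by $Q_p:T_pM/H_p\to K_p$ the inverse of the isomorphism $P^H_p|_{K_p}$. The curvature tensor of $H$ is $C^H_p:H_p\wedge H_p\to T_pM/H_p$, $C^H_p(u\wedge v)=P^H_p[Y,Z]_p$, where $Y,Z$ are any smooth sections of $H$ with $Y_p=u$, $Z_p=v$. Let $I\subset\mathbf R$ be a compact interval with more than one point, and let $\beta_0:I\to M$ be a smooth path tangent to $H$, i.e. $\dot\beta_0(t)\in H_{\beta_0(t)}$ for all $t\in I$. The bundle $\beta_0^*K\to I$ carries a canonical linear connection, whose horizontal space at $(t,k)$ is $(T_{(t,k)}q)^{-1}\big(T_kK\cap\omega_M(TH)\big)$, where $q:\beta_0^*K\to K$ is the canonical map, $H$ and $K$ also denote the total spaces, regarded as submanifolds of $TM$,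 and $\omega_M:T(TM)\to T(TM)$ is the canonical involution, $(x,y;z,w)\mapsto(x,z;y,w)$ in local coordinates. Let $(\beta_0^*K)_s^t:K_{\beta_0(s)}\to K_{\beta_0(t)}$ be its parallel transport and put $[\beta_0^*K]_s^t=Q_{\beta_0(t)}^{-1}\circ(\beta_0^*K)_s^t\circ Q_{\beta_0(s)}:T_{\beta_0(s)}M/H_{\beta_0(s)}\to T_{\beta_0(t)}M/H_{\beta_0(t)}$. Fix $t_0\in I$ and define, for smooth sections $X$ of $\beta_0^*TM$, $$(\mathsf D X)_t=[\beta_0^*K]_{t_0}^{t}\,\frac{d}{dt}\Big([\beta_0^*K]_{t}^{t_0}P^{H}_{\beta_0(t)}X_t\Big)-C^H_{\beta_0(t)}\big(P_{H,\beta_0(t)}X_t\wedge\dot\beta_0(t)\big)\in T_{\beta_0(t)}M/H_{\beta_0(t)},\qquad t\in I.$$ Then a smooth section $X$ of $\beta_0^*TM$ satisfies $(\mathsf D X)_t=0$ for all $t\in I$ if and only if there exist $\varepsilon>0$ and a smooth map $\beta:(-\varepsilon,\varepsilon)\times I\to M$ with $\beta(0,\cdot)=\beta_0$ and $\frac{\partial\beta}{\partial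 t}(s,t)\in H_{\beta(s,t)}$ for all $s\in(-\varepsilon,\varepsilon)$, $t\in I$, such that $X_t=\frac{\partial\beta}{\partial s}(0,t)$ for all $t\in I$. -/

import Mathlib

open Set Topology
open scoped Manifold ContDiff

noncomputable section

namespace TangentPaths

section Velocity

variable {E' : Type*} [NormedAddCommGroup E'] [NormedSpace ℝ E']
  {B' : Type*} [TopologicalSpace B'] (J : ModelWithCorners ℝ E' B')
  {N : Type*} [TopologicalSpace N] [ChartedSpace B' N]

/-- The velocity vector `ċ(t) ∈ T_{c(t)} N` of a path `c` defined on `S ⊆ ℝ` (one-sided at the end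
points when `S` is a compact interval). -/
def pathVelocity (c : ℝ → N) (S : Set ℝ) (t : ℝ) : TangentSpace J (c t) :=
  mfderivWithin 𝓘(ℝ, ℝ) J c S t (1 : ℝ)

end Velocity

variable {E : Type*} [NormedAddCommGroup E] [NormedSpace ℝ E]
  {M : Type*} [TopologicalSpace M] [ChartedSpace E M] [IsManifold 𝓘(ℝ, E) ∞ M]

/-- `H` is a smooth vector subbundle of `TM`: near every point it has a smooth local frame. -/
def IsSmoothSubbundle (H : ∀ p : M, Submodule ℝ (TangentSpace 𝓘(ℝ, E) p)) : Prop :=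
  ∀ p : M, ∃ U : Set M, IsOpen U ∧ p ∈ U ∧
    ∃ (k : ℕ) (F : Fin k → ∀ q : M, TangentSpace 𝓘(ℝ, E) q),
      (∀ i, ContMDiffOn 𝓘(ℝ, E) 𝓘(ℝ, E).tangent ∞
        (fun q => (⟨q, F i q⟩ : TangentBundle 𝓘(ℝ, E) M)) U) ∧
      ∀ q ∈ U, LinearIndependent ℝ (fun i => F i q) ∧
        Submodule.span ℝ (Set.range fun i => F i q) = H q

/-- `X` is (on some neighbourhood of `p`) a smooth section of the subbundle `H`.
Since only values and Lie brackets at `p` matter, it is equivalent to use sections over all of `M`: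
multiply by a cut-off function. -/
def IsSectionNear (H : ∀ p : M, Submodule ℝ (TangentSpace 𝓘(ℝ, E) p)) (p : M)
    (X : ∀ q : M, TangentSpace 𝓘(ℝ, E) q) : Prop :=
  ∃ U : Set M, IsOpen U ∧ p ∈ U ∧
    ContMDiffOn 𝓘(ℝ, E) 𝓘(ℝ, E).tangent ∞
      (fun q => (⟨q, X q⟩ : TangentBundle 𝓘(ℝ, E) M)) U ∧
    ∀ q ∈ U, X q ∈ H q

open Classical in
/-- The curvature tensor `C^H_p(u ∧ v) = [X, Y]_p mod H_p` for `u, v ∈ H_p`, where `X, Y` are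
smooth sections of `H` with `X_p = u`, `Y_p = v` (the value does not depend on their choice). -/
def curvature (H : ∀ p : M, Submodule ℝ (TangentSpace 𝓘(ℝ, E) p)) (p : M)
    (u v : TangentSpace 𝓘(ℝ, E) p) : TangentSpace 𝓘(ℝ, E) p ⧸ H p :=
  if h : ∃ XY : (∀ q : M, TangentSpace 𝓘(ℝ, E) q) × (∀ q : M, TangentSpace 𝓘(ℝ, E) q),
      IsSectionNear H p XY.1 ∧ IsSectionNear H p XY.2 ∧ XY.1 p = u ∧ XY.2 p = v then
    (H p).mkQ (VectorField.mlieBracket 𝓘(ℝ, E) h.choose.1 h.choose.2 p)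
  else 0

/-- The total space of a subbundle, as a subset of `TM`. -/
def totalSet (H : ∀ p : M, Submodule ℝ (TangentSpace 𝓘(ℝ, E) p)) :
    Set (TangentBundle 𝓘(ℝ, E) M) :=
  {h | h.2 ∈ H h.1}

/-- The tangent bundle `TS ⊆ T(TM)` of a submanifold `S` of `TM`: the set of velocity vectors
of the smooth curves that lie in `S`. -/
def tangentSet (S : Set (TangentBundle 𝓘(ℝ, E) M)) :
    Set (TangentBundle 𝓘(ℝ, E).tangent (TangentBundle 𝓘(ℝ, E) M)) :=
  {ξ | ∃ c : ℝ → TangentBundle 𝓘(ℝ, E) M, ∃ δ > (0 : ℝ),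
    ContMDiffOn 𝓘(ℝ, ℝ) 𝓘(ℝ, E).tangent ∞ c (Ioo (-δ) δ) ∧ (∀ u ∈ Ioo (-δ) δ, c u ∈ S) ∧
    ξ = ⟨c 0, pathVelocity 𝓘(ℝ, E).tangent c (Ioo (-δ) δ) 0⟩}

/-- The canonical involution `ω_M` of `T(TM)`, in local coordinates
`(x, y; z, w) ↦ (x, z; y, w)`. A tangent vector to `TM` at `⟨x, y⟩` is a pair in `E × E`, read in
the chart of `TM` induced by the preferred chart of `M` at `x`; this chart depends on `x` only. -/
def canonicalFlip (ξ : TangentBundle 𝓘(ℝ, E).tangent (TangentBundle 𝓘(ℝ, E) M)) :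
    TangentBundle 𝓘(ℝ, E).tangent (TangentBundle 𝓘(ℝ, E) M) :=
  ⟨⟨ξ.1.1, (show E × E from ξ.2).1⟩,
    (show E × E from ((show E from ξ.1.2), (show E × E from ξ.2).2))⟩

section AlongPath

variable (H K : ∀ p : M, Submodule ℝ (TangentSpace 𝓘(ℝ, E) p))
  (hHK : ∀ p, IsCompl (H p) (K p)) (a b : ℝ) (β₀ : ℝ → M)

/-- `β₀ : [a, b] → M` is tangent to `H`. -/
def IsTangentPath : Prop :=
  ∀ t ∈ Icc a b, pathVelocity 𝓘(ℝ, E) β₀ (Icc a b) t ∈ H (β₀ t)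

/-- `X` is a smooth section of the pull-back `β₀^* TM` over `[a, b]`. -/
def IsSmoothAlong (X : ∀ t : ℝ, TangentSpace 𝓘(ℝ, E) (β₀ t)) : Prop :=
  ContMDiffOn 𝓘(ℝ, ℝ) 𝓘(ℝ, E).tangent ∞
    (fun t => (⟨β₀ t, X t⟩ : TangentBundle 𝓘(ℝ, E) M)) (Icc a b)

/-- The smooth section `σ` of `β₀^* K` is horizontal (parallel) for the canonical linear connection
on `β₀^* K`, whose horizontal space at `k` consists of the vectors that `β₀^* K → K` maps into
`T_k K ∩ ω_M(TH)`. -/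
def IsParallel (σ : ∀ t : ℝ, K (β₀ t)) : Prop :=
  IsSmoothAlong a b β₀ (fun t => (σ t : TangentSpace 𝓘(ℝ, E) (β₀ t))) ∧
  ∀ t ∈ Icc a b,
    (⟨⟨β₀ t, (σ t : TangentSpace 𝓘(ℝ, E) (β₀ t))⟩,
      pathVelocity 𝓘(ℝ, E).tangent
        (fun τ => (⟨β₀ τ, (σ τ : TangentSpace 𝓘(ℝ, E) (β₀ τ))⟩ : TangentBundle 𝓘(ℝ, E) M))
        (Icc a b) t⟩ : TangentBundle 𝓘(ℝ, E).tangent (TangentBundle 𝓘(ℝ, E) M)) ∈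
      tangentSet (totalSet K) ∩ canonicalFlip '' tangentSet (totalSet H)

open Classical in
/-- The parallel transport `(β₀^* K)_s^t : K_{β₀(s)} → K_{β₀(t)}`: the value at `t` of the
horizontal section with value `k` at `s`. -/
def transport (s t : ℝ) (k : K (β₀ s)) : K (β₀ t) :=
  if h : ∃ σ : ∀ t : ℝ, K (β₀ t), IsParallel H K a b β₀ σ ∧ σ s = k then h.choose t else 0

/-- The operator `[β₀^* K]_s^t = Q(t)⁻¹ ∘ (β₀^* K)_s^t ∘ Q(s)` induced in the quotients by
the isomorphisms `Q(t) : T_{β₀(t)}M / H_{β₀(t)} ≃ K_{β₀(t)}`. -/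
def quotientTransport (s t : ℝ) (v : TangentSpace 𝓘(ℝ, E) (β₀ s) ⧸ H (β₀ s)) :
    TangentSpace 𝓘(ℝ, E) (β₀ t) ⧸ H (β₀ t) :=
  (Submodule.quotientEquivOfIsCompl _ _ (hHK (β₀ t))).symm
    (transport H K a b β₀ s t (Submodule.quotientEquivOfIsCompl _ _ (hHK (β₀ s)) v))

/-- The operator of infinitesimal variation
`(D X)_t = [β₀^* K]_{t₀}^t (d/dt) ([β₀^* K]_t^{t₀} (X_t mod H)) - C^H (P_H X_t ∧ β̇₀(t))`,
where `P_H` is the projection onto `H` along `K`. -/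
def variationOperator (t₀ : ℝ) (X : ∀ t : ℝ, TangentSpace 𝓘(ℝ, E) (β₀ t)) (t : ℝ) :
    TangentSpace 𝓘(ℝ, E) (β₀ t) ⧸ H (β₀ t) :=
  quotientTransport H K hHK a b β₀ t₀ t
      (derivWithin
        (fun τ => quotientTransport H K hHK a b β₀ τ t₀ ((H (β₀ τ)).mkQ (X τ))) (Icc a b) t)
    - curvature H (β₀ t)
        ((H (β₀ t)).projectionOnto (K (β₀ t)) (hHK (β₀ t)) (X t) : TangentSpace 𝓘(ℝ, E) (β₀ t))
        (pathVelocity 𝓘(ℝ, E) β₀ (Icc a b) t)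

/-- `β : (-ε, ε) × [a, b] → M` is a smooth variation of `β₀` through paths tangent to `H`. -/
structure IsTangentVariation (ε : ℝ) (β : ℝ × ℝ → M) : Prop where
  smooth : ContMDiffOn 𝓘(ℝ, ℝ × ℝ) 𝓘(ℝ, E) ∞ β (Ioo (-ε) ε ×ˢ Icc a b)
  initial : ∀ t ∈ Icc a b, β (0, t) = β₀ t
  tangent : ∀ s ∈ Ioo (-ε) ε, IsTangentPath H a b (fun t => β (s, t))

end AlongPath

end TangentPaths

end

/-! In a chart, let P(x) be the projection onto K along H. A path β is tangent to H exactly when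
P(β)β' = 0. Linearising this equation at a tangent path x = β₀ in the direction X gives the
expression L(X) = P(x)X' + DP(x)[X]x' (`linearizedConstraint`). Because P(x)x' = 0, a change of
chart acts on L(X) as on a tangent vector (`linearizedConstraint_comp`), so the condition L(X) = 0
makes sense on the manifold. It is the bridge between the two sides of the theorem.

The operator vanishes if and only if L(X) does (`variationOperator_eq_zero_iff`). A section k of K
is parallel for the canonical connection precisely when L(k) = 0, since the condition on ω_M(TH) is
the derivative of P(x)v = 0 with the two directions exchanged (`isParallel_iff`). If PX = ∑ κᵢ fᵢ in
a parallel frame, then L(PX) = ∑ κᵢ' fᵢ, which is the transported derivative in the definition of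
the operator. Differentiating P² = P gives L(X) = L(PX) - (DP[x']u - DP[u]x') with u = X - PX, and
the bracket is the curvature of u and x' computed in the chart (`curvature_eq`).

If X comes from a variation through tangent paths, then L(X) = 0 by differentiating P(β)∂ₜβ = 0 in s
and exchanging the derivatives (`IsProjectionField.linearizedConstraint_eq_zero`).

Conversely, suppose L(X) = 0. Inside one chart, take any family γ with γ(0, ·) = x and ∂ₛγ(0, ·) =
X, and solve ∂ₜz = (1 - P(z))∂ₜγ with the initial values of γ. The paths z(s, ·) are tangent to H
and z(0, ·) = x by uniqueness. Both ∂ₛz(0, ·) and X solve the linearised equation, X doing so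
because L(X) = 0, and hence they coincide (`IsProjectionField.exists_tangent_variation`). This needs
smooth dependence of solutions on a parameter up to the ends of a compact interval
(`contDiffOn_solution`).

Variations found in two charts need not agree on the overlap, so they cannot simply be pasted. A
given variation is instead prolonged: it is blended into the affine family x + sX near its end and
then corrected as above. The correction changes nothing where the family is already tangent, so the
old and the new variation agree on an overlap and glue (`VariationsExtend`). Compactness of the
interval finishes the argument (`interval_induction`). -/

set_option linter.unusedSectionVars false

noncomputable section

namespace TangentPaths

/-! ### Ordinary differential equations on a compact interval: existence, Grönwall bounds,
continuity in a parameter. -/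

section ODE

open scoped NNReal
open Metric Filter

variable {F : Type*} [NormedAddCommGroup F] [NormedSpace ℝ F]

/-- Global solvability of a bounded, globally Lipschitz time-dependent equation. -/
theorem exists_solution_of_lipschitz_of_bounded [CompleteSpace F] {f : ℝ → F → F} {c d s : ℝ}
    (hs : s ∈ Icc c d) {K : ℝ≥0} {L : ℝ} (hK : ∀ t ∈ Icc c d, LipschitzWith K (f t))
    (hc : ∀ x, ContinuousOn (fun t => f t x) (Icc c d))
    (hL : ∀ t ∈ Icc c d, ∀ x, ‖f t x‖ ≤ L) (x₀ : F) :
    ∃ α : ℝ → F, α s = x₀ ∧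
      ∀ t ∈ Icc c d, HasDerivWithinAt α (f t (α t)) (Icc c d) t := by
  have hL0 : 0 ≤ L := (norm_nonneg _).trans (hL s hs x₀)
  have hm : 0 ≤ max (d - s) (s - c) := le_max_of_le_left (by linarith [hs.2])
  have hPL : IsPicardLindelof f (⟨s, hs⟩ : Icc c d) x₀
      (L.toNNReal * (max (d - s) (s - c)).toNNReal) 0 L.toNNReal K :=
    { lipschitzOnWith := fun t ht => (hK t ht).lipschitzOnWith
      continuousOn := fun x _ => hc x
      norm_le := fun t ht x _ => by rw [Real.coe_toNNReal _ hL0]; exact hL t ht x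
      mul_max_le := by
        rw [NNReal.coe_zero, sub_zero, NNReal.coe_mul, Real.coe_toNNReal _ hL0,
          Real.coe_toNNReal _ hm] }
  exact hPL.exists_eq_forall_mem_Icc_hasDerivWithinAt₀

theorem norm_le_gronwallBound_right {α α' : ℝ → F} {c d K ε δ : ℝ}
    (hα : ∀ t ∈ Icc c d, HasDerivWithinAt α (α' t) (Icc c d) t)
    (hb : ∀ t ∈ Icc c d, ‖α' t‖ ≤ K * ‖α t‖ + ε) (h0 : ‖α c‖ ≤ δ) {t : ℝ} (ht : t ∈ Icc c d) :
    ‖α t‖ ≤ gronwallBound δ K ε (t - c) := by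
  refine norm_le_gronwallBound_of_norm_deriv_right_le (f' := α')
    (fun t ht => (hα t ht).continuousWithinAt) (fun t ht => ?_) h0
    (fun t ht => hb t (Ico_subset_Icc_self ht)) t ht
  exact ((hα t (Ico_subset_Icc_self ht)).mono_of_mem_nhdsWithin (Icc_mem_nhdsGE_of_mem ht))

/-- Time reversal reduces this to the forward estimate. -/
theorem norm_le_gronwallBound_left {α α' : ℝ → F} {c d K ε δ : ℝ}
    (hα : ∀ t ∈ Icc c d, HasDerivWithinAt α (α' t) (Icc c d) t)
    (hb : ∀ t ∈ Icc c d, ‖α' t‖ ≤ K * ‖α t‖ + ε) (h0 : ‖α d‖ ≤ δ) {t : ℝ} (ht : t ∈ Icc c d) :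
    ‖α t‖ ≤ gronwallBound δ K ε (d - t) := by
  have hmaps : MapsTo (fun t : ℝ => -t) (Icc (-d) (-c)) (Icc c d) := fun t ht =>
    ⟨by linarith [ht.2], by linarith [ht.1]⟩
  have := norm_le_gronwallBound_right (α := fun t => α (-t)) (α' := fun t => -α' (-t))
    (c := -d) (d := -c) (K := K) (ε := ε) (δ := δ) (t := -t) (fun t ht => ?_) (fun t ht => ?_)
    (by simpa using h0) ⟨by linarith [ht.2], by linarith [ht.1]⟩
  · simpa [sub_eq_neg_add, add_comm] using this
  · have := (hα (-t) (hmaps ht)).scomp t (hasDerivAt_neg t).hasDerivWithinAt hmaps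
    simpa [Function.comp_def] using this
  · simpa using hb _ (hmaps ht)

/-- Split the interval at `s`. By monotonicity of the Grönwall bound, the elapsed time may be
replaced by the full length, so that the estimate does not depend on `t`. -/
theorem norm_le_gronwallBound {α α' : ℝ → F} {c d s K ε δ : ℝ} (hK : 0 ≤ K) (hε : 0 ≤ ε)
    (hα : ∀ t ∈ Icc c d, HasDerivWithinAt α (α' t) (Icc c d) t)
    (hb : ∀ t ∈ Icc c d, ‖α' t‖ ≤ K * ‖α t‖ + ε) (hs : s ∈ Icc c d) (h0 : ‖α s‖ ≤ δ)
    {t : ℝ} (ht : t ∈ Icc c d) :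
    ‖α t‖ ≤ gronwallBound δ K ε (d - c) := by
  have hδ : 0 ≤ δ := (norm_nonneg _).trans h0
  rcases le_total s t with hst | hst
  · have hsub : Icc s d ⊆ Icc c d := Icc_subset_Icc_left hs.1
    refine (norm_le_gronwallBound_right (fun t ht => (hα t (hsub ht)).mono hsub)
      (fun t ht => hb t (hsub ht)) h0 (t := t) ⟨hst, ht.2⟩).trans ?_
    exact gronwallBound_mono hδ hε hK (by linarith [hs.1, ht.2])
  · have hsub : Icc c s ⊆ Icc c d := Icc_subset_Icc_right hs.2
    refine (norm_le_gronwallBound_left (fun t ht => (hα t (hsub ht)).mono hsub)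
      (fun t ht => hb t (hsub ht)) h0 (t := t) ⟨ht.1, hst⟩).trans ?_
    exact gronwallBound_mono hδ hε hK (by linarith [hs.2, ht.1])

/-- The Grönwall bound is linear in the initial error and the forcing term together: an error of
size η in both costs η times a fixed constant. -/
theorem gronwallBound_self_self (η K x : ℝ) :
    gronwallBound η K η x = η * gronwallBound 1 K 1 x := by
  unfold gronwallBound
  split_ifs <;> ring

/-- A solution of a homogeneous linear differential inequality that vanishes once vanishes. -/
theorem eq_zero_of_norm_deriv_le {α α' : ℝ → F} {c d s K : ℝ}
    (hα : ∀ t ∈ Icc c d, HasDerivWithinAt α (α' t) (Icc c d) t)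
    (hb : ∀ t ∈ Icc c d, ‖α' t‖ ≤ K * ‖α t‖) (hs : s ∈ Icc c d) (h0 : α s = 0)
    {t : ℝ} (ht : t ∈ Icc c d) : α t = 0 := by
  have := norm_le_gronwallBound (K := |K|) (ε := 0) (δ := 0) (abs_nonneg K) le_rfl hα
    (fun t ht => ?_) hs (by simp [h0]) ht
  · rw [gronwallBound_ε0_δ0] at this
    exact norm_le_zero_iff.1 this
  · rw [add_zero]
    exact (hb t ht).trans (mul_le_mul_of_nonneg_right (le_abs_self K) (norm_nonneg _))

theorem eqOn_of_hasDerivWithinAt_linear {A : ℝ → F →L[ℝ] F} {B x y : ℝ → F} {c d s : ℝ}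
    (hA : ContinuousOn A (Icc c d))
    (hx : ∀ t ∈ Icc c d, HasDerivWithinAt x (A t (x t) + B t) (Icc c d) t)
    (hy : ∀ t ∈ Icc c d, HasDerivWithinAt y (A t (y t) + B t) (Icc c d) t)
    (hs : s ∈ Icc c d) (h0 : x s = y s) : EqOn x y (Icc c d) := by
  obtain ⟨C, hC⟩ := isCompact_Icc.exists_bound_of_continuousOn hA
  intro t ht
  refine sub_eq_zero.1 (eq_zero_of_norm_deriv_le (α := fun t => x t - y t)
    (α' := fun t => A t (x t - y t)) (K := C) (fun t ht => ?_) (fun t ht => ?_) hs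
    (sub_eq_zero.2 h0) ht)
  · refine ((hx t ht).sub (hy t ht)).congr_deriv ?_
    rw [map_sub]; abel
  · exact (A t).le_of_opNorm_le (hC t ht) _

/-- Global solvability of linear equations on a compact interval. -/
theorem exists_solution_linear [FiniteDimensional ℝ F] {A : ℝ → F →L[ℝ] F} {B : ℝ → F}
    {c d s : ℝ} (hA : ContinuousOn A (Icc c d)) (hB : ContinuousOn B (Icc c d))
    (hs : s ∈ Icc c d) (x₀ : F) :
    ∃ x : ℝ → F, x s = x₀ ∧
      ∀ t ∈ Icc c d, HasDerivWithinAt x (A t (x t) + B t) (Icc c d) t := by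
  have := FiniteDimensional.complete ℝ F
  obtain ⟨C, hC⟩ := isCompact_Icc.exists_bound_of_continuousOn hA
  obtain ⟨b, hb⟩ := isCompact_Icc.exists_bound_of_continuousOn hB
  have hC0 : 0 ≤ C := (norm_nonneg _).trans (hC s hs)
  have hb0 : 0 ≤ b := (norm_nonneg _).trans (hb s hs)
  -- `R` is an a priori bound for solutions. The cut-off field `g` satisfies ‖g y‖ ≤ ‖y‖, so
  -- solutions of the truncated equation obey the same bound and never leave the region where `g` is
  -- the identity.
  set R := gronwallBound ‖x₀‖ C b (d - c) with hR
  have hR0 : 0 < |R| + 1 := by positivity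
  let χ : ContDiffBump (0 : F) := ⟨|R| + 1, |R| + 2, hR0, by linarith⟩
  let g : F → F := fun y => χ y • y
  have hgs : HasCompactSupport g := χ.hasCompactSupport.smul_right
  have hgd : ContDiff ℝ 1 g := χ.contDiff.smul contDiff_id
  obtain ⟨K, hK⟩ := hgd.lipschitzWith_of_hasCompactSupport hgs one_ne_zero
  obtain ⟨G, hG⟩ := hgs.exists_bound_of_continuous hgd.continuous
  have hgle : ∀ y, ‖g y‖ ≤ ‖y‖ := fun y => by
    rw [norm_smul, Real.norm_of_nonneg χ.nonneg]
    exact mul_le_of_le_one_left (norm_nonneg _) χ.le_one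
  have key := exists_solution_of_lipschitz_of_bounded (f := fun t y => A t (g y) + B t)
    hs (K := C.toNNReal * K) (L := C * G + b) (fun t ht => ?_) (fun y => ?_) (fun t ht y => ?_) x₀
  · obtain ⟨x, hx0, hx⟩ := key
    refine ⟨x, hx0, fun t ht => ?_⟩
    have hxt : ‖x t‖ ≤ R := by
      refine norm_le_gronwallBound hC0 hb0 hx (fun t ht => ?_) hs (by rw [hx0]) ht
      refine (norm_add_le _ _).trans (add_le_add ?_ (hb t ht))
      exact ((A t).le_of_opNorm_le (hC t ht) _).trans (by gcongr; exact hgle _)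
    have : g (x t) = x t := by
      have : χ (x t) = 1 := χ.one_of_mem_closedBall (by
        rw [mem_closedBall_zero_iff]
        exact hxt.trans ((le_abs_self R).trans (by change |R| ≤ |R| + 1; linarith)))
      simp [g, this]
    have := hx t ht
    simp only [‹g (x t) = x t›] at this
    exact this
  · refine LipschitzWith.of_dist_le_mul fun y z => ?_
    rw [dist_add_right, dist_eq_norm, ← map_sub, NNReal.coe_mul,
      Real.coe_toNNReal _ hC0, mul_assoc]
    refine ((A t).le_of_opNorm_le (hC t ht) _).trans ?_
    rw [← dist_eq_norm]
    exact mul_le_mul_of_nonneg_left (hK.dist_le_mul y z) hC0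
  · exact (hA.clm_apply continuousOn_const).add hB
  · refine (norm_add_le _ _).trans (add_le_add ?_ (hb t ht))
    exact ((A t).le_of_opNorm_le (hC t ht) _).trans (by gcongr; exact hG _)

/-- Uniform continuity along a compact set of a function of a parameter. -/
theorem eventually_forall_norm_sub_lt {G : Type*} [SeminormedAddCommGroup G]
    {g : ℝ × ℝ → G} {S : Set ℝ} {c d s₀ η : ℝ}
    (hS : IsOpen S) (hg : ContinuousOn g (S ×ˢ Icc c d)) (hs₀ : s₀ ∈ S) (hη : 0 < η) :
    ∀ᶠ s in 𝓝 s₀, ∀ t ∈ Icc c d, ‖g (s, t) - g (s₀, t)‖ < η := by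
  obtain ⟨v, hv, h⟩ := IsCompact.mem_uniformity_of_prod (f := fun s t => g (s, t))
    (k := Icc c d) isCompact_Icc hg hs₀ (Metric.dist_mem_uniformity hη)
  rw [hS.nhdsWithin_eq hs₀] at hv
  filter_upwards [hv] with s hs t ht
  rw [← dist_eq_norm]
  exact h s hs t ht

/-- Continuous dependence of solutions on a parameter. -/
theorem continuousOn_solution {f : ℝ × ℝ × F → F} {z : ℝ × ℝ → F} {S : Set ℝ} {c d : ℝ}
    (hcd : c ≤ d) (hS : IsOpen S)
    (hf : ContinuousOn f (S ×ˢ Icc c d ×ˢ univ))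
    (hlip : ∀ s₀ ∈ S, ∃ K : ℝ, 0 ≤ K ∧ ∀ᶠ s in 𝓝 s₀, ∀ t ∈ Icc c d, ∀ x y,
      ‖f (s, t, x) - f (s, t, y)‖ ≤ K * ‖x - y‖)
    (hz : ∀ s ∈ S, ∀ t ∈ Icc c d,
      HasDerivWithinAt (fun τ => z (s, τ)) (f (s, t, z (s, t))) (Icc c d) t)
    (hz0 : ContinuousOn (fun s => z (s, c)) S) :
    ContinuousOn z (S ×ˢ Icc c d) := by
  rintro ⟨s₀, t₀⟩ ⟨hs₀, ht₀⟩
  have hs₀ : s₀ ∈ S := hs₀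
  have ht₀ : t₀ ∈ Icc c d := ht₀
  obtain ⟨K, hK0, hK⟩ := hlip s₀ hs₀
  set G := gronwallBound 1 K 1 (d - c)
  have hzc : ContinuousOn (fun τ => z (s₀, τ)) (Icc c d) :=
    fun t ht => (hz s₀ hs₀ t ht).continuousWithinAt
  have hcont : ContinuousOn (fun p : ℝ × ℝ => f (p.1, p.2, z (s₀, p.2))) (S ×ˢ Icc c d) := by
    refine hf.comp (continuousOn_fst.prodMk (continuousOn_snd.prodMk
      (hzc.comp continuousOn_snd fun p hp => hp.2))) fun p hp => ⟨hp.1, hp.2, mem_univ _⟩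
  rw [ContinuousWithinAt, tendsto_iff_norm_sub_tendsto_zero]
  -- The right-hand sides differ by a Lipschitz term in the state and by the effect of moving `s`
  -- along the fixed solution `z (s₀, ·)`. The latter is uniformly small by compactness.
  have key : ∀ η > 0, ∀ᶠ s in 𝓝 s₀, ∀ t ∈ Icc c d, ‖z (s, t) - z (s₀, t)‖ ≤ η * G := by
    intro η hη
    have h0 : ∀ᶠ s in 𝓝 s₀, ‖z (s, c) - z (s₀, c)‖ < η := by
      have := (hz0.continuousAt (hS.mem_nhds hs₀))
      simpa [dist_eq_norm] using (Metric.tendsto_nhds.1 this) η hη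
    filter_upwards [h0, eventually_forall_norm_sub_lt hS hcont hs₀ hη, hK, hS.mem_nhds hs₀]
      with s h1 h2 h3 hs t ht
    rw [← gronwallBound_self_self]
    refine norm_le_gronwallBound hK0 hη.le (α := fun t => z (s, t) - z (s₀, t))
      (fun t ht => (hz s hs t ht).sub (hz s₀ hs₀ t ht)) (fun t ht => ?_)
      (left_mem_Icc.2 hcd) h1.le ht
    have : f (s, t, z (s, t)) - f (s₀, t, z (s₀, t)) =
        (f (s, t, z (s, t)) - f (s, t, z (s₀, t))) +
          (f (s, t, z (s₀, t)) - f (s₀, t, z (s₀, t))) := by abel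
    rw [this]
    exact (norm_add_le _ _).trans (add_le_add (h3 t ht _ _) (h2 t ht).le)
  have hG : 0 ≤ G := by
    have := gronwallBound_mono zero_le_one zero_le_one hK0 (sub_nonneg.2 hcd)
    rw [gronwallBound_x0] at this
    exact zero_le_one.trans this
  rw [← tendsto_iff_norm_sub_tendsto_zero, Metric.tendsto_nhds]
  intro ε hε
  have h1 := key (ε / 2 / (G + 1)) (by positivity)
  have h2 : ∀ᶠ t in 𝓝[Icc c d] t₀, ‖z (s₀, t) - z (s₀, t₀)‖ < ε / 2 := by
    simpa [dist_eq_norm] using Metric.tendsto_nhds.1 (hzc t₀ ht₀) (ε / 2) (by positivity)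
  rw [nhdsWithin_prod_eq]
  have h1' := eventually_nhdsWithin_of_eventually_nhds (s := S) h1
  filter_upwards [h1'.prod_mk h2, prod_mem_prod (Filter.univ_mem) self_mem_nhdsWithin]
    with p hp hp'
  rw [dist_eq_norm]
  have : z p - z (s₀, t₀) = (z (p.1, p.2) - z (s₀, p.2)) + (z (s₀, p.2) - z (s₀, t₀)) := by simp
  rw [this]
  refine (norm_add_le _ _).trans_lt ?_
  have e1 := hp.1 p.2 hp'.2
  have e2 := hp.2
  have e3 : ε / 2 / (G + 1) * G ≤ ε / 2 := by
    rw [div_mul_eq_mul_div, div_le_iff₀ (by positivity)]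
    nlinarith
  linarith

end ODE

/-! ### Differentiability of solutions in a parameter. -/

section ParameterDependence

open Metric Filter Asymptotics

variable {F : Type*} [NormedAddCommGroup F] [NormedSpace ℝ F]

/-- Uniform first order expansion: if the derivative of `f χ` tends to `φ` along `l ×ˢ 𝓝 u`, then
`f χ (v χ) - f χ (w χ)` is `φ (v χ - w χ)` to first order when `v` and `w` tend to `u`. -/
theorem isLittleO_sub_sub_of_tendsto_fderiv {α E' F' : Type*} [NormedAddCommGroup E']
    [NormedSpace ℝ E'] [NormedAddCommGroup F'] [NormedSpace ℝ F'] {l : Filter α} {u : E'}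
    {v w : α → E'} (hv : Tendsto v l (𝓝 u)) (hw : Tendsto w l (𝓝 u)) {f : α → E' → F'}
    {f' : α → E' → E' →L[ℝ] F'} (df' : ∀ᶠ p in l ×ˢ 𝓝 u, HasFDerivAt (f p.1) (f' p.1 p.2) p.2)
    {φ : E' →L[ℝ] F'} (cf' : Tendsto (fun p : α × E' => f' p.1 p.2) (l ×ˢ 𝓝 u) (𝓝 φ)) :
    (fun χ => f χ (v χ) - f χ (w χ) - φ (v χ - w χ)) =o[l] fun χ => v χ - w χ := by
  rw [isLittleO_iff]
  intro ε hε
  have cf'' := (Metric.tendsto_nhds.1 cf') ε hε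
  filter_upwards [
    Eventually.segment_of_prod_nhds (r := fun χ y => HasFDerivAt (f χ) (f' χ y) y) hw hv df',
    Eventually.segment_of_prod_nhds (r := fun χ y => dist (f' χ y) φ < ε) hw hv cf''] with χ h1 h2
  refine Convex.norm_image_sub_le_of_norm_hasFDerivWithin_le'
    (fun z hz => (h1 z hz).hasFDerivWithinAt) (fun z hz => ?_)
    (convex_segment ..) (left_mem_segment ..) (right_mem_segment ..)
  rw [← dist_eq_norm]
  exact (h2 z hz).le

/-- A function of two real variables is differentiable as soon as it has partial derivatives, the
first of which is continuous. -/
theorem hasFDerivWithinAt_of_partial {z w : ℝ × ℝ → F} {v : F} {S T : Set ℝ} {p₀ : ℝ × ℝ}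
    (hS : IsOpen S) (hp₀ : p₀ ∈ S ×ˢ T)
    (hw : ∀ p ∈ S ×ˢ T, HasDerivAt (fun s => z (s, p.2)) (w p) p.1)
    (hwc : ContinuousWithinAt w (S ×ˢ T) p₀)
    (hv : HasDerivWithinAt (fun t => z (p₀.1, t)) v T p₀.2) :
    HasFDerivWithinAt z ((ContinuousLinearMap.fst ℝ ℝ ℝ).smulRight (w p₀) +
      (ContinuousLinearMap.snd ℝ ℝ ℝ).smulRight v) (S ×ˢ T) p₀ := by
  have hfst : Tendsto (fun p : ℝ × ℝ => p.1) (𝓝[S ×ˢ T] p₀) (𝓝 p₀.1) :=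
    continuous_fst.continuousWithinAt
  have hsnd : Tendsto (fun p : ℝ × ℝ => p.2) (𝓝[S ×ˢ T] p₀) (𝓝[T] p₀.2) :=
    tendsto_nhdsWithin_iff.2 ⟨continuous_snd.continuousWithinAt,
      eventually_mem_nhdsWithin.mono fun p hp => hp.2⟩
  have hmem : ∀ᶠ q : (ℝ × ℝ) × ℝ in (𝓝[S ×ˢ T] p₀) ×ˢ 𝓝 p₀.1,
      ((q.2, q.1.2) : ℝ × ℝ) ∈ S ×ˢ T := by
    have h1 : ∀ᶠ q : ℝ × ℝ in 𝓝[S ×ˢ T] p₀, q.2 ∈ T :=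
      eventually_mem_nhdsWithin.mono fun p hp => hp.2
    have h2 : ∀ᶠ s in 𝓝 p₀.1, s ∈ S := by
      exact hS.mem_nhds hp₀.1
    exact (h1.prod_mk h2).mono fun q hq => ⟨hq.2, hq.1⟩
  -- Go from `p₀` to `χ` first in time, with the first coordinate fixed at `p₀.1`, then in the first
  -- coordinate at time `χ.2`. Continuity of `w` at `p₀` makes the second expansion uniform in
  -- `χ.2`.
  have key := isLittleO_sub_sub_of_tendsto_fderiv (l := 𝓝[S ×ˢ T] p₀) (u := p₀.1)
    (v := fun χ : ℝ × ℝ => χ.1) (w := fun _ => p₀.1) hfst tendsto_const_nhds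
    (f := fun χ s => z (s, χ.2))
    (f' := fun χ s => ContinuousLinearMap.toSpanSingleton ℝ (w (s, χ.2)))
    (φ := ContinuousLinearMap.toSpanSingleton ℝ (w p₀))
    (df' := hmem.mono fun q hq => by
      exact (hw _ hq).hasFDerivAt)
    (cf' := by
      have hc : Continuous fun y : F => ContinuousLinearMap.toSpanSingleton ℝ y :=
        (ContinuousLinearMap.toSpanSingletonCLE (𝕜 := ℝ) (E := F)).continuous
      refine (hc.tendsto _).comp (hwc.tendsto.comp ?_)
      refine tendsto_nhdsWithin_iff.2 ⟨?_, hmem⟩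
      have h1 : Tendsto (fun q : (ℝ × ℝ) × ℝ => q.2) ((𝓝[S ×ˢ T] p₀) ×ˢ 𝓝 p₀.1)
          (𝓝 p₀.1) := by exact tendsto_snd
      have h2 : Tendsto (fun q : (ℝ × ℝ) × ℝ => q.1.2) ((𝓝[S ×ˢ T] p₀) ×ˢ 𝓝 p₀.1)
          (𝓝 p₀.2) := (hsnd.mono_right nhdsWithin_le_nhds).comp tendsto_fst
      exact h1.prodMk_nhds h2)
  have key2 := (hasDerivWithinAt_iff_isLittleO.1 hv).comp_tendsto hsnd
  rw [hasFDerivWithinAt_iff_isLittleO]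
  have e1 : (fun χ : ℝ × ℝ => χ.1 - p₀.1) =O[𝓝[S ×ˢ T] p₀] fun χ => χ - p₀ :=
    isBigO_fst_prod' (f' := fun χ : ℝ × ℝ => χ - p₀)
  have e2 : (fun χ : ℝ × ℝ => χ.2 - p₀.2) =O[𝓝[S ×ˢ T] p₀] fun χ => χ - p₀ :=
    isBigO_snd_prod' (f' := fun χ : ℝ × ℝ => χ - p₀)
  refine ((key.trans_isBigO e1).add (key2.trans_isBigO e2)).congr_left fun χ => ?_
  simp only [Function.comp_apply, ContinuousLinearMap.toSpanSingleton_apply,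
    add_apply, ContinuousLinearMap.smulRight_apply,
    ContinuousLinearMap.coe_fst', ContinuousLinearMap.coe_snd', Prod.fst_sub, Prod.snd_sub]
  abel

/-- The inclusion of the parameter and the state among (parameter, time, state). -/
def paramStateIncl (F : Type*) [NormedAddCommGroup F] [NormedSpace ℝ F] :
    ℝ × F →L[ℝ] ℝ × ℝ × F :=
  (ContinuousLinearMap.fst ℝ ℝ F).prod
    ((0 : ℝ × F →L[ℝ] ℝ).prod (ContinuousLinearMap.snd ℝ ℝ F))

@[simp] theorem paramStateIncl_apply (y : ℝ × F) : paramStateIncl F y = (y.1, 0, y.2) := rfl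

variable {f : ℝ × ℝ × F → F} {z : ℝ × ℝ → F} {S : Set ℝ} {c d : ℝ}

theorem uniqueDiffOn_param_time_state (hcd : c < d) (hS : IsOpen S) :
    UniqueDiffOn ℝ (S ×ˢ Icc c d ×ˢ (univ : Set F)) :=
  hS.uniqueDiffOn.prod ((uniqueDiffOn_Icc hcd).prod uniqueDiffOn_univ)

/-- First order expansion of the right-hand side, uniformly in time. -/
theorem isLittleO_rhs (hcd : c < d) (hS : IsOpen S)
    (hf : ContDiffOn ℝ 1 f (S ×ˢ Icc c d ×ˢ univ)) (hz : ContinuousOn z (S ×ˢ Icc c d))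
    {s₀ : ℝ} (hs₀ : s₀ ∈ S) :
    (fun p : ℝ × ℝ => f (p.1, p.2, z p) - f (s₀, p.2, z (s₀, p.2)) -
      fderivWithin ℝ f (S ×ˢ Icc c d ×ˢ univ) (s₀, p.2, z (s₀, p.2))
        (p.1 - s₀, 0, z p - z (s₀, p.2)))
      =o[𝓝 s₀ ×ˢ 𝓟 (Icc c d)] fun p => ((p.1 - s₀, z p - z (s₀, p.2)) : ℝ × F) := by
  set D := S ×ˢ Icc c d ×ˢ (univ : Set F) with hD
  set f' := fderivWithin ℝ f D with hf'
  have hf'c : ContinuousOn f' D :=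
    hf.continuousOn_fderivWithin (uniqueDiffOn_param_time_state hcd hS) le_rfl
  set l := 𝓝 s₀ ×ˢ 𝓟 (Icc c d) with hl
  have hmeml : ∀ᶠ p : ℝ × ℝ in l, p ∈ S ×ˢ Icc c d :=
    prod_mem_prod (hS.mem_nhds hs₀) (mem_principal_self _)
  have hz0 : ContinuousOn (fun t => z (s₀, t)) (Icc c d) :=
    hz.comp (continuousOn_const.prodMk continuousOn_id) fun t ht => ⟨hs₀, ht⟩
  let g : ℝ × F → ℝ → (ℝ × F →L[ℝ] F) := fun y t =>
    (f' (s₀ + y.1, t, z (s₀, t) + y.2)).comp (paramStateIncl F)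
  let O : Set (ℝ × F) := {y | s₀ + y.1 ∈ S}
  have hO : IsOpen O := hS.preimage (by fun_prop)
  have hO0 : (0 : ℝ × F) ∈ O := by simpa [O] using hs₀
  have hg : ContinuousOn (Function.uncurry g) (O ×ˢ Icc c d) := by
    refine ContinuousOn.clm_comp (hf'c.comp ?_ ?_) continuousOn_const
    · refine ContinuousOn.prodMk (by fun_prop) (ContinuousOn.prodMk continuousOn_snd ?_)
      exact (hz0.comp continuousOn_snd fun p hp => hp.2).add (by fun_prop)
    · exact fun p hp => ⟨hp.1, hp.2, mem_univ _⟩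
  have hv : Tendsto (fun p : ℝ × ℝ => ((p.1 - s₀, z p - z (s₀, p.2)) : ℝ × F)) l (𝓝 0) := by
    refine Tendsto.prodMk_nhds ?_ ?_
    · have h := (tendsto_fst (f := 𝓝 s₀) (g := 𝓟 (Icc c d)))
      simpa using h.sub_const s₀
    · rw [Metric.tendsto_nhds]
      intro η hη
      rw [hl, eventually_prod_principal_iff]
      simpa using eventually_forall_norm_sub_lt hS hz hs₀ hη
  -- The derivative at zero displacement depends on time. Subtracting its linear map `g 0 p.2` makes
  -- the limit derivative the single map 0; compactness in time gives the convergence.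
  have key := isLittleO_sub_sub_of_tendsto_fderiv (l := l) (u := (0 : ℝ × F))
    (v := fun p : ℝ × ℝ => ((p.1 - s₀, z p - z (s₀, p.2)) : ℝ × F))
    (w := fun _ => 0) hv tendsto_const_nhds
    (f := fun p y => f (s₀ + y.1, p.2, z (s₀, p.2) + y.2) - g 0 p.2 y)
    (f' := fun p y => g y p.2 - g 0 p.2) (φ := 0)
    (df' := by
      have h1 : ∀ᶠ q : (ℝ × ℝ) × (ℝ × F) in l ×ˢ 𝓝 (0 : ℝ × F),
          q.1 ∈ S ×ˢ Icc c d ∧ q.2 ∈ O := by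
        exact hmeml.prod_mk (hO.mem_nhds hO0)
      refine h1.mono fun q hq => ?_
      refine HasFDerivAt.sub ?_ (g 0 q.1.2).hasFDerivAt
      have hq' : (s₀ + q.2.1, q.1.2, z (s₀, q.1.2) + q.2.2) ∈ D := ⟨hq.2, hq.1.2, mem_univ _⟩
      have hd := (hf.differentiableOn one_ne_zero _ hq').hasFDerivWithinAt
      have hi : HasFDerivAt (fun y : ℝ × F => (s₀ + y.1, q.1.2, z (s₀, q.1.2) + y.2))
          (paramStateIncl F) q.2 :=
        (hasFDerivAt_fst.const_add _).prodMk
          ((hasFDerivAt_const _ _).prodMk (hasFDerivAt_snd.const_add _))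
      have hmaps : MapsTo (fun y : ℝ × F => (s₀ + y.1, q.1.2, z (s₀, q.1.2) + y.2)) O D :=
        fun y hy => ⟨hy, hq.1.2, mem_univ _⟩
      exact (hd.comp q.2 (hi.hasFDerivWithinAt (s := O)) hmaps).hasFDerivAt (hO.mem_nhds hq.2))
    (cf' := by
      rw [Metric.tendsto_nhds]
      intro η hη
      obtain ⟨V, hV, h⟩ := isCompact_Icc.mem_uniformity_of_prod hg hO0
        (Metric.dist_mem_uniformity hη)
      rw [hO.nhdsWithin_eq hO0] at hV
      have h1 : ∀ᶠ q : (ℝ × ℝ) × (ℝ × F) in l ×ˢ 𝓝 (0 : ℝ × F),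
          q.1 ∈ S ×ˢ Icc c d ∧ q.2 ∈ V := by
        exact hmeml.prod_mk hV
      refine h1.mono fun q hq => ?_
      have := h q.2 hq.2 q.1.2 hq.1.2
      rw [Set.mem_ofPred_eq, dist_eq_norm] at this
      rw [dist_zero_right]
      exact this)
  simp only [sub_zero, zero_apply] at key
  refine key.congr_left fun p => ?_
  have h0 : ((0, 0, 0) : ℝ × ℝ × F) = 0 := rfl
  simp [g, h0]
  abel

/-- Differentiability of solutions with respect to a parameter; the derivative solves the
linearised equation. -/
theorem hasDerivAt_solution (hcd : c < d) (hS : IsOpen S)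
    (hf : ContDiffOn ℝ 1 f (S ×ˢ Icc c d ×ˢ univ)) (hzc : ContinuousOn z (S ×ˢ Icc c d))
    (hz : ∀ s ∈ S, ∀ t ∈ Icc c d,
      HasDerivWithinAt (fun τ => z (s, τ)) (f (s, t, z (s, t))) (Icc c d) t)
    {s₀ : ℝ} (hs₀ : s₀ ∈ S) {w : ℝ → F} (hz0 : HasDerivAt (fun s => z (s, c)) (w c) s₀)
    (hw : ∀ t ∈ Icc c d, HasDerivWithinAt w
      (fderivWithin ℝ f (S ×ˢ Icc c d ×ˢ univ) (s₀, t, z (s₀, t)) (1, 0, w t)) (Icc c d) t)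
    {t₀ : ℝ} (ht₀ : t₀ ∈ Icc c d) :
    HasDerivAt (fun s => z (s, t₀)) (w t₀) s₀ := by
  have hlo := isLittleO_rhs hcd hS hf hzc hs₀
  set D := S ×ˢ Icc c d ×ˢ (univ : Set F) with hD
  set f' := fderivWithin ℝ f D with hf'
  have hf'c : ContinuousOn f' D :=
    hf.continuousOn_fderivWithin (uniqueDiffOn_param_time_state hcd hS) le_rfl
  have hz0c : ContinuousOn (fun t => z (s₀, t)) (Icc c d) :=
    fun t ht => (hz s₀ hs₀ t ht).continuousWithinAt
  obtain ⟨C, hC⟩ := isCompact_Icc.exists_bound_of_continuousOn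
    (hf'c.comp (continuousOn_const.prodMk (continuousOn_id.prodMk hz0c))
      fun t ht => ⟨hs₀, ht, mem_univ _⟩)
  obtain ⟨W, hW⟩ := isCompact_Icc.exists_bound_of_continuousOn
    (fun t ht => (hw t ht).continuousWithinAt : ContinuousOn w (Icc c d))
  have hC0 : 0 ≤ C := (norm_nonneg _).trans (hC t₀ ht₀)
  have hW0 : 0 ≤ W := (norm_nonneg _).trans (hW t₀ ht₀)
  set G := gronwallBound 1 (C + 1) 1 (d - c) with hGdef
  have hG : 0 ≤ G := by
    have := gronwallBound_mono zero_le_one zero_le_one (by positivity : 0 ≤ C + 1)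
      (sub_nonneg.2 hcd.le)
    rw [gronwallBound_x0] at this
    exact zero_le_one.trans this
  rw [hasDerivAt_iff_isLittleO, isLittleO_iff]
  intro ε hε
  -- The condition η ≤ 1 lets the term η‖r‖ be absorbed into the growth rate `C + 1`; the second
  -- condition is what the final Grönwall estimate needs.
  obtain ⟨η, hη, hη1, hηε⟩ : ∃ η > 0, η ≤ 1 ∧ η * ((1 + W) * G) ≤ ε := by
    refine ⟨min 1 (ε / ((1 + W) * G + 1)), by positivity, min_le_left _ _, ?_⟩
    calc min 1 (ε / ((1 + W) * G + 1)) * ((1 + W) * G)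
        ≤ ε / ((1 + W) * G + 1) * ((1 + W) * G) := by gcongr; exact min_le_right _ _
      _ ≤ ε := by
        rw [div_mul_eq_mul_div, div_le_iff₀ (by positivity)]
        nlinarith
  have h1 := hlo.def hη
  rw [eventually_prod_principal_iff] at h1
  filter_upwards [h1, (hasDerivAt_iff_isLittleO.1 hz0).def hη, hS.mem_nhds hs₀] with s h1 h2 hs
  -- The remainder of the first order expansion in `s` satisfies a linear differential inequality in
  -- `t` whose forcing term and initial value are O(η|s - s₀|).
  let r : ℝ → F := fun t => z (s, t) - z (s₀, t) - (s - s₀) • w t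
  let r' : ℝ → F := fun t => f (s, t, z (s, t)) - f (s₀, t, z (s₀, t)) -
    (s - s₀) • f' (s₀, t, z (s₀, t)) (1, 0, w t)
  have hr : ∀ t ∈ Icc c d, HasDerivWithinAt r (r' t) (Icc c d) t := fun t ht =>
    ((hz s hs t ht).sub (hz s₀ hs₀ t ht)).sub ((hw t ht).const_smul _)
  have hbound : ∀ t ∈ Icc c d, ‖r' t‖ ≤ (C + 1) * ‖r t‖ + η * (1 + W) * ‖s - s₀‖ := by
    intro t ht
    have e : r' t = (f (s, t, z (s, t)) - f (s₀, t, z (s₀, t)) -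
        f' (s₀, t, z (s₀, t)) (s - s₀, 0, z (s, t) - z (s₀, t))) +
        f' (s₀, t, z (s₀, t)) (0, 0, r t) := by
      have : ((0, 0, r t) : ℝ × ℝ × F) = (s - s₀, 0, z (s, t) - z (s₀, t)) -
          (s - s₀) • ((1, 0, w t) : ℝ × ℝ × F) := by
        simp [r]
      rw [this, map_sub, map_smul]
      simp only [r']
      abel
    have e1 := h1 t ht
    have e2 : ‖((s - s₀, z (s, t) - z (s₀, t)) : ℝ × F)‖ ≤ ‖r t‖ + (1 + W) * ‖s - s₀‖ := by
      have hzr : z (s, t) - z (s₀, t) = r t + (s - s₀) • w t := by simp [r]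
      have hle : ‖z (s, t) - z (s₀, t)‖ ≤ ‖r t‖ + ‖s - s₀‖ * W := by
        rw [hzr]
        refine (norm_add_le _ _).trans ?_
        rw [norm_smul]
        gcongr
        exact hW t ht
      rw [Prod.norm_def]
      refine max_le ?_ (hle.trans ?_)
      · have := norm_nonneg (r t)
        have := mul_nonneg hW0 (norm_nonneg (s - s₀))
        dsimp only
        linarith
      · have := norm_nonneg (s - s₀)
        linarith
    have e3 : ‖f' (s₀, t, z (s₀, t)) (0, 0, r t)‖ ≤ C * ‖r t‖ := by
      refine (ContinuousLinearMap.le_of_opNorm_le _ (hC t ht) _).trans_eq ?_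
      simp [Prod.norm_def]
    rw [e]
    refine (norm_add_le _ _).trans ((add_le_add e1 e3).trans ?_)
    have e4 : η * ‖((s - s₀, z (s, t) - z (s₀, t)) : ℝ × F)‖ ≤
        η * (‖r t‖ + (1 + W) * ‖s - s₀‖) := by gcongr
    have e5 : η * ‖r t‖ ≤ 1 * ‖r t‖ := by gcongr
    linarith
  have hδ0 : 0 ≤ η * (1 + W) * ‖s - s₀‖ := by positivity
  have hrc : ‖r c‖ ≤ η * (1 + W) * ‖s - s₀‖ := by
    refine h2.trans ?_
    have : η * ‖s - s₀‖ * 1 ≤ η * ‖s - s₀‖ * (1 + W) := by gcongr; linarith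
    linarith
  have := norm_le_gronwallBound (by positivity : 0 ≤ C + 1) hδ0 hr hbound
    (left_mem_Icc.2 hcd.le) hrc ht₀
  rw [gronwallBound_self_self] at this
  refine this.trans ?_
  calc η * (1 + W) * ‖s - s₀‖ * G = η * ((1 + W) * G) * ‖s - s₀‖ := by ring
    _ ≤ ε * ‖s - s₀‖ := by gcongr

end ParameterDependence

/-! ### Smoothness of solutions jointly in time and parameter. -/

section SmoothDependence

open Metric Filter

universe u

/-- Smooth dependence of solutions on a parameter, jointly with time. -/
theorem contDiffOn_solution_nat (n : ℕ) : ∀ {F : Type u} [NormedAddCommGroup F] [NormedSpace ℝ F]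
    [FiniteDimensional ℝ F] {f : ℝ × ℝ × F → F} {z : ℝ × ℝ → F} {S : Set ℝ} {c d : ℝ}
    (_ : c < d) (_ : IsOpen S) (_ : ContDiffOn ℝ ∞ f (S ×ˢ Icc c d ×ˢ univ))
    (_ : ContinuousOn z (S ×ˢ Icc c d))
    (_ : ∀ s ∈ S, ∀ t ∈ Icc c d,
      HasDerivWithinAt (fun τ => z (s, τ)) (f (s, t, z (s, t))) (Icc c d) t)
    (_ : ContDiffOn ℝ ∞ (fun s => z (s, c)) S),
    ContDiffOn ℝ n z (S ×ˢ Icc c d) := by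
  -- The state space stays universally quantified because the inductive step applies the hypothesis
  -- to `F × F`.
  induction n with
  | zero =>
    intro F _ _ _ f z S c d _ _ _ hzc _ _
    exact contDiffOn_zero.2 hzc
  | succ n ih =>
    intro F _ _ _ f z S c d hcd hS hf hzc hz hz0
    set D := S ×ˢ Icc c d ×ˢ (univ : Set F) with hD
    have hDu : UniqueDiffOn ℝ D := uniqueDiffOn_param_time_state hcd hS
    set f' := fderivWithin ℝ f D with hf'
    have hf'd : ContDiffOn ℝ ∞ f' D := hf.fderivWithin hDu (by norm_cast)
    have hmaps : MapsTo (fun p : ℝ × ℝ => (p.1, p.2, z p)) (S ×ˢ Icc c d) D :=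
      fun p hp => ⟨hp.1, hp.2, mem_univ _⟩
    have hzp : ContinuousOn (fun p : ℝ × ℝ => (p.1, p.2, z p)) (S ×ˢ Icc c d) :=
      continuousOn_fst.prodMk (continuousOn_snd.prodMk hzc)
    have hf'z : ContinuousOn (fun p : ℝ × ℝ => f' (p.1, p.2, z p)) (S ×ˢ Icc c d) :=
      hf'd.continuousOn.comp hzp hmaps
    let ι : F →L[ℝ] ℝ × ℝ × F :=
      (ContinuousLinearMap.inr ℝ ℝ (ℝ × F)).comp (ContinuousLinearMap.inr ℝ ℝ F)
    -- Candidate for ∂ₛz: the solution of the variational equation with the derivative of the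
    -- initial value.
    have hw : ∀ s ∈ S, ∃ w : ℝ → F, w c = deriv (fun s => z (s, c)) s ∧ ∀ t ∈ Icc c d,
        HasDerivWithinAt w (f' (s, t, z (s, t)) (1, 0, w t)) (Icc c d) t := by
      intro s hs
      have hc : ContinuousOn (fun t => f' (s, t, z (s, t))) (Icc c d) :=
        hf'z.comp (continuousOn_const.prodMk continuousOn_id) fun t ht => ⟨hs, ht⟩
      obtain ⟨w, hw0, hw⟩ := exists_solution_linear
        (A := fun t => (f' (s, t, z (s, t))).comp ι) (B := fun t => f' (s, t, z (s, t)) (1, 0, 0))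
        (hc.clm_comp continuousOn_const) (hc.clm_apply continuousOn_const)
        (left_mem_Icc.2 hcd.le) (deriv (fun s => z (s, c)) s)
      refine ⟨w, hw0, fun t ht => (hw t ht).congr_deriv ?_⟩
      rw [ContinuousLinearMap.comp_apply, ← map_add]
      simp [ι]
    choose! w hw0 hw using hw
    let W : ℝ × ℝ → F := fun p => w p.1 p.2
    have hderiv : ContDiffOn ℝ ∞ (fun s => deriv (fun s => z (s, c)) s) S :=
      hz0.deriv_of_isOpen hS (by norm_cast)
    have hW0 : ContDiffOn ℝ ∞ (fun s => W (s, c)) S := hderiv.congr fun s hs => hw0 s hs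
    have hWc : ContinuousOn W (S ×ˢ Icc c d) := by
      refine continuousOn_solution (f := fun q => f' (q.1, q.2.1, z (q.1, q.2.1)) (1, 0, q.2.2))
        hcd.le hS ?_ ?_ (fun s hs t ht => hw s hs t ht) hW0.continuousOn
      · refine ContinuousOn.clm_apply ?_ (by fun_prop)
        exact hf'z.comp (f := fun q : ℝ × ℝ × F => (q.1, q.2.1)) (by fun_prop)
          fun q hq => ⟨hq.1, hq.2.1⟩
      · intro s₀ hs₀
        obtain ⟨C, hC⟩ := isCompact_Icc.exists_bound_of_continuousOn
          (hf'z.comp (continuousOn_const.prodMk continuousOn_id) fun t ht => ⟨hs₀, ht⟩ :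
            ContinuousOn (fun t => f' (s₀, t, z (s₀, t))) (Icc c d))
        have hC0 : 0 ≤ C := (norm_nonneg _).trans (hC c (left_mem_Icc.2 hcd.le))
        refine ⟨C + 1, by positivity, ?_⟩
        filter_upwards [eventually_forall_norm_sub_lt hS hf'z hs₀ one_pos] with s hs t ht x y
        rw [← map_sub]
        have h1 : ‖f' (s, t, z (s, t))‖ ≤ C + 1 := by
          have := norm_add_le (f' (s₀, t, z (s₀, t)))
            (f' (s, t, z (s, t)) - f' (s₀, t, z (s₀, t)))
          rw [add_sub_cancel] at this
          have h2 : ‖f' (s₀, t, z (s₀, t))‖ ≤ C := hC t ht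
          have h3 := hs t ht
          linarith
        refine (ContinuousLinearMap.le_of_opNorm_le _ h1 _).trans_eq ?_
        simp [Prod.norm_def]
    have hzw : ∀ p ∈ S ×ˢ Icc c d, HasDerivAt (fun s => z (s, p.2)) (W p) p.1 := by
      intro p hp
      refine hasDerivAt_solution hcd hS (hf.of_le (by norm_cast)) hzc hz hp.1 (w := w p.1) ?_
        (hw p.1 hp.1) hp.2
      rw [hw0 p.1 hp.1]
      exact ((hz0.contDiffAt (hS.mem_nhds hp.1)).differentiableAt (by simp)).hasDerivAt
    -- The solution together with its parameter derivative solves a smooth equation of the same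
    -- kind. Since ∂ₜz is the right-hand side along `z`, both partial derivatives of `z` are then of
    -- class C^n.
    have hpair : ContDiffOn ℝ n (fun p => (z p, W p)) (S ×ˢ Icc c d) := by
      refine ih (F := F × F)
        (f := fun q => (f (q.1, q.2.1, q.2.2.1), f' (q.1, q.2.1, q.2.2.1) (1, 0, q.2.2.2)))
        hcd hS ?_ (hzc.prodMk hWc) (fun s hs t ht => (hz s hs t ht).prodMk (hw s hs t ht))
        (hz0.prodMk hW0)
      have hm : MapsTo (fun q : ℝ × ℝ × F × F => (q.1, q.2.1, q.2.2.1))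
          (S ×ˢ Icc c d ×ˢ univ) D := fun q hq => ⟨hq.1, hq.2.1, mem_univ _⟩
      refine (hf.comp (by fun_prop) hm).prodMk (ContDiffOn.clm_apply ?_ (by fun_prop))
      exact hf'd.comp (f := fun q : ℝ × ℝ × F × F => (q.1, q.2.1, q.2.2.1)) (by fun_prop) hm
    have hu : UniqueDiffOn ℝ (S ×ˢ Icc c d) := hS.uniqueDiffOn.prod (uniqueDiffOn_Icc hcd)
    have hzn : ContDiffOn ℝ n z (S ×ˢ Icc c d) := hpair.fst
    rw [Nat.cast_add, Nat.cast_one, contDiffOn_succ_iff_hasFDerivWithinAt_of_uniqueDiffOn hu]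
    refine ⟨fun h => by simp at h, _, ?_, fun p hp =>
      hasFDerivWithinAt_of_partial hS hp hzw (hWc p hp) (hz p.1 hp.1 p.2 hp.2)⟩
    have hfz : ContDiffOn ℝ n (fun p : ℝ × ℝ => f (p.1, p.2, z (p.1, p.2))) (S ×ˢ Icc c d) :=
      (hf.of_le (by exact_mod_cast le_top)).comp
        (contDiffOn_fst.prodMk (contDiffOn_snd.prodMk hzn)) hmaps
    exact (contDiffOn_const.smulRight hpair.snd).add (contDiffOn_const.smulRight hfz)

theorem contDiffOn_solution {F : Type u} [NormedAddCommGroup F] [NormedSpace ℝ F]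
    [FiniteDimensional ℝ F] {f : ℝ × ℝ × F → F} {z : ℝ × ℝ → F} {S : Set ℝ} {c d : ℝ}
    (hcd : c < d) (hS : IsOpen S) (hf : ContDiffOn ℝ ∞ f (S ×ˢ Icc c d ×ˢ univ))
    (hzc : ContinuousOn z (S ×ˢ Icc c d))
    (hz : ∀ s ∈ S, ∀ t ∈ Icc c d,
      HasDerivWithinAt (fun τ => z (s, τ)) (f (s, t, z (s, t))) (Icc c d) t)
    (hz0 : ContDiffOn ℝ ∞ (fun s => z (s, c)) S) :
    ContDiffOn ℝ ∞ z (S ×ˢ Icc c d) :=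
  contDiffOn_infty.2 fun n => contDiffOn_solution_nat n hcd hS hf hzc hz hz0

end SmoothDependence

/-! ### Partial derivatives on an open set times a closed interval. -/

section TwoVariables

variable {F : Type*} [NormedAddCommGroup F] [NormedSpace ℝ F]
  {γ : ℝ × ℝ → F} {S : Set ℝ} {c d : ℝ}

theorem uniqueDiffOn_prod_Icc (hcd : c < d) (hS : IsOpen S) : UniqueDiffOn ℝ (S ×ˢ Icc c d) :=
  hS.uniqueDiffOn.prod (uniqueDiffOn_Icc hcd)

theorem hasDerivWithinAt_snd_of_prod {L : ℝ × ℝ →L[ℝ] F} {T : Set ℝ} {p : ℝ × ℝ}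
    (h : HasFDerivWithinAt γ L (S ×ˢ T) p) (hp : p.1 ∈ S) :
    HasDerivWithinAt (fun t => γ (p.1, t)) (L (0, 1)) T p.2 :=
  h.comp_hasDerivWithinAt (f := fun t => (p.1, t)) p.2
    ((hasDerivWithinAt_const p.2 T p.1).prodMk (hasDerivWithinAt_id p.2 T)) fun _ ht => ⟨hp, ht⟩

theorem hasDerivAt_fst_of_prod {L : ℝ × ℝ →L[ℝ] F} {T : Set ℝ} {p : ℝ × ℝ}
    (hS : IsOpen S) (h : HasFDerivWithinAt γ L (S ×ˢ T) p) (hp : p ∈ S ×ˢ T) :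
    HasDerivAt (fun s => γ (s, p.2)) (L (1, 0)) p.1 :=
  (h.comp_hasDerivWithinAt (f := fun s => (s, p.2)) p.1
    ((hasDerivWithinAt_id p.1 S).prodMk (hasDerivWithinAt_const p.1 S p.2))
      fun _ hs => ⟨hs, hp.2⟩).hasDerivAt (hS.mem_nhds hp.1)

theorem hasFDerivWithinAt_fderivWithin_apply (hcd : c < d) (hS : IsOpen S)
    (hγ : ContDiffOn ℝ ∞ γ (S ×ˢ Icc c d)) {p : ℝ × ℝ} (hp : p ∈ S ×ˢ Icc c d) (e : ℝ × ℝ) :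
    HasFDerivWithinAt (fun q => fderivWithin ℝ γ (S ×ˢ Icc c d) q e)
      ((fderivWithin ℝ (fderivWithin ℝ γ (S ×ˢ Icc c d)) (S ×ˢ Icc c d) p).flip e)
      (S ×ˢ Icc c d) p := by
  have hu := uniqueDiffOn_prod_Icc hcd hS
  have h : ContDiffOn ℝ ∞ (fderivWithin ℝ γ (S ×ˢ Icc c d)) (S ×ˢ Icc c d) :=
    hγ.fderivWithin hu (by norm_cast)
  have h1 := (h.differentiableOn (by simp) p hp).hasFDerivWithinAt
  refine (h1.clm_apply (hasFDerivWithinAt_const e p _)).congr_fderiv ?_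
  ext <;> simp

/-- Equality of the mixed second derivatives, up to the boundary. -/
theorem fderivWithin_fderivWithin_comm (hcd : c < d) (hS : IsOpen S)
    (hγ : ContDiffOn ℝ ∞ γ (S ×ˢ Icc c d)) {p : ℝ × ℝ} (hp : p ∈ S ×ˢ Icc c d) (e e' : ℝ × ℝ) :
    fderivWithin ℝ (fderivWithin ℝ γ (S ×ˢ Icc c d)) (S ×ˢ Icc c d) p e e' =
      fderivWithin ℝ (fderivWithin ℝ γ (S ×ˢ Icc c d)) (S ×ˢ Icc c d) p e' e := by
  refine (hγ p hp).isSymmSndFDerivWithinAt (by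
    rw [minSmoothness_of_isRCLikeNormedField]; exact WithTop.coe_le_coe.2 le_top)
    (uniqueDiffOn_prod_Icc hcd hS) ?_ hp e e'
  -- Symmetry at boundary points holds because the strip lies in the closure of its interior.
  rw [interior_prod_eq, closure_prod_eq, hS.interior_eq, interior_Icc, closure_Ioo hcd.ne]
  exact ⟨subset_closure hp.1, hp.2⟩

theorem contDiffOn_fderivWithin_apply (hcd : c < d) (hS : IsOpen S)
    (hγ : ContDiffOn ℝ ∞ γ (S ×ˢ Icc c d)) (e : ℝ × ℝ) :
    ContDiffOn ℝ ∞ (fun q => fderivWithin ℝ γ (S ×ˢ Icc c d) q e) (S ×ˢ Icc c d) :=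
  (hγ.fderivWithin (uniqueDiffOn_prod_Icc hcd hS) (by norm_cast)).clm_apply contDiffOn_const

end TwoVariables

/-! ### Fields of projections and parallel sections in a chart. -/

section ProjectionField

variable {E : Type*} [NormedAddCommGroup E] [NormedSpace ℝ E]

/-- The linearisation at the path `x`, in the direction `X`, of the equation `P(x) x' = 0`. -/
def linearizedConstraint (P : E → E →L[ℝ] E) (x X : ℝ → E) (J : Set ℝ) (t : ℝ) : E :=
  P (x t) (derivWithin X J t) + fderiv ℝ P (x t) (X t) (derivWithin x J t)

/-- A smooth family of projections on the open set `V`. -/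
structure IsProjectionField (P : E → E →L[ℝ] E) (V : Set E) : Prop where
  isOpen : IsOpen V
  contDiffOn : ContDiffOn ℝ ∞ P V
  idem : ∀ x ∈ V, ∀ v, P x (P x v) = P x v

namespace IsProjectionField

variable {P : E → E →L[ℝ] E} {V : Set E}

theorem differentiableAt (hP : IsProjectionField P V) {x : E} (hx : x ∈ V) :
    DifferentiableAt ℝ P x :=
  (hP.contDiffOn.contDiffAt (hP.isOpen.mem_nhds hx)).differentiableAt (by simp)

theorem compl (hP : IsProjectionField P V) :
    IsProjectionField (fun x => ContinuousLinearMap.id ℝ E - P x) V where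
  isOpen := hP.isOpen
  contDiffOn := contDiffOn_const.sub hP.contDiffOn
  idem x hx v := by simp [hP.idem x hx]

theorem fderiv_compl (P : E → E →L[ℝ] E) (x : E) :
    fderiv ℝ (fun x => ContinuousLinearMap.id ℝ E - P x) x = -fderiv ℝ P x := by
  rw [fderiv_const_sub]

/-- Differentiate P² = P. Two consequences are used repeatedly: DP[v] maps ker P into im P, and P
DP[v] P = 0. -/
theorem fderiv_idem (hP : IsProjectionField P V) {x : E} (hx : x ∈ V) (u v : E) :
    fderiv ℝ P x v (P x u) + P x (fderiv ℝ P x v u) = fderiv ℝ P x v u := by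
  have h := (hP.differentiableAt hx).hasFDerivAt
  have h1 : HasFDerivAt (fun y => P y u) ((fderiv ℝ P x).flip u) x := by
    refine (h.clm_apply (hasFDerivAt_const u x)).congr_fderiv ?_
    ext v; simp
  have h2 := h.clm_apply h1
  have h3 : (fun y => P y u) =ᶠ[𝓝 x] fun y => P y (P y u) := by
    filter_upwards [hP.isOpen.mem_nhds hx] with y hy
    rw [hP.idem y hy]
  have := congrArg (fun L : E →L[ℝ] E => L v) (h1.unique (h2.congr_of_eventuallyEq h3))
  simp only [ContinuousLinearMap.flip_apply, add_apply, ContinuousLinearMap.comp_apply] at this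
  exact (add_comm _ _).trans this.symm

/-- If `P(x) k = k` and `x' ∈ ker P(x)` then the linearised constraint is a linear equation. -/
theorem hasDerivWithinAt_of_parallel (hP : IsProjectionField P V) {x k : ℝ → E} {c d : ℝ}
    (hcd : c < d) {t : ℝ} (ht : t ∈ Icc c d) (hx : DifferentiableOn ℝ x (Icc c d))
    (hxV : ∀ t ∈ Icc c d, x t ∈ V) (hk : DifferentiableOn ℝ k (Icc c d))
    (hPk : ∀ t ∈ Icc c d, P (x t) (k t) = k t)
    (hL : linearizedConstraint P x k (Icc c d) t = 0) :
    HasDerivWithinAt k ((fderiv ℝ P (x t) (derivWithin x (Icc c d) t) -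
      (fderiv ℝ P (x t)).flip (derivWithin x (Icc c d) t)) (k t)) (Icc c d) t := by
  have hk' := (hk t ht).hasDerivWithinAt
  have hx' := (hx t ht).hasDerivWithinAt
  have h1 := (hP.differentiableAt (hxV t ht)).hasFDerivAt.comp_hasDerivWithinAt t hx'
  have h2 := (h1.clm_apply hk').congr (fun τ hτ => (hPk τ hτ).symm) (hPk t ht).symm
  have e := (uniqueDiffOn_Icc hcd t ht).eq_deriv _ hk' h2
  refine hk'.congr_deriv ?_
  unfold linearizedConstraint at hL
  simp only [Function.comp_apply] at e
  rw [e, sub_apply, ContinuousLinearMap.flip_apply,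
    eq_neg_of_add_eq_zero_left hL, sub_eq_add_neg]

theorem contDiffOn_parallel_coeff (hP : IsProjectionField P V) {x : ℝ → E} {c d : ℝ}
    (hcd : c < d) (hx : ContDiffOn ℝ ∞ x (Icc c d)) (hxV : ∀ t ∈ Icc c d, x t ∈ V) :
    ContDiffOn ℝ ∞ (fun t => fderiv ℝ P (x t) (derivWithin x (Icc c d) t) -
      (fderiv ℝ P (x t)).flip (derivWithin x (Icc c d) t)) (Icc c d) := by
  have h1 : ContDiffOn ℝ ∞ (fun t => fderiv ℝ P (x t)) (Icc c d) :=
    (hP.contDiffOn.fderiv_of_isOpen hP.isOpen (by norm_cast)).comp hx hxV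
  have h2 : ContDiffOn ℝ ∞ (derivWithin x (Icc c d)) (Icc c d) :=
    hx.derivWithin (uniqueDiffOn_Icc hcd) (by norm_cast)
  refine (h1.clm_apply h2).sub (ContDiffOn.clm_apply ?_ h2)
  exact (ContinuousLinearMap.flipₗᵢ ℝ E E E).contDiff.comp_contDiffOn h1

theorem eqOn_of_parallel (hP : IsProjectionField P V) {x k l : ℝ → E} {c d s : ℝ}
    (hcd : c < d) (hs : s ∈ Icc c d) (hx : ContDiffOn ℝ ∞ x (Icc c d))
    (hxV : ∀ t ∈ Icc c d, x t ∈ V) (hk : DifferentiableOn ℝ k (Icc c d))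
    (hPk : ∀ t ∈ Icc c d, P (x t) (k t) = k t)
    (hLk : ∀ t ∈ Icc c d, linearizedConstraint P x k (Icc c d) t = 0)
    (hl : DifferentiableOn ℝ l (Icc c d)) (hPl : ∀ t ∈ Icc c d, P (x t) (l t) = l t)
    (hLl : ∀ t ∈ Icc c d, linearizedConstraint P x l (Icc c d) t = 0) (h0 : k s = l s) :
    EqOn k l (Icc c d) := by
  refine eqOn_of_hasDerivWithinAt_linear (B := 0)
    (hP.contDiffOn_parallel_coeff hcd hx hxV).continuousOn (fun t ht => ?_) (fun t ht => ?_) hs h0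
  · simpa using hP.hasDerivWithinAt_of_parallel hcd ht (hx.differentiableOn (by simp)) hxV hk hPk
      (hLk t ht)
  · simpa using hP.hasDerivWithinAt_of_parallel hcd ht (hx.differentiableOn (by simp)) hxV hl hPl
      (hLl t ht)

/-- Solve the linear equation k' = DP[x']k - DP[k]x'. The point is that the solution stays in the
image of P: since P(x)x' = 0, the defect k - Pk satisfies the homogeneous equation with coefficient
-P DP[x'], and it vanishes at `s`. The constraint then follows from the equation. -/
theorem exists_parallel [FiniteDimensional ℝ E] (hP : IsProjectionField P V) {x : ℝ → E}
    {c d s : ℝ} (hcd : c < d) (hs : s ∈ Icc c d) (hx : ContDiffOn ℝ ∞ x (Icc c d))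
    (hxV : ∀ t ∈ Icc c d, x t ∈ V)
    (hx' : ∀ t ∈ Icc c d, P (x t) (derivWithin x (Icc c d) t) = 0)
    {k₀ : E} (hk₀ : P (x s) k₀ = k₀) :
    ∃ k : ℝ → E, k s = k₀ ∧ ContDiffOn ℝ ∞ k (Icc c d) ∧
      ∀ t ∈ Icc c d, P (x t) (k t) = k t ∧ linearizedConstraint P x k (Icc c d) t = 0 := by
  have hA := hP.contDiffOn_parallel_coeff hcd hx hxV
  have hu := uniqueDiffOn_Icc hcd
  obtain ⟨k, hks, hk⟩ := exists_solution_linear (B := 0) hA.continuousOn continuousOn_const hs k₀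
  simp only [Pi.zero_apply, add_zero] at hk
  have hksm : ContDiffOn ℝ ∞ k (Icc c d) := by
    refine ODE.contDiffOn_enat_Icc_of_hasDerivWithinAt (n := ⊤) (u := univ)
      (f := fun t y => (fderiv ℝ P (x t) (derivWithin x (Icc c d) t) -
        (fderiv ℝ P (x t)).flip (derivWithin x (Icc c d) t)) y) ?_ hk (mapsTo_univ _ _)
    exact (hA.comp contDiffOn_fst fun p hp => hp.1).clm_apply contDiffOn_snd
  have hx1 : ∀ t ∈ Icc c d, HasDerivWithinAt x (derivWithin x (Icc c d) t) (Icc c d) t :=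
    fun t ht => (hx.differentiableOn (by simp) t ht).hasDerivWithinAt
  have hk' : ∀ t ∈ Icc c d, derivWithin k (Icc c d) t =
      fderiv ℝ P (x t) (derivWithin x (Icc c d) t) (k t) -
        fderiv ℝ P (x t) (k t) (derivWithin x (Icc c d) t) :=
    fun t ht => (hk t ht).derivWithin (hu t ht)
  have hDP : ContinuousOn (fun t => P (x t) ∘L fderiv ℝ P (x t) (derivWithin x (Icc c d) t))
      (Icc c d) := by
    refine (hP.contDiffOn.continuousOn.comp hx.continuousOn hxV).clm_comp
      (ContinuousOn.clm_apply ?_ ?_)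
    · exact (hP.contDiffOn.continuousOn_fderiv_of_isOpen hP.isOpen (by simp)).comp
        hx.continuousOn hxV
    · exact hx.continuousOn_derivWithin hu (by simp)
  obtain ⟨C, hC⟩ := isCompact_Icc.exists_bound_of_continuousOn hDP
  have hPk : ∀ t ∈ Icc c d, k t - P (x t) (k t) = 0 := by
    intro t ht
    refine eq_zero_of_norm_deriv_le (α := fun t => k t - P (x t) (k t)) (K := C) (s := s)
      (α' := fun t => -(P (x t) ∘L fderiv ℝ P (x t) (derivWithin x (Icc c d) t))
        (k t - P (x t) (k t))) (fun t ht => ?_) (fun t ht => ?_) hs ?_ ht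
    · have h1 := (hP.differentiableAt (hxV t ht)).hasFDerivAt.comp_hasDerivWithinAt t (hx1 t ht)
      refine ((hk t ht).sub (h1.clm_apply (hk t ht))).congr_deriv ?_
      have e1 := hP.fderiv_idem (hxV t ht) (k t) (derivWithin x (Icc c d) t)
      have e2 := hP.fderiv_idem (hxV t ht) (derivWithin x (Icc c d) t) (k t)
      have e3 := hP.fderiv_idem (hxV t ht) (P (x t) (k t)) (derivWithin x (Icc c d) t)
      rw [hP.idem _ (hxV t ht), add_eq_left] at e3
      rw [hx' t ht, map_zero, zero_add] at e2
      simp only [sub_apply, ContinuousLinearMap.flip_apply,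
        ContinuousLinearMap.comp_apply, Function.comp_apply, map_sub, e2, e3]
      abel
    · rw [norm_neg]
      exact ContinuousLinearMap.le_of_opNorm_le _ (hC t ht) _
    · rw [hks, hk₀, sub_self]
  refine ⟨k, hks, hksm, fun t ht => ⟨(sub_eq_zero.1 (hPk t ht)).symm, ?_⟩⟩
  have e2 := hP.fderiv_idem (hxV t ht) (derivWithin x (Icc c d) t) (k t)
  rw [hx' t ht, map_zero, zero_add] at e2
  have e3 := hP.fderiv_idem (hxV t ht) (k t) (derivWithin x (Icc c d) t)
  rw [(sub_eq_zero.1 (hPk t ht)).symm, add_eq_left] at e3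
  rw [linearizedConstraint, hk' t ht, map_sub, e2, e3]
  abel

end IsProjectionField

end ProjectionField

/-! ### Correcting a family of paths into a family of tangent paths. -/

section TangentCorrection

variable {E : Type*} [NormedAddCommGroup E] [NormedSpace ℝ E]

namespace IsProjectionField

open Metric Filter

variable {P : E → E →L[ℝ] E} {V : Set E}

/-- Extension to the whole space of the complementary projections, by a cut-off. -/
theorem contDiff_cutoff_compl [FiniteDimensional ℝ E] (hP : IsProjectionField P V) {x₀ : E}
    (χ : ContDiffBump x₀) (hχ : closedBall x₀ χ.rOut ⊆ V) :
    ContDiff ℝ ∞ fun y => χ y • (ContinuousLinearMap.id ℝ E - P y) := by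
  rw [contDiff_iff_contDiffAt]
  intro y
  by_cases hy : y ∈ closedBall x₀ χ.rOut
  · exact χ.contDiff.contDiffAt.smul
      (hP.compl.contDiffOn.contDiffAt (hP.isOpen.mem_nhds (hχ hy)))
  · have : (fun y => χ y • (ContinuousLinearMap.id ℝ E - P y)) =ᶠ[𝓝 y] fun _ => 0 := by
      filter_upwards [isClosed_closedBall.isOpen_compl.mem_nhds hy] with w hw
      have : χ w = 0 := χ.zero_of_le_dist (le_of_lt (by simpa using hw))
      rw [this, zero_smul]
    exact contDiffAt_const.congr_of_eventuallyEq this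

/-- A variation `γ` of a path tangent to `ker P` satisfying the linearised constraint can be
corrected into a variation through paths tangent to `ker P`, without being changed where it is
already tangent. -/
theorem exists_tangent_variation [FiniteDimensional ℝ E] (hP : IsProjectionField P V)
    {γ : ℝ × ℝ → E} {S : Set ℝ} {c d r : ℝ} {x₀ : E} (hcd : c < d) (hS : IsOpen S) (hS0 : 0 ∈ S)
    (hr : 0 < r) (hV : closedBall x₀ (3 * r) ⊆ V) (hγ : ContDiffOn ℝ ∞ γ (S ×ˢ Icc c d))
    (hγ0 : ∀ t ∈ Icc c d, γ (0, t) ∈ ball x₀ r)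
    (hγH : ∀ t ∈ Icc c d, P (γ (0, t)) (derivWithin (fun t => γ (0, t)) (Icc c d) t) = 0)
    (hγL : ∀ t ∈ Icc c d, linearizedConstraint P (fun t => γ (0, t))
      (fun t => fderivWithin ℝ γ (S ×ˢ Icc c d) (0, t) (1, 0)) (Icc c d) t = 0) :
    ∃ ε > 0, Ioo (-ε) ε ⊆ S ∧ ∃ β : ℝ × ℝ → E,
      ContDiffOn ℝ ∞ β (Ioo (-ε) ε ×ˢ Icc c d) ∧
      (∀ s ∈ Ioo (-ε) ε, ∀ t ∈ Icc c d, β (s, t) ∈ ball x₀ (2 * r)) ∧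
      (∀ t ∈ Icc c d, β (0, t) = γ (0, t)) ∧
      (∀ t ∈ Icc c d, HasDerivAt (fun s => β (s, t))
        (fderivWithin ℝ γ (S ×ˢ Icc c d) (0, t) (1, 0)) 0) ∧
      (∀ s ∈ Ioo (-ε) ε, ∀ t ∈ Icc c d,
        P (β (s, t)) (derivWithin (fun t => β (s, t)) (Icc c d) t) = 0) ∧
      ∀ e ∈ Icc c d, (∀ s ∈ S, ∀ t ∈ Icc c e, γ (s, t) ∈ ball x₀ (2 * r) ∧
          P (γ (s, t)) (derivWithin (fun t => γ (s, t)) (Icc c d) t) = 0) →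
        ∀ s ∈ Ioo (-ε) ε, ∀ t ∈ Icc c e, β (s, t) = γ (s, t) := by
  have := FiniteDimensional.complete ℝ E
  have hu := uniqueDiffOn_Icc hcd
  set Ω := S ×ˢ Icc c d with hΩ
  let χ : ContDiffBump x₀ := ⟨2 * r, 3 * r, by positivity, by linarith⟩
  -- The cut-off makes the field bounded and globally Lipschitz, so solutions exist on the whole
  -- interval. On the ball of radius 2r it is exactly 1 - P.
  let Q : E → E →L[ℝ] E := fun y => χ y • (ContinuousLinearMap.id ℝ E - P y)
  have hQ : ContDiff ℝ ∞ Q := hP.contDiff_cutoff_compl χ hV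
  have hQ1 : ∀ y ∈ ball x₀ (2 * r), Q y = ContinuousLinearMap.id ℝ E - P y := fun y hy => by
    have : χ y = 1 := χ.one_of_mem_closedBall (ball_subset_closedBall hy)
    simp only [Q, this, one_smul]
  have hQs : HasCompactSupport Q := χ.hasCompactSupport.smul_right
  obtain ⟨K, hK⟩ := hQ.lipschitzWith_of_hasCompactSupport hQs (by simp)
  obtain ⟨B, hB⟩ := hQs.exists_bound_of_continuous hQ.continuous
  have hB0 : 0 ≤ B := (norm_nonneg _).trans (hB 0)
  have hbV : ball x₀ (2 * r) ⊆ V :=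
    (ball_subset_closedBall.trans (closedBall_subset_closedBall (by linarith))).trans hV
  have hb : ball x₀ r ⊆ ball x₀ (2 * r) := ball_subset_ball (by linarith)
  let g : ℝ × ℝ → E := fun p => fderivWithin ℝ γ Ω p (0, 1)
  have hg : ContDiffOn ℝ ∞ g Ω := contDiffOn_fderivWithin_apply hcd hS hγ _
  have hγt : ∀ p ∈ Ω, HasDerivWithinAt (fun t => γ (p.1, t)) (g p) (Icc c d) p.2 := fun p hp =>
    hasDerivWithinAt_snd_of_prod (hγ.differentiableOn (by simp) p hp).hasFDerivWithinAt hp.1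
  -- The corrected family solves ∂ₜz = Q(z)∂ₜγ. Where Q = 1 - P the velocity is in ker P, and
  -- wherever γ stays in the ball and is tangent, γ is itself a solution.
  let f : ℝ × ℝ × E → E := fun q => Q q.2.2 (g (q.1, q.2.1))
  have hfd : ContDiffOn ℝ ∞ f (S ×ˢ Icc c d ×ˢ univ) := by
    refine (hQ.comp_contDiffOn (by fun_prop)).clm_apply ?_
    exact hg.comp (f := fun q : ℝ × ℝ × E => (q.1, q.2.1)) (by fun_prop)
      fun q hq => ⟨hq.1, hq.2.1⟩
  have hlipf : ∀ q : ℝ × ℝ, ∀ x y, ‖f (q.1, q.2, x) - f (q.1, q.2, y)‖ ≤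
      K * ‖g q‖ * ‖x - y‖ := by
    intro q x y
    simp only [f]
    rw [← sub_apply]
    refine (ContinuousLinearMap.le_opNorm _ _).trans ?_
    have := hK.dist_le_mul x y
    rw [dist_eq_norm, dist_eq_norm] at this
    calc _ ≤ K * ‖x - y‖ * ‖g q‖ := by gcongr
      _ = _ := by ring
  have hgb : ∀ s ∈ S, ∃ C, 0 ≤ C ∧ ∀ t ∈ Icc c d, ‖g (s, t)‖ ≤ C := by
    intro s hs
    obtain ⟨C, hC⟩ := isCompact_Icc.exists_bound_of_continuousOn
      (hg.continuousOn.comp (continuousOn_const.prodMk continuousOn_id)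
        (fun t ht => ⟨hs, ht⟩ : MapsTo (fun t => (s, t)) (Icc c d) Ω))
    exact ⟨C, (norm_nonneg _).trans (hC c (left_mem_Icc.2 hcd.le)), hC⟩
  have hsol : ∀ s ∈ S, ∃ y : ℝ → E, y c = γ (s, c) ∧
      ∀ t ∈ Icc c d, HasDerivWithinAt y (f (s, t, y t)) (Icc c d) t := by
    intro s hs
    obtain ⟨C, hC0, hC⟩ := hgb s hs
    refine exists_solution_of_lipschitz_of_bounded (f := fun t y => f (s, t, y))
      (K := K * C.toNNReal) (L := B * C) (left_mem_Icc.2 hcd.le) (fun t ht => ?_) (fun x => ?_)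
      (fun t ht x => ?_) _
    · refine LipschitzWith.of_dist_le_mul fun x y => ?_
      rw [dist_eq_norm, dist_eq_norm, NNReal.coe_mul, Real.coe_toNNReal _ hC0]
      refine (hlipf (s, t) x y).trans ?_
      gcongr
      exact hC t ht
    · exact hfd.continuousOn.comp (by fun_prop) fun t ht => ⟨hs, ht, mem_univ _⟩
    · exact (ContinuousLinearMap.le_of_opNorm_le _ (hB _) _).trans (by gcongr; exact hC t ht)
  choose! y hyc hy using hsol
  let z : ℝ × ℝ → E := fun p => y p.1 p.2
  have hz : ∀ s ∈ S, ∀ t ∈ Icc c d,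
      HasDerivWithinAt (fun τ => z (s, τ)) (f (s, t, z (s, t))) (Icc c d) t := hy
  have hz0 : ContDiffOn ℝ ∞ (fun s => z (s, c)) S := by
    refine ContDiffOn.congr (f := fun s => γ (s, c)) ?_ fun s hs => hyc s hs
    exact hγ.comp (f := fun s => (s, c)) (by fun_prop) fun s hs => ⟨hs, left_mem_Icc.2 hcd.le⟩
  have hzc : ContinuousOn z Ω := by
    refine continuousOn_solution hcd.le hS hfd.continuousOn (fun s₀ hs₀ => ?_) hz hz0.continuousOn
    obtain ⟨C, hC0, hC⟩ := hgb s₀ hs₀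
    refine ⟨K * (C + 1), by positivity, ?_⟩
    filter_upwards [eventually_forall_norm_sub_lt hS hg.continuousOn hs₀ one_pos] with s hs t ht u v
    refine (hlipf (s, t) u v).trans ?_
    have h1 : ‖g (s, t)‖ ≤ C + 1 := by
      have := norm_add_le (g (s₀, t)) (g (s, t) - g (s₀, t))
      rw [add_sub_cancel] at this
      linarith [hC t ht, hs t ht]
    gcongr
  have hzd : ContDiffOn ℝ ∞ z Ω := contDiffOn_solution hcd hS hfd hzc hz hz0
  have hagree : ∀ s ∈ S, ∀ e ∈ Icc c d, (∀ t ∈ Icc c e, γ (s, t) ∈ ball x₀ (2 * r) ∧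
      P (γ (s, t)) (derivWithin (fun t => γ (s, t)) (Icc c d) t) = 0) →
      ∀ t ∈ Icc c e, z (s, t) = γ (s, t) := by
    intro s hs e he h t ht
    obtain ⟨C, hC0, hC⟩ := hgb s hs
    have hsub : Icc c e ⊆ Icc c d := Icc_subset_Icc_right he.2
    refine sub_eq_zero.1 (eq_zero_of_norm_deriv_le (α := fun t => z (s, t) - γ (s, t))
      (α' := fun t => f (s, t, z (s, t)) - g (s, t)) (K := K * C)
      (fun t ht => ((hz s hs t (hsub ht)).sub (hγt (s, t) ⟨hs, hsub ht⟩)).mono hsub)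
      (fun t ht => ?_) (left_mem_Icc.2 he.1) ?_ ht)
    · have e1 : g (s, t) = f (s, t, γ (s, t)) := by
        have h2 := (h t ht).2
        rw [(hγt (s, t) ⟨hs, hsub ht⟩).derivWithin (hu t (hsub ht))] at h2
        simp only [f]
        rw [hQ1 _ (h t ht).1, sub_apply, h2]
        simp
      nth_rw 1 [e1]
      refine (hlipf (s, t) _ _).trans ?_
      gcongr
      exact hC t (hsub ht)
    · exact sub_eq_zero.2 (hyc s hs)
  have hinit : ∀ t ∈ Icc c d, z (0, t) = γ (0, t) :=
    hagree 0 hS0 d (right_mem_Icc.2 hcd.le) fun t ht => ⟨hb (hγ0 t ht), hγH t ht⟩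
  let X : ℝ → E := fun t => fderivWithin ℝ γ Ω (0, t) (1, 0)
  have hX : ∀ t ∈ Icc c d, HasDerivWithinAt X
      (fderivWithin ℝ (fderivWithin ℝ γ Ω) Ω (0, t) (1, 0) (0, 1)) (Icc c d) t := by
    intro t ht
    have h1 := hasDerivWithinAt_snd_of_prod
      (hasFDerivWithinAt_fderivWithin_apply hcd hS hγ (p := (0, t)) ⟨hS0, ht⟩ (1, 0)) hS0
    rw [ContinuousLinearMap.flip_apply,
      fderivWithin_fderivWithin_comm hcd hS hγ (p := (0, t)) ⟨hS0, ht⟩] at h1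
    exact h1
  -- The variational equation at s = 0 reads w' = (1 - P)X' - DP[w]x'. For w = X the right-hand side
  -- is X' minus the linearised constraint, that is X'.
  have hder : ∀ t ∈ Icc c d, HasDerivAt (fun s => z (s, t)) (X t) 0 := by
    intro t ht
    refine hasDerivAt_solution hcd hS (hfd.of_le (by norm_cast)) hzc hz hS0 (w := X) ?_ ?_ ht
    · have hcI : c ∈ Icc c d := left_mem_Icc.2 hcd.le
      have h1 := hasDerivAt_fst_of_prod hS (hγ.differentiableOn (by simp) (0, c)
        ⟨hS0, hcI⟩).hasFDerivWithinAt ⟨hS0, hcI⟩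
      refine h1.congr_of_eventuallyEq ?_
      filter_upwards [hS.mem_nhds hS0] with s hs using hyc s hs
    · intro t ht
      refine (hX t ht).congr_deriv ?_
      have hD : UniqueDiffOn ℝ (S ×ˢ Icc c d ×ˢ (univ : Set E)) :=
        uniqueDiffOn_param_time_state hcd hS
      have hmem : ((0, t, z (0, t)) : ℝ × ℝ × E) ∈ S ×ˢ Icc c d ×ˢ (univ : Set E) :=
        ⟨hS0, ht, mem_univ _⟩
      have hzb : z (0, t) ∈ ball x₀ (2 * r) := by rw [hinit t ht]; exact hb (hγ0 t ht)
      have d1 : HasFDerivAt Q (-fderiv ℝ P (z (0, t))) (z (0, t)) := by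
        rw [← fderiv_compl]
        refine ((hP.compl.differentiableAt (hbV hzb)).hasFDerivAt).congr_of_eventuallyEq ?_
        filter_upwards [isOpen_ball.mem_nhds hzb] with y hy using hQ1 y hy
      have d2 : HasFDerivWithinAt (fun q : ℝ × ℝ × E => Q q.2.2)
          ((-fderiv ℝ P (z (0, t))).comp ((ContinuousLinearMap.snd ℝ ℝ E).comp
            (ContinuousLinearMap.snd ℝ ℝ (ℝ × E)))) (S ×ˢ Icc c d ×ˢ univ) (0, t, z (0, t)) :=
        (d1.comp (0, t, z (0, t)) (f := fun q : ℝ × ℝ × E => q.2.2)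
          (hasFDerivAt_snd.comp _ hasFDerivAt_snd)).hasFDerivWithinAt
      have d3 := (hasFDerivWithinAt_fderivWithin_apply hcd hS hγ (p := (0, t)) ⟨hS0, ht⟩
        (0, 1)).comp (f := fun q : ℝ × ℝ × E => (q.1, q.2.1)) (0, t, z (0, t))
        (f' := (ContinuousLinearMap.fst ℝ ℝ (ℝ × E)).prod
          ((ContinuousLinearMap.fst ℝ ℝ E).comp (ContinuousLinearMap.snd ℝ ℝ (ℝ × E))))
        (hasFDerivAt_fst.prodMk (hasFDerivAt_fst.comp _ hasFDerivAt_snd)).hasFDerivWithinAt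
        (fun q hq => ⟨hq.1, hq.2.1⟩ : MapsTo _ (S ×ˢ Icc c d ×ˢ (univ : Set E)) Ω)
      have d4 := (d2.clm_apply d3).fderivWithin (hD _ hmem)
      have hL := hγL t ht
      rw [linearizedConstraint, (hX t ht).derivWithin (hu t ht),
        (hγt (0, t) ⟨hS0, ht⟩).derivWithin (hu t ht)] at hL
      have hf_eq : f = fun q : ℝ × ℝ × E => Q q.2.2
          (((fun q => fderivWithin ℝ γ Ω q (0, 1)) ∘ fun q : ℝ × ℝ × E => (q.1, q.2.1)) q) := rfl
      rw [hf_eq, d4]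
      simp only [add_apply, ContinuousLinearMap.comp_apply, ContinuousLinearMap.flip_apply,
        ContinuousLinearMap.prod_apply, ContinuousLinearMap.coe_fst', ContinuousLinearMap.coe_snd',
        Function.comp_apply, neg_apply]
      rw [hQ1 _ hzb, hinit t ht, sub_apply, ContinuousLinearMap.id_apply, sub_add,
        eq_comm, sub_eq_self]
      simpa [sub_neg_eq_add, g, X] using hL
  have hcont0 : ContinuousOn (fun t => γ (0, t)) (Icc c d) :=
    hγ.continuousOn.comp (by fun_prop) fun t ht => ⟨hS0, ht⟩
  -- The initial path is in the ball of radius r, so a displacement less than r keeps every path in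
  -- the ball of radius 2r, where the cut-off is inactive.
  obtain ⟨ε, hε, hεS⟩ : ∃ ε > 0, ∀ s ∈ Ioo (-ε) ε, s ∈ S ∧
      ∀ t ∈ Icc c d, ‖z (s, t) - z (0, t)‖ < r := by
    have h1 := (eventually_forall_norm_sub_lt hS hzc hS0 hr)
    have h2 := (hS.eventually_mem hS0).and h1
    obtain ⟨ε, hε, h⟩ := Metric.eventually_nhds_iff_ball.1 h2
    refine ⟨ε, hε, fun s hs => h s ?_⟩
    rw [Real.ball_eq_Ioo]
    simpa using hs
  have hsubS : Ioo (-ε) ε ⊆ S := fun s hs => (hεS s hs).1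
  have hzball : ∀ s ∈ Ioo (-ε) ε, ∀ t ∈ Icc c d, z (s, t) ∈ ball x₀ (2 * r) := by
    intro s hs t ht
    have h1 := (hεS s hs).2 t ht
    have h2 := hγ0 t ht
    rw [hinit t ht, ← dist_eq_norm] at h1
    rw [mem_ball] at h2 ⊢
    linarith [dist_triangle (z (s, t)) (γ (0, t)) x₀]
  refine ⟨ε, hε, hsubS, z, hzd.mono (prod_mono_left hsubS), hzball, hinit, hder, ?_, ?_⟩
  · intro s hs t ht
    rw [(hz s (hsubS hs) t ht).derivWithin (hu t ht)]
    have hb' := hzball s hs t ht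
    simp only [f]
    rw [hQ1 _ hb', sub_apply, map_sub, ContinuousLinearMap.id_apply, hP.idem _ (hbV hb'), sub_self]
  · exact fun e he h s hs => hagree s (hsubS hs) e he fun t ht => h s (hsubS hs) t ht

end IsProjectionField

end TangentCorrection

/-! ### Induction over intervals, blending, and the linearised constraint. -/

section LocalVariations

open Filter

/-- A property of compact intervals which holds for short intervals and is inherited by unions of
overlapping intervals holds for all intervals. -/
theorem interval_induction {W : ℝ → ℝ → Prop} {a b : ℝ} (hab : a < b)
    (hloc : ∀ t ∈ Icc a b, ∃ δ > 0, ∀ c d, a ≤ c → c < d → d ≤ b → t - δ < c → d < t + δ → W c d)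
    (hglue : ∀ c c' d d', a ≤ c → c ≤ c' → c' < d → d ≤ d' → d' ≤ b →
      W c d → W c' d' → W c d') : W a b := by
  choose! δ hδ hW using hloc
  obtain ⟨η, hη, hleb⟩ := lebesgue_number_lemma_of_metric (s := Icc a b)
    (c := fun t : Icc a b => Ioo ((t : ℝ) - δ t) (t + δ t)) isCompact_Icc
    (fun t => isOpen_Ioo) fun t ht => mem_iUnion.2 ⟨⟨t, ht⟩, by
      have := hδ t ht
      constructor <;> simp [this]⟩
  have hsmall : ∀ c d, a ≤ c → c < d → d ≤ b → d - c < η → W c d := by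
    intro c d hac hcd hdb h
    obtain ⟨t, ht⟩ := hleb c ⟨hac, (hcd.trans_le hdb).le⟩
    have h1 := ht (Metric.mem_ball_self hη)
    have h2 : d ∈ Metric.ball c η := by
      rw [Metric.mem_ball, Real.dist_eq, abs_of_pos (sub_pos.2 hcd)]; exact h
    exact hW t t.2 c d hac hcd hdb h1.1 (ht h2).2
  have hind : ∀ n : ℕ, ∀ c d, a ≤ c → c < d → d ≤ b → d - c ≤ (n + 1) * (η / 3) → W c d := by
    intro n
    induction n with
    | zero =>
      intro c d hac hcd hdb h
      exact hsmall c d hac hcd hdb (by norm_num at h; linarith)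
    | succ n ih =>
      intro c d hac hcd hdb h
      push_cast at h
      rcases lt_or_ge (d - c) η with h1 | h1
      · exact hsmall c d hac hcd hdb h1
      -- The last piece has length 2η/3 < η and overlaps the previous one in an interval of length
      -- η/3, since gluing needs a nondegenerate overlap.
      · refine hglue c (d - 2 * (η / 3)) (d - η / 3) d hac (by linarith) (by linarith)
          (by linarith) hdb (ih c _ hac (by linarith) (by linarith) (by linarith)) ?_
        exact hsmall _ d (by linarith) (by linarith) hdb (by linarith)
  obtain ⟨n, hn⟩ := exists_nat_gt ((b - a) / (η / 3))
  refine hind n a b le_rfl hab le_rfl ?_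
  rw [div_lt_iff₀ (by positivity)] at hn
  nlinarith

variable {E : Type*} [NormedAddCommGroup E] [NormedSpace ℝ E]

/-- Prolongation of a variation, modifying it near the end of its interval of definition. -/
theorem exists_blend {γ : ℝ × ℝ → E} {x X : ℝ → E} {S : Set ℝ} {c d e₁ e : ℝ}
    (he₁ : e₁ < e) (hγ : ContDiffOn ℝ ∞ γ (S ×ˢ Icc c e))
    (hx : ContDiffOn ℝ ∞ x (Icc c d)) (hX : ContDiffOn ℝ ∞ X (Icc c d))
    (hγ0 : ∀ t ∈ Icc c e, γ (0, t) = x t)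
    (hγX : ∀ t ∈ Icc c e, HasDerivAt (fun s => γ (s, t)) (X t) 0) :
    ∃ ζ : ℝ × ℝ → E, ContDiffOn ℝ ∞ ζ (S ×ˢ Icc c d) ∧
      (∀ s, ∀ t ≤ e₁, ζ (s, t) = γ (s, t)) ∧
      (∀ t ∈ Icc c d, ζ (0, t) = x t) ∧
      ∀ t ∈ Icc c d, HasDerivAt (fun s => ζ (s, t)) (X t) 0 := by
  obtain ⟨e₂, h12, h2e⟩ := exists_between he₁
  -- ρ is 1 up to `e₁` and 0 from `e₂ < e` on, so `γ` is no longer used near `e`. The blend is with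
  -- the affine family `l`, which has the same value and s-derivative at s = 0; these data therefore
  -- survive.
  let ρ : ℝ → ℝ := fun t => Real.smoothTransition ((e₂ - t) / (e₂ - e₁))
  have hρ : ContDiff ℝ ∞ ρ := by
    refine Real.smoothTransition.contDiff.comp ?_
    exact (contDiff_const.sub contDiff_id).div_const _
  have hρ1 : ∀ t ≤ e₁, ρ t = 1 := fun t ht => Real.smoothTransition.one_of_one_le (by
    rw [le_div_iff₀ (by linarith)]; linarith)
  have hρ0 : ∀ t, e₂ ≤ t → ρ t = 0 := fun t ht => Real.smoothTransition.zero_of_nonpos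
    (div_nonpos_of_nonpos_of_nonneg (by linarith) (by linarith))
  let l : ℝ × ℝ → E := fun p => x p.2 + p.1 • X p.2
  have hl : ContDiffOn ℝ ∞ l (S ×ˢ Icc c d) :=
    (hx.comp contDiffOn_snd fun p hp => hp.2).add
      (contDiffOn_fst.smul (hX.comp contDiffOn_snd fun p hp => hp.2))
  have hld : ∀ t, HasDerivAt (fun s => l (s, t)) (X t) 0 := fun t => by
    simpa [l] using ((hasDerivAt_id (0 : ℝ)).smul_const (X t)).const_add (x t)
  refine ⟨fun p => l p + ρ p.2 • (γ p - l p), hl.add ?_, fun s t ht => ?_, fun t ht => ?_,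
    fun t ht => ?_⟩
  · intro p hp
    rcases lt_or_ge p.2 e with h | h
    · have hmem : S ×ˢ Icc c e ∈ 𝓝[S ×ˢ Icc c d] p := by
        have : {q : ℝ × ℝ | q.2 < e} ∈ 𝓝 p := (isOpen_lt continuous_snd continuous_const).mem_nhds h
        filter_upwards [mem_nhdsWithin_of_mem_nhds this, self_mem_nhdsWithin] with q hq hq'
        exact ⟨hq'.1, hq'.2.1, le_of_lt hq⟩
      have h1 := (hγ p ⟨hp.1, hp.2.1, h.le⟩).mono_of_mem_nhdsWithin hmem
      exact (hρ.comp contDiff_snd).contDiffWithinAt.smul (h1.sub (hl p hp))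
    · have : {q : ℝ × ℝ | e₂ < q.2} ∈ 𝓝 p :=
        (isOpen_lt continuous_const continuous_snd).mem_nhds (h2e.trans_le h)
      refine (contDiffWithinAt_const (c := (0 : E))).congr_of_eventuallyEq_of_mem ?_ hp
      filter_upwards [mem_nhdsWithin_of_mem_nhds this] with q hq
      rw [hρ0 _ (le_of_lt hq), zero_smul]
  · simp [hρ1 t ht]
  · rcases lt_or_ge e₂ t with h | h
    · simp [hρ0 t h.le, l]
    · simp [hγ0 t ⟨ht.1, by linarith⟩, l]
  · rcases lt_or_ge e₂ t with h | h
    · simpa [hρ0 t h.le] using hld t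
    · have hte : t ∈ Icc c e := ⟨ht.1, h.trans h2e.le⟩
      have h1 : HasDerivAt (fun s => l (s, t) + ρ t • (γ (s, t) - l (s, t)))
          (X t + ρ t • (X t - X t)) 0 := (hld t).add (((hγX t hte).sub (hld t)).const_smul (ρ t))
      simpa using h1

theorem linearizedConstraint_congr_set {P : E → E →L[ℝ] E} {x X : ℝ → E} {J J' : Set ℝ} {t : ℝ}
    (h : J =ᶠ[𝓝 t] J') : linearizedConstraint P x X J t = linearizedConstraint P x X J' t := by
  rw [linearizedConstraint, linearizedConstraint, derivWithin_congr_set h, derivWithin_congr_set h]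

theorem linearizedConstraint_congr {P P' : E → E →L[ℝ] E} {x X x' X' : ℝ → E} {J : Set ℝ} {t : ℝ}
    (ht : t ∈ J) (hx : x =ᶠ[𝓝[J] t] x') (hX : X =ᶠ[𝓝[J] t] X') (hP : P =ᶠ[𝓝 (x t)] P') :
    linearizedConstraint P x X J t = linearizedConstraint P' x' X' J t := by
  have e1 := hx.eq_of_nhdsWithin ht
  rw [linearizedConstraint, linearizedConstraint, hx.derivWithin_eq_of_mem ht,
    hX.derivWithin_eq_of_mem ht, hP.fderiv_eq, hP.eq_of_nhds, e1, hX.eq_of_nhdsWithin ht]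

/-- The linearised constraint holds for the variation vector field of a variation through paths
tangent to `ker P`. -/
theorem IsProjectionField.linearizedConstraint_eq_zero {P : E → E →L[ℝ] E} {V : Set E}
    (hP : IsProjectionField P V) {β : ℝ × ℝ → E} {S : Set ℝ} {c d : ℝ} (hcd : c < d)
    (hS : IsOpen S) (hS0 : 0 ∈ S) (hβ : ContDiffOn ℝ ∞ β (S ×ˢ Icc c d)) {t : ℝ}
    (ht : t ∈ Icc c d) (hβV : β (0, t) ∈ V)
    (hβH : ∀ s ∈ S, P (β (s, t)) (derivWithin (fun t => β (s, t)) (Icc c d) t) = 0) :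
    linearizedConstraint P (fun t => β (0, t))
      (fun t => fderivWithin ℝ β (S ×ˢ Icc c d) (0, t) (1, 0)) (Icc c d) t = 0 := by
  have hu := uniqueDiffOn_Icc hcd t ht
  have hp : ((0, t) : ℝ × ℝ) ∈ S ×ˢ Icc c d := ⟨hS0, ht⟩
  have ht' : ∀ s ∈ S, derivWithin (fun t => β (s, t)) (Icc c d) t =
      fderivWithin ℝ β (S ×ˢ Icc c d) (s, t) (0, 1) := fun s hs =>
    (hasDerivWithinAt_snd_of_prod (hβ.differentiableOn (by simp) (s, t) ⟨hs, ht⟩).hasFDerivWithinAt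
      hs).derivWithin hu
  have h1 := hasDerivWithinAt_snd_of_prod
    (hasFDerivWithinAt_fderivWithin_apply hcd hS hβ hp (1, 0)) hS0
  have h2 := hasDerivAt_fst_of_prod hS
    (hasFDerivWithinAt_fderivWithin_apply hcd hS hβ hp (0, 1)) hp
  have h3 := hasDerivAt_fst_of_prod hS (hβ.differentiableOn (by simp) _ hp).hasFDerivWithinAt hp
  have h4 := (hP.differentiableAt hβV).hasFDerivAt.comp_hasDerivAt (f := fun s => β (s, t)) 0 h3
  -- This is the s-derivative of P(β)∂ₜβ, which vanishes identically; exchanging ∂ₛ and ∂ₜ turns it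
  -- into the linearised constraint.
  have h5 := h4.clm_apply h2
  have h6 : (fun s => P (β (s, t)) (fderivWithin ℝ β (S ×ˢ Icc c d) (s, t) (0, 1)))
      =ᶠ[𝓝 0] fun _ => 0 := by
    filter_upwards [hS.mem_nhds hS0] with s hs
    rw [← ht' s hs, hβH s hs]
  have h7 := (h5.congr_of_eventuallyEq h6.symm).unique (hasDerivAt_const (0 : ℝ) (0 : E))
  rw [linearizedConstraint, h1.derivWithin hu, ht' 0 hS0, ContinuousLinearMap.flip_apply,
    fderivWithin_fderivWithin_comm hcd hS hβ hp, add_comm]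
  simpa using h7

/-- Invariance of the linearised constraint under changes of coordinates. -/
theorem linearizedConstraint_comp {P₁ P₂ : E → E →L[ℝ] E} {ψ : E → E} {x X : ℝ → E} {J : Set ℝ}
    {t : ℝ} (hu : UniqueDiffWithinAt ℝ J t) (hψ : ContDiffAt ℝ 2 ψ (x t))
    (hP₁ : DifferentiableAt ℝ P₁ (x t)) (hP₂ : DifferentiableAt ℝ P₂ (ψ (x t)))
    (hrel : ∀ᶠ y in 𝓝 (x t), ∀ v, P₂ (ψ y) (fderiv ℝ ψ y v) = fderiv ℝ ψ y (P₁ y v))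
    (hx : DifferentiableWithinAt ℝ x J t) (hX : DifferentiableWithinAt ℝ X J t)
    (hw : P₁ (x t) (derivWithin x J t) = 0) :
    linearizedConstraint P₂ (fun τ => ψ (x τ)) (fun τ => fderiv ℝ ψ (x τ) (X τ)) J t =
      fderiv ℝ ψ (x t) (linearizedConstraint P₁ x X J t) := by
  have hψ1 : HasFDerivAt ψ (fderiv ℝ ψ (x t)) (x t) :=
    (hψ.differentiableAt two_ne_zero).hasFDerivAt
  have hψ2 : HasFDerivAt (fderiv ℝ ψ) (fderiv ℝ (fderiv ℝ ψ) (x t)) (x t) :=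
    ((hψ.fderiv_right (m := 1) (by norm_num)).differentiableAt one_ne_zero).hasFDerivAt
  have hsymm : IsSymmSndFDerivAt ℝ ψ (x t) := hψ.isSymmSndFDerivAt (by simp)
  set w := derivWithin x J t with hwdef
  have hx' : HasDerivWithinAt x w J t := hx.hasDerivWithinAt
  have hX' := hX.hasDerivWithinAt
  have d1 : derivWithin (fun τ => ψ (x τ)) J t = fderiv ℝ ψ (x t) w :=
    (hψ1.comp_hasDerivWithinAt t hx').derivWithin hu
  have d2 : derivWithin (fun τ => fderiv ℝ ψ (x τ) (X τ)) J t =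
      fderiv ℝ (fderiv ℝ ψ) (x t) w (X t) + fderiv ℝ ψ (x t) (derivWithin X J t) :=
    ((hψ2.comp_hasDerivWithinAt t hx').clm_apply hX').derivWithin hu
  -- Differentiate the intertwining relation at the fixed vector w = x' in the direction X. The term
  -- D²ψ[X](P₁ w) drops out because P₁ w = 0, and symmetry of D²ψ matches the remaining second order
  -- terms.
  have e1 : HasFDerivAt (fun y => P₂ (ψ y) (fderiv ℝ ψ y w)) _ (x t) :=
    (hP₂.hasFDerivAt.comp (x t) hψ1).clm_apply (hψ2.clm_apply (hasFDerivAt_const w (x t)))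
  have e2 : HasFDerivAt (fun y => fderiv ℝ ψ y (P₁ y w)) _ (x t) :=
    hψ2.clm_apply (hP₁.hasFDerivAt.clm_apply (hasFDerivAt_const w (x t)))
  have e3 : (fun y => P₂ (ψ y) (fderiv ℝ ψ y w)) =ᶠ[𝓝 (x t)]
      fun y => fderiv ℝ ψ y (P₁ y w) := by
    filter_upwards [hrel] with y hy using hy w
  have e4 := congrArg (fun L : E →L[ℝ] E => L (X t))
    ((e1.congr_of_eventuallyEq e3.symm).unique e2)
  simp only [add_apply, ContinuousLinearMap.comp_apply, ContinuousLinearMap.flip_apply,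
    zero_apply, map_zero, zero_add, hw, Function.comp_apply, add_zero] at e4
  have e5 := hrel.self_of_nhds (derivWithin X J t)
  rw [linearizedConstraint, linearizedConstraint, d1, d2, map_add, map_add, e5, hsymm.eq w (X t),
    ← e4]
  abel

end LocalVariations

/-! ### Tangent vectors and smoothness in an arbitrary chart. -/

section Charts

open Filter

variable {E : Type*} [NormedAddCommGroup E] [NormedSpace ℝ E]
  {M : Type*} [TopologicalSpace M] [ChartedSpace E M] [IsManifold 𝓘(ℝ, E) ∞ M]

/-- The coordinates of a tangent vector in the preferred chart at `p`. -/
def readVec (p : M) (ξ : TangentBundle 𝓘(ℝ, E) M) : E :=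
  tangentCoordChange 𝓘(ℝ, E) ξ.1 p ξ.1 (show E from ξ.2)

/-- The tangent vector with given coordinates in the preferred chart at `p`. -/
def mkVec (p : M) (x v : E) : TangentBundle 𝓘(ℝ, E) M :=
  ⟨(extChartAt 𝓘(ℝ, E) p).symm x,
    (show E from tangentCoordChange 𝓘(ℝ, E) p ((extChartAt 𝓘(ℝ, E) p).symm x)
      ((extChartAt 𝓘(ℝ, E) p).symm x) v)⟩

theorem tangentBundle_ext {q q' : M} {v : TangentSpace 𝓘(ℝ, E) q} {v' : TangentSpace 𝓘(ℝ, E) q'}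
    (h : q = q') (hv : (show E from v) = (show E from v')) :
    (⟨q, v⟩ : TangentBundle 𝓘(ℝ, E) M) = ⟨q', v'⟩ := by
  subst h
  exact congrArg (Bundle.TotalSpace.mk q) hv

theorem readVec_self (q : M) (v : TangentSpace 𝓘(ℝ, E) q) :
    readVec q (⟨q, v⟩ : TangentBundle 𝓘(ℝ, E) M) = (show E from v) :=
  tangentCoordChange_self (mem_extChartAt_source q)

theorem tangentCoordChange_readVec {p p' : M} {ξ : TangentBundle 𝓘(ℝ, E) M}
    (h : ξ.1 ∈ (extChartAt 𝓘(ℝ, E) p).source) (h' : ξ.1 ∈ (extChartAt 𝓘(ℝ, E) p').source) :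
    tangentCoordChange 𝓘(ℝ, E) p p' ξ.1 (readVec p ξ) = readVec p' ξ :=
  tangentCoordChange_comp ⟨⟨mem_extChartAt_source _, h⟩, h'⟩

theorem readVec_mkVec {p : M} {x v : E} (hx : x ∈ (extChartAt 𝓘(ℝ, E) p).target) :
    readVec p (mkVec p x v) = v := by
  have h := (extChartAt 𝓘(ℝ, E) p).map_target hx
  exact (tangentCoordChange_comp ⟨⟨h, mem_extChartAt_source _⟩, h⟩).trans
    (tangentCoordChange_self h)

theorem mkVec_readVec {p : M} {ξ : TangentBundle 𝓘(ℝ, E) M}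
    (h : ξ.1 ∈ (extChartAt 𝓘(ℝ, E) p).source) :
    mkVec p (extChartAt 𝓘(ℝ, E) p ξ.1) (readVec p ξ) = ξ := by
  obtain ⟨q, v⟩ := ξ
  have hq : (extChartAt 𝓘(ℝ, E) p).symm (extChartAt 𝓘(ℝ, E) p q) = q :=
    (extChartAt 𝓘(ℝ, E) p).left_inv h
  refine tangentBundle_ext hq ?_
  change tangentCoordChange 𝓘(ℝ, E) p ((extChartAt 𝓘(ℝ, E) p).symm (extChartAt 𝓘(ℝ, E) p q))
      ((extChartAt 𝓘(ℝ, E) p).symm (extChartAt 𝓘(ℝ, E) p q))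
      (tangentCoordChange 𝓘(ℝ, E) q p q v) = v
  rw [hq]
  exact (tangentCoordChange_comp ⟨⟨mem_extChartAt_source q, h⟩, mem_extChartAt_source q⟩).trans
    (tangentCoordChange_self (mem_extChartAt_source q))

theorem readVec_injective {p q : M} (h : q ∈ (extChartAt 𝓘(ℝ, E) p).source)
    {u v : TangentSpace 𝓘(ℝ, E) q} (huv : readVec p (⟨q, u⟩ : TangentBundle 𝓘(ℝ, E) M) =
      readVec p (⟨q, v⟩ : TangentBundle 𝓘(ℝ, E) M)) : u = v := by
  have h1 := mkVec_readVec (ξ := (⟨q, u⟩ : TangentBundle 𝓘(ℝ, E) M)) h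
  rw [huv, mkVec_readVec (ξ := (⟨q, v⟩ : TangentBundle 𝓘(ℝ, E) M)) h] at h1
  cases h1
  rfl

/-- Reading tangent vectors at `q` in the chart at `p` is linear. -/
def readVecₗ (p q : M) : TangentSpace 𝓘(ℝ, E) q →ₗ[ℝ] E where
  toFun v := readVec p (⟨q, v⟩ : TangentBundle 𝓘(ℝ, E) M)
  map_add' u v := (tangentCoordChange 𝓘(ℝ, E) q p q).map_add u v
  map_smul' r v := (tangentCoordChange 𝓘(ℝ, E) q p q).map_smul r v

theorem readVecₗ_apply (p q : M) (v : TangentSpace 𝓘(ℝ, E) q) :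
    readVecₗ p q v = readVec p (⟨q, v⟩ : TangentBundle 𝓘(ℝ, E) M) := rfl

theorem exists_readVecₗ_eq {p q : M} (h : q ∈ (extChartAt 𝓘(ℝ, E) p).source) (v : E) :
    ∃ u : TangentSpace 𝓘(ℝ, E) q, readVecₗ p q u = v := by
  refine ⟨(show E from tangentCoordChange 𝓘(ℝ, E) p q q v), ?_⟩
  exact (tangentCoordChange_comp ⟨⟨h, mem_extChartAt_source _⟩, h⟩).trans
    (tangentCoordChange_self h)

theorem hasFDerivAt_transition {p p' q : M} (h : q ∈ (extChartAt 𝓘(ℝ, E) p).source)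
    (h' : q ∈ (extChartAt 𝓘(ℝ, E) p').source) :
    HasFDerivAt (extChartAt 𝓘(ℝ, E) p' ∘ (extChartAt 𝓘(ℝ, E) p).symm)
      (tangentCoordChange 𝓘(ℝ, E) p p' q) (extChartAt 𝓘(ℝ, E) p q) := by
  have := hasFDerivWithinAt_tangentCoordChange (I := 𝓘(ℝ, E)) ⟨h, h'⟩
  rwa [modelWithCornersSelf_coe, range_id, hasFDerivWithinAt_univ] at this

theorem contDiffAt_transition {p p' q : M} (h : q ∈ (extChartAt 𝓘(ℝ, E) p).source)
    (h' : q ∈ (extChartAt 𝓘(ℝ, E) p').source) :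
    ContDiffAt ℝ ∞ (extChartAt 𝓘(ℝ, E) p' ∘ (extChartAt 𝓘(ℝ, E) p).symm)
      (extChartAt 𝓘(ℝ, E) p q) := by
  have hm : extChartAt 𝓘(ℝ, E) p q ∈
      ((extChartAt 𝓘(ℝ, E) p).symm ≫ extChartAt 𝓘(ℝ, E) p').source := by
    rw [PartialEquiv.trans_source'', PartialEquiv.symm_symm, PartialEquiv.symm_target]
    exact mem_image_of_mem _ ⟨h, h'⟩
  have := contDiffWithinAt_ext_coord_change (I := 𝓘(ℝ, E)) (n := ∞) p' p hm
  rwa [modelWithCornersSelf_coe, range_id, contDiffWithinAt_univ] at this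

variable {N : Type*} [NormedAddCommGroup N] [NormedSpace ℝ N]

theorem contMDiffWithinAt_iff_chart {f : N → M} {S : Set N} {x : N} {p : M}
    (hp : f x ∈ (extChartAt 𝓘(ℝ, E) p).source) :
    ContMDiffWithinAt 𝓘(ℝ, N) 𝓘(ℝ, E) ∞ f S x ↔
      ContinuousWithinAt f S x ∧ ContDiffWithinAt ℝ ∞ (fun y => extChartAt 𝓘(ℝ, E) p (f y)) S x := by
  rw [contMDiffWithinAt_iff_target_of_mem_source (y := p) (by simpa using hp),
    contMDiffWithinAt_iff_contDiffWithinAt]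
  rfl

/-- Any chart whose domain contains the base point is allowed, so that a single chart can serve a
whole segment of a path. -/
theorem contMDiffWithinAt_tangent_iff {c : N → TangentBundle 𝓘(ℝ, E) M} {S : Set N} {x : N}
    {p : M} (hp : (c x).1 ∈ (extChartAt 𝓘(ℝ, E) p).source) :
    ContMDiffWithinAt 𝓘(ℝ, N) 𝓘(ℝ, E).tangent ∞ c S x ↔
      ContMDiffWithinAt 𝓘(ℝ, N) 𝓘(ℝ, E) ∞ (fun y => (c y).1) S x ∧
        ContDiffWithinAt ℝ ∞ (fun y => readVec p (c y)) S x := by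
  have hp' : (c x).1 ∈ (chartAt E p).source := by simpa using hp
  refine (Bundle.contMDiffWithinAt_totalSpace (E := (TangentSpace 𝓘(ℝ, E) : M → Type _))).trans
    (and_congr_right fun h => ?_)
  rw [← contMDiffWithinAt_iff_contDiffWithinAt]
  refine Bundle.Trivialization.contMDiffWithinAt_snd_comp_iff₂ (IB := 𝓘(ℝ, E)) h
    (e' := trivializationAt E (TangentSpace 𝓘(ℝ, E)) p) ?_ ?_
  · exact mem_chart_source E (c x).1
  · exact hp'

end Charts

/-! ### Velocities in charts. -/

section Velocities

open Filter

theorem pathVelocity_eq_derivWithin {E' : Type*} [NormedAddCommGroup E'] [NormedSpace ℝ E']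
    {B' : Type*} [TopologicalSpace B'] {J : ModelWithCorners ℝ E' B'}
    {N : Type*} [TopologicalSpace N] [ChartedSpace B' N] {c : ℝ → N} {S : Set ℝ} {t : ℝ}
    (hc : MDifferentiableWithinAt 𝓘(ℝ, ℝ) J c S t) :
    (show E' from pathVelocity J c S t) = derivWithin (fun τ => extChartAt J (c t) (c τ)) S t := by
  change (mfderivWithin 𝓘(ℝ, ℝ) J c S t : ℝ →L[ℝ] E') 1 = _
  have h : mfderivWithin 𝓘(ℝ, ℝ) J c S t = fderivWithin ℝ (writtenInExtChartAt 𝓘(ℝ, ℝ) J t c)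
      ((extChartAt 𝓘(ℝ, ℝ) t).symm ⁻¹' S ∩ range 𝓘(ℝ, ℝ)) (extChartAt 𝓘(ℝ, ℝ) t t) := if_pos hc
  have h' : (extChartAt 𝓘(ℝ, ℝ) t).symm ⁻¹' S ∩ range 𝓘(ℝ, ℝ) = S := by
    simp only [extChartAt_model_space_eq_id, modelWithCornersSelf_coe, range_id, inter_univ]
    rfl
  rw [h'] at h
  exact congrArg (fun L : ℝ →L[ℝ] E' => L 1) h

variable {E : Type*} [NormedAddCommGroup E] [NormedSpace ℝ E]
  {M : Type*} [TopologicalSpace M] [ChartedSpace E M] [IsManifold 𝓘(ℝ, E) ∞ M]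

theorem readVec_pathVelocity {β : ℝ → M} {S : Set ℝ} {t : ℝ}
    (hβ : ContMDiffWithinAt 𝓘(ℝ, ℝ) 𝓘(ℝ, E) ∞ β S t) (hu : UniqueDiffWithinAt ℝ S t) (ht : t ∈ S)
    {p : M} (hp : β t ∈ (extChartAt 𝓘(ℝ, E) p).source) :
    readVec p (⟨β t, pathVelocity 𝓘(ℝ, E) β S t⟩ : TangentBundle 𝓘(ℝ, E) M) =
      derivWithin (fun τ => extChartAt 𝓘(ℝ, E) p (β τ)) S t := by
  have h0 := pathVelocity_eq_derivWithin (hβ.mdifferentiableWithinAt (by simp))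
  have hq := mem_extChartAt_source (I := 𝓘(ℝ, E)) (β t)
  have h1 := (((contMDiffWithinAt_iff_chart hq).1 hβ).2.differentiableWithinAt
    (by simp)).hasDerivWithinAt
  have h2 := (hasFDerivAt_transition hq hp).comp_hasDerivWithinAt t h1
  have h3 : (fun τ => extChartAt 𝓘(ℝ, E) p (β τ)) =ᶠ[𝓝[S] t]
      (extChartAt 𝓘(ℝ, E) p ∘ (extChartAt 𝓘(ℝ, E) (β t)).symm) ∘
        fun τ => extChartAt 𝓘(ℝ, E) (β t) (β τ) := by
    filter_upwards [hβ.continuousWithinAt.preimage_mem_nhdsWithin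
      ((isOpen_extChartAt_source (β t)).mem_nhds hq)] with τ hτ
    simp only [Function.comp_apply]
    rw [(extChartAt 𝓘(ℝ, E) (β t)).left_inv hτ]
  rw [h3.derivWithin_eq_of_mem ht, h2.derivWithin hu, ← h0]
  rfl

/-- The chart of `TM` at `c t` is induced by the chart of `M` at the base point, so the velocity
splits into base and fibre derivatives. -/
theorem pathVelocity_tangent {c : ℝ → TangentBundle 𝓘(ℝ, E) M} {S : Set ℝ} {t : ℝ}
    (hc : ContMDiffWithinAt 𝓘(ℝ, ℝ) 𝓘(ℝ, E).tangent ∞ c S t) (hu : UniqueDiffWithinAt ℝ S t) :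
    (show E × E from pathVelocity 𝓘(ℝ, E).tangent c S t) =
      (derivWithin (fun τ => extChartAt 𝓘(ℝ, E) (c t).1 (c τ).1) S t,
        derivWithin (fun τ => readVec (c t).1 (c τ)) S t) := by
  have h := (contMDiffWithinAt_tangent_iff (mem_extChartAt_source (c t).1)).1 hc
  have h1 := ((contMDiffWithinAt_iff_chart (f := fun τ => (c τ).1)
    (mem_extChartAt_source (c t).1)).1 h.1).2
  have d1 := (h1.differentiableWithinAt (by simp)).hasDerivWithinAt
  have d2 := (h.2.differentiableWithinAt (by simp)).hasDerivWithinAt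
  exact (pathVelocity_eq_derivWithin (hc.mdifferentiableWithinAt (by simp))).trans
    ((d1.prodMk d2).derivWithin hu)

end Velocities

/-! ### Projections in terms of frames. -/

section Frames

variable {T : Type*} [AddCommGroup T] [Module ℝ T] {H K : Submodule ℝ T} {k l : ℕ}
  {F : Fin k → T} {G : Fin l → T}

/-- The linear combinations of two families of vectors. -/
def frameMap (F : Fin k → T) (G : Fin l → T) : (Fin k → ℝ) × (Fin l → ℝ) →ₗ[ℝ] T :=
  (Fintype.linearCombination ℝ F).coprod (Fintype.linearCombination ℝ G)

theorem frameMap_bijective (hHK : IsCompl H K) (hF : LinearIndependent ℝ F)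
    (hFs : Submodule.span ℝ (range F) = H) (hG : LinearIndependent ℝ G)
    (hGs : Submodule.span ℝ (range G) = K) : Function.Bijective (frameMap F G) := by
  have rF : (Fintype.linearCombination ℝ F).range = H := by
    rw [Fintype.range_linearCombination, hFs]
  have rG : (Fintype.linearCombination ℝ G).range = K := by
    rw [Fintype.range_linearCombination, hGs]
  constructor
  · rw [← LinearMap.ker_eq_bot, frameMap,
      LinearMap.ker_coprod_of_disjoint_range _ _ (by rw [rF, rG]; exact hHK.disjoint),
      LinearMap.ker_eq_bot.2 hF.fintypeLinearCombination_injective,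
      LinearMap.ker_eq_bot.2 hG.fintypeLinearCombination_injective, Submodule.prod_bot]
  · rw [← LinearMap.range_eq_top, frameMap, LinearMap.range_coprod, rF, rG, hHK.sup_eq_top]

theorem projection_frameMap (hHK : IsCompl H K) (hFs : Submodule.span ℝ (range F) = H)
    (hGs : Submodule.span ℝ (range G) = K) (c : (Fin k → ℝ) × (Fin l → ℝ)) :
    K.projection H hHK.symm (frameMap F G c) = frameMap F G (0, c.2) := by
  have h1 : Fintype.linearCombination ℝ F c.1 ∈ H := by
    rw [← hFs, ← Fintype.range_linearCombination ℝ]; exact LinearMap.mem_range_self _ _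
  have h2 : Fintype.linearCombination ℝ G c.2 ∈ K := by
    rw [← hGs, ← Fintype.range_linearCombination ℝ]; exact LinearMap.mem_range_self _ _
  rw [frameMap, LinearMap.coprod_apply, LinearMap.coprod_apply, map_add, map_zero, zero_add]
  rw [← Submodule.coe_projectionOnto_apply, ← Submodule.coe_projectionOnto_apply,
    Submodule.projectionOnto_apply_of_mem_left _ h2,
    (Submodule.projectionOnto_apply_eq_zero_iff _).2 h1]
  simp

end Frames

/-! ### The projection onto K along H in charts; the intrinsic constraint. -/

section ChartProjection

open Filter

variable {E : Type*} [NormedAddCommGroup E] [NormedSpace ℝ E]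
  {M : Type*} [TopologicalSpace M] [ChartedSpace E M] [IsManifold 𝓘(ℝ, E) ∞ M]

/-- The inverse of `readVecₗ p q` for `q` in the chart domain. -/
def mkVecₗ (p q : M) : E →ₗ[ℝ] TangentSpace 𝓘(ℝ, E) q where
  toFun v := (show E from tangentCoordChange 𝓘(ℝ, E) p q q v)
  map_add' u v := (tangentCoordChange 𝓘(ℝ, E) p q q).map_add u v
  map_smul' r v := (tangentCoordChange 𝓘(ℝ, E) p q q).map_smul r v

theorem readVecₗ_mkVecₗ {p q : M} (h : q ∈ (extChartAt 𝓘(ℝ, E) p).source) (v : E) :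
    readVecₗ p q (mkVecₗ p q v) = v :=
  (tangentCoordChange_comp ⟨⟨h, mem_extChartAt_source _⟩, h⟩).trans
    (tangentCoordChange_self h)

theorem mkVecₗ_readVecₗ {p q : M} (h : q ∈ (extChartAt 𝓘(ℝ, E) p).source)
    (v : TangentSpace 𝓘(ℝ, E) q) : mkVecₗ p q (readVecₗ p q v) = v :=
  readVec_injective h (readVecₗ_mkVecₗ h (readVecₗ p q v))

/-- Reading tangent vectors at `q` in the chart at `p`, as an equivalence. -/
def readVecEquiv {p q : M} (h : q ∈ (extChartAt 𝓘(ℝ, E) p).source) :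
    TangentSpace 𝓘(ℝ, E) q ≃ₗ[ℝ] E :=
  LinearEquiv.ofLinearMap (readVecₗ p q) (mkVecₗ p q) (LinearMap.ext (readVecₗ_mkVecₗ h))
    (LinearMap.ext (mkVecₗ_readVecₗ h))

variable [FiniteDimensional ℝ E] (H K : ∀ p : M, Submodule ℝ (TangentSpace 𝓘(ℝ, E) p))
  (hHK : ∀ p, IsCompl (H p) (K p))

/-- The projection onto `K q` along `H q`. -/
def tangentProj (q : M) : TangentSpace 𝓘(ℝ, E) q →ₗ[ℝ] TangentSpace 𝓘(ℝ, E) q :=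
  (K q).projection (H q) (hHK q).symm

/-- The projection onto `K q` along `H q`, read in the chart at `p`. -/
def chartProjAt (p q : M) : E →L[ℝ] E :=
  LinearMap.toContinuousLinearMap (readVecₗ p q ∘ₗ tangentProj H K hHK q ∘ₗ mkVecₗ p q)

/-- The projection onto `K` along `H`, read in the chart at `p`. -/
def chartProj (p : M) (x : E) : E →L[ℝ] E :=
  chartProjAt H K hHK p ((extChartAt 𝓘(ℝ, E) p).symm x)

variable {H K hHK}

theorem tangentProj_mem {q : M} (v : TangentSpace 𝓘(ℝ, E) q) : tangentProj H K hHK q v ∈ K q := by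
  rw [tangentProj, ← Submodule.coe_projectionOnto_apply]
  exact Submodule.coe_mem _

theorem tangentProj_eq_self_iff {q : M} {v : TangentSpace 𝓘(ℝ, E) q} :
    tangentProj H K hHK q v = v ↔ v ∈ K q := by
  constructor
  · intro h
    rw [← h]
    exact tangentProj_mem v
  · intro h
    rw [tangentProj, ← Submodule.coe_projectionOnto_apply,
      Submodule.projectionOnto_apply_of_mem_left _ h]

theorem tangentProj_eq_zero_iff {q : M} {v : TangentSpace 𝓘(ℝ, E) q} :
    tangentProj H K hHK q v = 0 ↔ v ∈ H q := by
  rw [tangentProj, ← Submodule.coe_projectionOnto_apply, Submodule.coe_eq_zero,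
    Submodule.projectionOnto_apply_eq_zero_iff]

theorem chartProjAt_readVecₗ {p q : M} (h : q ∈ (extChartAt 𝓘(ℝ, E) p).source)
    (v : TangentSpace 𝓘(ℝ, E) q) :
    chartProjAt H K hHK p q (readVecₗ p q v) = readVecₗ p q (tangentProj H K hHK q v) := by
  change readVecₗ p q (tangentProj H K hHK q (mkVecₗ p q (readVecₗ p q v))) = _
  rw [mkVecₗ_readVecₗ h]

theorem chartProj_extChartAt {p q : M} (h : q ∈ (extChartAt 𝓘(ℝ, E) p).source) :
    chartProj H K hHK p (extChartAt 𝓘(ℝ, E) p q) = chartProjAt H K hHK p q := by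
  rw [chartProj, (extChartAt 𝓘(ℝ, E) p).left_inv h]

theorem chartProj_readVec {p q : M} (h : q ∈ (extChartAt 𝓘(ℝ, E) p).source)
    (v : TangentSpace 𝓘(ℝ, E) q) :
    chartProj H K hHK p (extChartAt 𝓘(ℝ, E) p q)
      (readVec p (⟨q, v⟩ : TangentBundle 𝓘(ℝ, E) M)) =
      readVec p (⟨q, tangentProj H K hHK q v⟩ : TangentBundle 𝓘(ℝ, E) M) := by
  rw [chartProj_extChartAt h]
  exact chartProjAt_readVecₗ h v

theorem chartProj_readVec_eq_zero_iff {p q : M} (h : q ∈ (extChartAt 𝓘(ℝ, E) p).source)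
    (v : TangentSpace 𝓘(ℝ, E) q) :
    chartProj H K hHK p (extChartAt 𝓘(ℝ, E) p q)
      (readVec p (⟨q, v⟩ : TangentBundle 𝓘(ℝ, E) M)) = 0 ↔ v ∈ H q := by
  rw [chartProj_readVec h, ← tangentProj_eq_zero_iff (hHK := hHK)]
  exact (readVecEquiv h).map_eq_zero_iff

theorem chartProj_readVec_eq_self_iff {p q : M} (h : q ∈ (extChartAt 𝓘(ℝ, E) p).source)
    (v : TangentSpace 𝓘(ℝ, E) q) :
    chartProj H K hHK p (extChartAt 𝓘(ℝ, E) p q)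
      (readVec p (⟨q, v⟩ : TangentBundle 𝓘(ℝ, E) M)) =
        readVec p (⟨q, v⟩ : TangentBundle 𝓘(ℝ, E) M) ↔ v ∈ K q := by
  rw [chartProj_readVec h, ← tangentProj_eq_self_iff (hHK := hHK)]
  exact (readVecEquiv h).injective.eq_iff

theorem contDiffAt_readVec_section {p : M} {X : ∀ q : M, TangentSpace 𝓘(ℝ, E) q} {U : Set M}
    (hU : IsOpen U) (hX : ContMDiffOn 𝓘(ℝ, E) 𝓘(ℝ, E).tangent ∞
      (fun q => (⟨q, X q⟩ : TangentBundle 𝓘(ℝ, E) M)) U) {x : E}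
    (hx : x ∈ (extChartAt 𝓘(ℝ, E) p).target) (hxU : (extChartAt 𝓘(ℝ, E) p).symm x ∈ U) :
    ContDiffAt ℝ ∞ (fun y => readVec p (⟨(extChartAt 𝓘(ℝ, E) p).symm y,
      X ((extChartAt 𝓘(ℝ, E) p).symm y)⟩ : TangentBundle 𝓘(ℝ, E) M)) x := by
  have h1 : ContMDiffAt 𝓘(ℝ, E) 𝓘(ℝ, E) ∞ (extChartAt 𝓘(ℝ, E) p).symm x :=
    (contMDiffOn_extChartAt_symm p).contMDiffAt ((isOpen_extChartAt_target p).mem_nhds hx)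
  have h2 : ContMDiffAt 𝓘(ℝ, E) 𝓘(ℝ, E).tangent ∞ ((fun q =>
      (⟨q, X q⟩ : TangentBundle 𝓘(ℝ, E) M)) ∘ (extChartAt 𝓘(ℝ, E) p).symm) x :=
    ContMDiffAt.comp x (hX.contMDiffAt (hU.mem_nhds hxU)) h1
  have h3 := (contMDiffWithinAt_tangent_iff (N := E) (S := univ)
    (c := fun y => (⟨(extChartAt 𝓘(ℝ, E) p).symm y,
      X ((extChartAt 𝓘(ℝ, E) p).symm y)⟩ : TangentBundle 𝓘(ℝ, E) M)) (p := p)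
    ((extChartAt 𝓘(ℝ, E) p).map_target hx)).1 h2
  exact contDiffWithinAt_univ.1 h3.2

/-- Local frames of H and K together give a smooth family of isomorphisms B(y). In these coordinates
the projection is the constant map π that kills the H-coefficients, so it equals B π B⁻¹, and
inversion is smooth at isomorphisms. -/
theorem contDiffAt_chartProj (hH : IsSmoothSubbundle H) (hK : IsSmoothSubbundle K) {p : M} {x : E}
    (hx : x ∈ (extChartAt 𝓘(ℝ, E) p).target) : ContDiffAt ℝ ∞ (chartProj H K hHK p) x := by
  set φ := extChartAt 𝓘(ℝ, E) p with hφ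
  obtain ⟨U, hU, hxU, k, F, hF, hFH⟩ := hH (φ.symm x)
  obtain ⟨U', hU', hxU', l, G, hG, hGK⟩ := hK (φ.symm x)
  let B : E → (Fin k → ℝ) × (Fin l → ℝ) →L[ℝ] E := fun y =>
    (∑ i, (ContinuousLinearMap.proj (R := ℝ) (φ := fun _ : Fin k => ℝ) i ∘L
      ContinuousLinearMap.fst ℝ (Fin k → ℝ) (Fin l → ℝ)).smulRight
        (readVec p (⟨φ.symm y, F i (φ.symm y)⟩ : TangentBundle 𝓘(ℝ, E) M))) +
    ∑ i, (ContinuousLinearMap.proj (R := ℝ) (φ := fun _ : Fin l => ℝ) i ∘L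
      ContinuousLinearMap.snd ℝ (Fin k → ℝ) (Fin l → ℝ)).smulRight
        (readVec p (⟨φ.symm y, G i (φ.symm y)⟩ : TangentBundle 𝓘(ℝ, E) M))
  have hB : ContDiffAt ℝ ∞ B x := by
    refine ContDiffAt.add (ContDiffAt.sum fun i _ => ?_) (ContDiffAt.sum fun i _ => ?_)
    · exact contDiffAt_const.smulRight (contDiffAt_readVec_section hU (hF i) hx hxU)
    · exact contDiffAt_const.smulRight (contDiffAt_readVec_section hU' (hG i) hx hxU')
  have hBc : ∀ y c, B y c = readVecₗ p (φ.symm y)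
      (frameMap (fun i => F i (φ.symm y)) (fun i => G i (φ.symm y)) c) := by
    intro y c
    simp only [B, frameMap, LinearMap.coprod_apply, Fintype.linearCombination_apply, map_add,
      map_sum, map_smul, add_apply, sum_apply,
      ContinuousLinearMap.smulRight_apply, ContinuousLinearMap.comp_apply,
      ContinuousLinearMap.proj_apply, ContinuousLinearMap.coe_fst', ContinuousLinearMap.coe_snd']
    rfl
  have hev : ∀ᶠ y in 𝓝 x, y ∈ φ.target ∧ φ.symm y ∈ U ∧ φ.symm y ∈ U' := by
    have hc : ContinuousAt φ.symm x := continuousAt_extChartAt_symm'' hx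
    filter_upwards [(isOpen_extChartAt_target p).mem_nhds hx, hc (hU.mem_nhds hxU),
      hc (hU'.mem_nhds hxU')] with y h1 h2 h3 using ⟨h1, h2, h3⟩
  have hbij : ∀ y, y ∈ φ.target ∧ φ.symm y ∈ U ∧ φ.symm y ∈ U' → Function.Bijective (B y) := by
    rintro y ⟨h1, h2, h3⟩
    have e : ⇑(B y) = readVecEquiv (φ.map_target h1) ∘
        frameMap (fun i => F i (φ.symm y)) (fun i => G i (φ.symm y)) := funext (hBc y)
    rw [e]
    exact (readVecEquiv (φ.map_target h1)).bijective.comp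
      (frameMap_bijective (hHK _) (hFH _ h2).1 (hFH _ h2).2 (hGK _ h3).1 (hGK _ h3).2)
  have hequiv : ∀ y, y ∈ φ.target ∧ φ.symm y ∈ U ∧ φ.symm y ∈ U' →
      ∃ e : ((Fin k → ℝ) × (Fin l → ℝ)) ≃L[ℝ] E, (e : _ →L[ℝ] E) = B y := fun y hy =>
    ⟨(LinearEquiv.ofBijective (B y : _ →ₗ[ℝ] E) (hbij y hy)).toContinuousLinearEquiv, by
      ext <;> rfl⟩
  let π : (Fin k → ℝ) × (Fin l → ℝ) →L[ℝ] (Fin k → ℝ) × (Fin l → ℝ) :=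
    ContinuousLinearMap.inr ℝ _ _ ∘L ContinuousLinearMap.snd ℝ (Fin k → ℝ) (Fin l → ℝ)
  have hmain : chartProj H K hHK p =ᶠ[𝓝 x] fun y => B y ∘L π ∘L (B y).inverse := by
    filter_upwards [hev] with y hy
    obtain ⟨e, he⟩ := hequiv y hy
    have h1 : chartProj H K hHK p y ∘L B y = B y ∘L π := by
      refine ContinuousLinearMap.ext fun c => ?_
      change chartProjAt H K hHK p (φ.symm y) (B y c) = B y (0, c.2)
      rw [hBc, hBc, chartProjAt_readVecₗ (φ.map_target hy.1), tangentProj,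
        projection_frameMap (hHK _) (hFH _ hy.2.1).2 (hGK _ hy.2.2).2]
    rw [← he] at h1 ⊢
    rw [ContinuousLinearMap.inverse_equiv, ← ContinuousLinearMap.comp_assoc, ← h1]
    ext v
    simp
  refine ContDiffAt.congr_of_eventuallyEq ?_ hmain
  obtain ⟨e, he⟩ := hequiv x hev.self_of_nhds
  have hinv : ContDiffAt ℝ ∞ (fun y => (B y).inverse) x := by
    have := contDiffAt_map_inverse (n := ∞) e
    rw [he] at this
    exact this.comp x hB
  exact hB.clm_comp (contDiffAt_const.clm_comp hinv)

theorem isProjectionField_chartProj (hH : IsSmoothSubbundle H) (hK : IsSmoothSubbundle K) (p : M) :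
    IsProjectionField (chartProj H K hHK p) (extChartAt 𝓘(ℝ, E) p).target where
  isOpen := isOpen_extChartAt_target p
  contDiffOn x hx := (contDiffAt_chartProj hH hK hx).contDiffWithinAt
  idem x hx v := by
    have h := (extChartAt 𝓘(ℝ, E) p).map_target hx
    obtain ⟨u, rfl⟩ := exists_readVecₗ_eq h v
    rw [chartProj, chartProjAt_readVecₗ h, chartProjAt_readVecₗ h,
      tangentProj_eq_self_iff.2 (tangentProj_mem u)]

/-- The linearised constraint for a vector field along a path, read in the chart at `p`. -/
def chartConstraint (H K : ∀ p : M, Submodule ℝ (TangentSpace 𝓘(ℝ, E) p))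
    (hHK : ∀ p, IsCompl (H p) (K p)) (p : M) (ξ : ℝ → TangentBundle 𝓘(ℝ, E) M) (J : Set ℝ)
    (t : ℝ) : E :=
  linearizedConstraint (chartProj H K hHK p) (fun τ => extChartAt 𝓘(ℝ, E) p (ξ τ).1)
    (fun τ => readVec p (ξ τ)) J t

/-- Apply `linearizedConstraint_comp` to the transition map, which intertwines the two chart
projections because both represent one projection of the tangent spaces. Tangency to H is essential:
it removes the second derivatives of the transition map. -/
theorem chartConstraint_transition (hH : IsSmoothSubbundle H) (hK : IsSmoothSubbundle K)
    {ξ : ℝ → TangentBundle 𝓘(ℝ, E) M} {J : Set ℝ} {t : ℝ} (hu : UniqueDiffWithinAt ℝ J t)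
    (ht : t ∈ J) (hξ : ContMDiffWithinAt 𝓘(ℝ, ℝ) 𝓘(ℝ, E).tangent ∞ ξ J t)
    (hv : pathVelocity 𝓘(ℝ, E) (fun τ => (ξ τ).1) J t ∈ H (ξ t).1) {p p' : M}
    (hp : (ξ t).1 ∈ (extChartAt 𝓘(ℝ, E) p).source)
    (hp' : (ξ t).1 ∈ (extChartAt 𝓘(ℝ, E) p').source) :
    chartConstraint H K hHK p' ξ J t =
      tangentCoordChange 𝓘(ℝ, E) p p' (ξ t).1 (chartConstraint H K hHK p ξ J t) := by
  set φ := extChartAt 𝓘(ℝ, E) p with hφ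
  set φ' := extChartAt 𝓘(ℝ, E) p' with hφ'
  set ψ := φ' ∘ φ.symm with hψ
  have h1 := (contMDiffWithinAt_tangent_iff hp).1 hξ
  have h2 := (contMDiffWithinAt_iff_chart (f := fun τ => (ξ τ).1) hp).1 h1.1
  have hψd : ∀ q ∈ φ.source, q ∈ φ'.source →
      fderiv ℝ ψ (φ q) = tangentCoordChange 𝓘(ℝ, E) p p' q := fun q hq hq' =>
    (hasFDerivAt_transition hq hq').fderiv
  have hψx : ψ (φ (ξ t).1) = φ' (ξ t).1 := congrArg φ' (φ.left_inv hp)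
  have hP := isProjectionField_chartProj (hHK := hHK) hH hK p
  have hP' := isProjectionField_chartProj (hHK := hHK) hH hK p'
  have key := linearizedConstraint_comp (P₁ := chartProj H K hHK p) (P₂ := chartProj H K hHK p')
    (ψ := ψ) (x := fun τ => φ (ξ τ).1) (X := fun τ => readVec p (ξ τ)) hu
    ((contDiffAt_transition hp hp').of_le (by norm_cast))
    (hP.differentiableAt (φ.map_source hp))
    (by
      rw [hψx]; exact hP'.differentiableAt (φ'.map_source hp'))
    (by
      have hc : ContinuousAt φ.symm (φ (ξ t).1) := continuousAt_extChartAt_symm' hp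
      have hn : φ'.source ∈ 𝓝 (φ.symm (φ (ξ t).1)) := by
        rw [φ.left_inv hp]; exact (isOpen_extChartAt_source p').mem_nhds hp'
      filter_upwards [(isOpen_extChartAt_target p).mem_nhds (φ.map_source hp), hc hn] with y hy hy'
        v
      have hs := φ.map_target hy
      obtain ⟨u, rfl⟩ := exists_readVecₗ_eq hs v
      have e := hψd _ hs hy'
      rw [φ.right_inv hy] at e
      rw [e, readVecₗ_apply]
      have e1 := tangentCoordChange_readVec (p := p) (p' := p')
        (ξ := (⟨φ.symm y, u⟩ : TangentBundle 𝓘(ℝ, E) M)) hs hy'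
      have e2 := tangentCoordChange_readVec (p := p) (p' := p')
        (ξ := (⟨φ.symm y, tangentProj H K hHK _ u⟩ : TangentBundle 𝓘(ℝ, E) M)) hs hy'
      have e3 := chartProj_readVec (hHK := hHK) hs u
      rw [φ.right_inv hy] at e3
      rw [e3]
      refine (congrArg _ e1).trans (Eq.trans ?_ e2.symm)
      exact chartProj_readVec hy' u)
    (h2.2.differentiableWithinAt (by simp)) (h1.2.differentiableWithinAt (by simp))
    (by
      have e := readVec_pathVelocity h1.1 hu ht hp
      rw [← e]
      exact (chartProj_readVec_eq_zero_iff hp _).2 hv)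
  have e := hψd _ hp hp'
  rw [chartConstraint, chartConstraint, ← e]
  refine Eq.trans ?_ key
  have hev : ∀ᶠ τ in 𝓝[J] t, (ξ τ).1 ∈ φ.source ∧ (ξ τ).1 ∈ φ'.source := by
    have hc := h1.1.continuousWithinAt
    filter_upwards [hc ((isOpen_extChartAt_source p).mem_nhds hp),
      hc ((isOpen_extChartAt_source p').mem_nhds hp')] with τ a b using ⟨a, b⟩
  refine linearizedConstraint_congr ht ?_ ?_ EventuallyEq.rfl
  · filter_upwards [hev] with τ hτ
    exact congrArg φ' (φ.left_inv hτ.1).symm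
  · filter_upwards [hev] with τ hτ
    rw [hψd _ hτ.1 hτ.2]
    exact (tangentCoordChange_readVec hτ.1 hτ.2).symm

theorem chartConstraint_eq_zero_iff (hH : IsSmoothSubbundle H) (hK : IsSmoothSubbundle K)
    {ξ : ℝ → TangentBundle 𝓘(ℝ, E) M} {J : Set ℝ} {t : ℝ} (hu : UniqueDiffWithinAt ℝ J t)
    (ht : t ∈ J) (hξ : ContMDiffWithinAt 𝓘(ℝ, ℝ) 𝓘(ℝ, E).tangent ∞ ξ J t)
    (hv : pathVelocity 𝓘(ℝ, E) (fun τ => (ξ τ).1) J t ∈ H (ξ t).1) {p p' : M}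
    (hp : (ξ t).1 ∈ (extChartAt 𝓘(ℝ, E) p).source)
    (hp' : (ξ t).1 ∈ (extChartAt 𝓘(ℝ, E) p').source) :
    chartConstraint H K hHK p ξ J t = 0 ↔ chartConstraint H K hHK p' ξ J t = 0 := by
  constructor <;> intro h
  · rw [chartConstraint_transition hH hK hu ht hξ hv hp hp', h, map_zero]
  · rw [chartConstraint_transition hH hK hu ht hξ hv hp' hp, h, map_zero]

end ChartProjection

/-! ### The canonical connection as the linearised constraint. -/

section Connection

open Filter

variable {E : Type*} [NormedAddCommGroup E] [NormedSpace ℝ E]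
  {M : Type*} [TopologicalSpace M] [ChartedSpace E M] [IsManifold 𝓘(ℝ, E) ∞ M]

theorem hasDerivWithinAt_field_apply {R : E → E →L[ℝ] E} {x k : ℝ → E} {x' k' : E} {J : Set ℝ}
    {t : ℝ} (hR : DifferentiableAt ℝ R (x t)) (hx : HasDerivWithinAt x x' J t)
    (hk : HasDerivWithinAt k k' J t) :
    HasDerivWithinAt (fun τ => R (x τ) (k τ)) (fderiv ℝ R (x t) x' (k t) + R (x t) k') J t :=
  (hR.hasFDerivAt.comp_hasDerivWithinAt t hx).clm_apply hk

theorem doubleTangent_ext {η η' : TangentBundle 𝓘(ℝ, E) M}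
    {v : TangentSpace 𝓘(ℝ, E).tangent η} {v' : TangentSpace 𝓘(ℝ, E).tangent η'}
    (h : η = η') (hv : (show E × E from v) = (show E × E from v')) :
    (⟨η, v⟩ : TangentBundle 𝓘(ℝ, E).tangent (TangentBundle 𝓘(ℝ, E) M)) = ⟨η', v'⟩ := by
  subst h
  exact congrArg (Bundle.TotalSpace.mk η) hv

theorem contMDiffOn_symm_comp {N : Type*} [NormedAddCommGroup N] [NormedSpace ℝ N] {p : M}
    {x : N → E} {S : Set N} (hx : ContDiffOn ℝ ∞ x S)
    (hxp : ∀ u ∈ S, x u ∈ (extChartAt 𝓘(ℝ, E) p).target) :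
    ContMDiffOn 𝓘(ℝ, N) 𝓘(ℝ, E) ∞ (fun u => (extChartAt 𝓘(ℝ, E) p).symm (x u)) S :=
  (contMDiffOn_extChartAt_symm p).comp hx.contMDiffOn hxp

theorem contMDiffOn_mkVec {N : Type*} [NormedAddCommGroup N] [NormedSpace ℝ N] {p : M}
    {x Y : N → E} {S : Set N} (hx : ContDiffOn ℝ ∞ x S) (hY : ContDiffOn ℝ ∞ Y S)
    (hxp : ∀ u ∈ S, x u ∈ (extChartAt 𝓘(ℝ, E) p).target) :
    ContMDiffOn 𝓘(ℝ, N) 𝓘(ℝ, E).tangent ∞ (fun u => mkVec p (x u) (Y u)) S := fun u hu =>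
  (contMDiffWithinAt_tangent_iff (c := fun u => mkVec p (x u) (Y u))
    ((extChartAt 𝓘(ℝ, E) p).map_target (hxp u hu))).2
    ⟨contMDiffOn_symm_comp hx hxp u hu,
      (hY u hu).congr (fun v hv => readVec_mkVec (hxp v hv)) (readVec_mkVec (hxp u hu))⟩

/-- The tangent bundle of the total space of a subbundle that is locally the kernel of a
projection field. -/
theorem mem_tangentSet_totalSet_iff {N : ∀ p : M, Submodule ℝ (TangentSpace 𝓘(ℝ, E) p)}
    {R : M → E → E →L[ℝ] E} (hR : ∀ p, IsProjectionField (R p) (extChartAt 𝓘(ℝ, E) p).target)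
    (hRN : ∀ p, ∀ η : TangentBundle 𝓘(ℝ, E) M, η.1 ∈ (extChartAt 𝓘(ℝ, E) p).source →
      (R p (extChartAt 𝓘(ℝ, E) p η.1) (readVec p η) = 0 ↔ η.2 ∈ N η.1))
    (ξ : TangentBundle 𝓘(ℝ, E).tangent (TangentBundle 𝓘(ℝ, E) M)) :
    ξ ∈ tangentSet (totalSet N) ↔ ξ.1.2 ∈ N ξ.1.1 ∧
      fderiv ℝ (R ξ.1.1) (extChartAt 𝓘(ℝ, E) ξ.1.1 ξ.1.1) (show E × E from ξ.2).1
        (show E from ξ.1.2) +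
      R ξ.1.1 (extChartAt 𝓘(ℝ, E) ξ.1.1 ξ.1.1) (show E × E from ξ.2).2 = 0 := by
  constructor
  · rintro ⟨c, δ, hδ, hc, hcN, rfl⟩
    have h0 : (0 : ℝ) ∈ Ioo (-δ) δ := ⟨neg_lt_zero.2 hδ, hδ⟩
    have hu : UniqueDiffWithinAt ℝ (Ioo (-δ) δ) 0 := isOpen_Ioo.uniqueDiffWithinAt h0
    refine ⟨hcN 0 h0, ?_⟩
    have e := pathVelocity_tangent (hc 0 h0) hu
    refine (congrArg (fun V : E × E =>
      fderiv ℝ (R (c 0).1) (extChartAt 𝓘(ℝ, E) (c 0).1 (c 0).1) V.1 (show E from (c 0).2) +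
        R (c 0).1 (extChartAt 𝓘(ℝ, E) (c 0).1 (c 0).1) V.2) e).trans ?_
    have hp := mem_extChartAt_source (I := 𝓘(ℝ, E)) (c 0).1
    have h := (contMDiffWithinAt_tangent_iff hp).1 (hc 0 h0)
    have h1 := ((contMDiffWithinAt_iff_chart (f := fun τ => (c τ).1) hp).1 h.1).2
    have d1 := (h1.differentiableWithinAt (by simp)).hasDerivWithinAt
    have d2 := (h.2.differentiableWithinAt (by simp)).hasDerivWithinAt
    have d3 := hasDerivWithinAt_field_apply ((hR (c 0).1).differentiableAt
      (mem_extChartAt_target (I := 𝓘(ℝ, E)) (c 0).1)) d1 d2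
    have hz : (fun τ => R (c 0).1 (extChartAt 𝓘(ℝ, E) (c 0).1 (c τ).1) (readVec (c 0).1 (c τ)))
        =ᶠ[𝓝[Ioo (-δ) δ] 0] fun _ => (0 : E) := by
      filter_upwards [self_mem_nhdsWithin, h.1.continuousWithinAt
        ((isOpen_extChartAt_source (c 0).1).mem_nhds hp)] with τ hτ hτ'
      exact (hRN _ (c τ) hτ').2 (hcN τ hτ)
    have d4 := (hasDerivWithinAt_const (0 : ℝ) (Ioo (-δ) δ) (0 : E)).congr_of_eventuallyEq_of_mem
      hz h0
    have := hu.eq_deriv _ d3 d4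
    exact (congrArg (fun y : E =>
      fderiv ℝ (R (c 0).1) (extChartAt 𝓘(ℝ, E) (c 0).1 (c 0).1)
        (derivWithin (fun τ => extChartAt 𝓘(ℝ, E) (c 0).1 (c τ).1) (Ioo (-δ) δ) 0) y +
      R (c 0).1 (extChartAt 𝓘(ℝ, E) (c 0).1 (c 0).1)
        (derivWithin (fun τ => readVec (c 0).1 (c τ)) (Ioo (-δ) δ) 0))
      (readVec_self (c 0).1 (c 0).2)).symm.trans this
  · rintro ⟨hy, hw⟩
    obtain ⟨⟨q, y⟩, zw⟩ := ξ
    obtain ⟨z, w, hzw⟩ : ∃ z w : E, (show E × E from zw) = (z, w) := ⟨_, _, rfl⟩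
    obtain ⟨y', hy'⟩ : ∃ y' : E, (show E from y) = y' := ⟨_, rfl⟩
    dsimp only at hy hw
    rw [hzw, hy'] at hw
    dsimp only at hw
    set φ := extChartAt 𝓘(ℝ, E) q with hφ
    have hq := mem_extChartAt_source (I := 𝓘(ℝ, E)) q
    have hx0 : φ q ∈ φ.target := φ.map_source hq
    let x : ℝ → E := fun u => φ q + u • z
    -- Applying 1 - R to the straight line forces the curve into the kernel. The hypothesis `hw`
    -- says that DR[z]y' + R w = 0, so this does not change the derivative at 0.
    let Y : ℝ → E := fun u => (y' + u • w) - R q (x u) (y' + u • w)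
    have hxd : ContDiff ℝ ∞ x := contDiff_const.add (contDiff_id.smul contDiff_const)
    have hyd : ContDiff ℝ ∞ fun u : ℝ => y' + u • w :=
      contDiff_const.add (contDiff_id.smul contDiff_const)
    have hopen : IsOpen (x ⁻¹' φ.target) := (isOpen_extChartAt_target q).preimage hxd.continuous
    have hmem : (0 : ℝ) ∈ x ⁻¹' φ.target := by simpa [x] using hx0
    obtain ⟨δ, hδ, hball⟩ := Metric.isOpen_iff.1 hopen 0 hmem
    rw [Real.ball_eq_Ioo, zero_sub, zero_add] at hball
    have hYd : ContDiffOn ℝ ∞ Y (Ioo (-δ) δ) :=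
      hyd.contDiffOn.sub (((hR q).contDiffOn.comp hxd.contDiffOn hball).clm_apply hyd.contDiffOn)
    have hRy : R q (φ q) y' = 0 := by
      have := (hRN q ⟨q, y⟩ hq).2 hy
      rwa [readVec_self, hy'] at this
    have hd1 : HasDerivAt x z 0 := by
      simpa [x] using ((hasDerivAt_id (0 : ℝ)).smul_const z).const_add (φ q)
    have hd2 : HasDerivAt (fun u : ℝ => y' + u • w) w 0 := by
      simpa using ((hasDerivAt_id (0 : ℝ)).smul_const w).const_add y'
    have hx00 : x 0 = φ q := by simp [x]
    have hd3 : HasDerivAt Y w 0 := by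
      have h1 : HasFDerivAt (R q) (fderiv ℝ (R q) (φ q)) (x 0) := by
        rw [hx00]; exact ((hR q).differentiableAt hx0).hasFDerivAt
      have h3 := hd2.sub ((h1.comp_hasDerivAt (0 : ℝ) hd1).clm_apply hd2)
      refine h3.congr_deriv ?_
      simp only [Function.comp_apply, zero_smul, add_zero, hx00, hw, sub_zero]
    have h0 : (0 : ℝ) ∈ Ioo (-δ) δ := ⟨neg_lt_zero.2 hδ, hδ⟩
    obtain ⟨c, hc⟩ : ∃ c : ℝ → TangentBundle 𝓘(ℝ, E) M, ∀ u, c u = mkVec q (x u) (Y u) :=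
      ⟨_, fun u => rfl⟩
    have hcs : ContMDiffOn 𝓘(ℝ, ℝ) 𝓘(ℝ, E).tangent ∞ c (Ioo (-δ) δ) := by
      rw [show c = fun u => mkVec q (x u) (Y u) from funext hc]
      exact contMDiffOn_mkVec hxd.contDiffOn hYd hball
    have hc0 : c 0 = ⟨q, y⟩ := by
      rw [hc, ← mkVec_readVec (p := q) (ξ := (⟨q, y⟩ : TangentBundle 𝓘(ℝ, E) M)) hq, readVec_self,
        hx00]
      refine congrArg (mkVec q (φ q)) ?_
      change y' + (0 : ℝ) • w - R q (x 0) (y' + (0 : ℝ) • w) = _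
      rw [zero_smul, add_zero, hx00, hRy, sub_zero, hy']
    refine ⟨c, δ, hδ, hcs, fun u hu => ?_, ?_⟩
    · have hxu := hball hu
      have h1 : (c u).1 = φ.symm (x u) := by rw [hc]; rfl
      have h2 : (c u).1 ∈ φ.source := by rw [h1]; exact φ.map_target hxu
      refine (hRN q (c u) h2).1 ?_
      rw [h1, φ.right_inv hxu, hc, readVec_mkVec hxu]
      simp only [Y, map_sub, (hR q).idem _ hxu, sub_self]
    · refine doubleTangent_ext hc0.symm ?_
      rw [hzw, pathVelocity_tangent (hcs 0 h0) (isOpen_Ioo.uniqueDiffWithinAt h0)]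
      have h1 : (c 0).1 = q := by rw [hc0]
      rw [h1]
      have hev : ∀ u ∈ Ioo (-δ) δ, φ (c u).1 = x u ∧ readVec q (c u) = Y u := fun u hu => by
        rw [hc]
        exact ⟨φ.right_inv (hball hu), readVec_mkVec (hball hu)⟩
      refine Prod.ext ?_ ?_
      · refine Eq.symm ?_
        have := hd1.hasDerivWithinAt.congr (s := Ioo (-δ) δ) (fun u hu => (hev u hu).1) (hev 0 h0).1
        exact this.derivWithin (isOpen_Ioo.uniqueDiffWithinAt h0)
      · refine Eq.symm ?_
        have := hd3.hasDerivWithinAt.congr (s := Ioo (-δ) δ) (fun u hu => (hev u hu).2) (hev 0 h0).2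
        exact this.derivWithin (isOpen_Ioo.uniqueDiffWithinAt h0)

theorem canonicalFlip_canonicalFlip
    (ξ : TangentBundle 𝓘(ℝ, E).tangent (TangentBundle 𝓘(ℝ, E) M)) :
    canonicalFlip (canonicalFlip ξ) = ξ := rfl

theorem mem_image_canonicalFlip_iff
    {S : Set (TangentBundle 𝓘(ℝ, E).tangent (TangentBundle 𝓘(ℝ, E) M))}
    {ξ : TangentBundle 𝓘(ℝ, E).tangent (TangentBundle 𝓘(ℝ, E) M)} :
    ξ ∈ canonicalFlip '' S ↔ canonicalFlip ξ ∈ S := by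
  constructor
  · rintro ⟨η, hη, rfl⟩
    rwa [canonicalFlip_canonicalFlip]
  · exact fun h => ⟨_, h, canonicalFlip_canonicalFlip ξ⟩

variable [FiniteDimensional ℝ E] {H K : ∀ p : M, Submodule ℝ (TangentSpace 𝓘(ℝ, E) p)}
  (hHK : ∀ p, IsCompl (H p) (K p))

/-- In a chart, a section of `K` along a path tangent to `H` is parallel if and only if it
satisfies the linearised constraint. -/
theorem isParallel_iff (hH : IsSmoothSubbundle H) (hK : IsSmoothSubbundle K) {a b : ℝ}
    (hab : a < b) {β₀ : ℝ → M} (hβ₀H : IsTangentPath H a b β₀) (σ : ∀ t : ℝ, K (β₀ t)) :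
    IsParallel H K a b β₀ σ ↔
      IsSmoothAlong a b β₀ (fun t => (σ t : TangentSpace 𝓘(ℝ, E) (β₀ t))) ∧
      ∀ t ∈ Icc a b, chartConstraint H K hHK (β₀ t)
        (fun τ => (⟨β₀ τ, (σ τ : TangentSpace 𝓘(ℝ, E) (β₀ τ))⟩ : TangentBundle 𝓘(ℝ, E) M))
        (Icc a b) t = 0 := by
  refine and_congr_right fun hs => forall₂_congr fun t ht => ?_
  have hu := uniqueDiffOn_Icc hab t ht
  obtain ⟨ξ, hξ⟩ : ∃ ξ : ℝ → TangentBundle 𝓘(ℝ, E) M, ξ = fun τ =>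
    (⟨β₀ τ, (σ τ : TangentSpace 𝓘(ℝ, E) (β₀ τ))⟩ : TangentBundle 𝓘(ℝ, E) M) := ⟨_, rfl⟩
  have hP := isProjectionField_chartProj (hHK := hHK) hH hK
  have hs' : ContMDiffWithinAt 𝓘(ℝ, ℝ) 𝓘(ℝ, E).tangent ∞ ξ (Icc a b) t := by
    rw [hξ]; exact hs t ht
  have hξK : ∀ τ, (ξ τ).2 ∈ K (ξ τ).1 := fun τ => by rw [hξ]; exact (σ τ).2
  have hξH : pathVelocity 𝓘(ℝ, E) (fun τ => (ξ τ).1) (Icc a b) t ∈ H (ξ t).1 := by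
    rw [hξ]; exact hβ₀H t ht
  change ((⟨(fun τ => (⟨β₀ τ, (σ τ : TangentSpace 𝓘(ℝ, E) (β₀ τ))⟩ :
    TangentBundle 𝓘(ℝ, E) M)) t, _⟩ : TangentBundle 𝓘(ℝ, E).tangent (TangentBundle 𝓘(ℝ, E) M)) ∈ _)
      ↔ chartConstraint H K hHK ((fun τ => (⟨β₀ τ, (σ τ : TangentSpace 𝓘(ℝ, E) (β₀ τ))⟩ :
        TangentBundle 𝓘(ℝ, E) M)) t).1 _ _ _ = 0
  rw [← hξ]
  have hp := mem_extChartAt_source (I := 𝓘(ℝ, E)) (ξ t).1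
  have h := (contMDiffWithinAt_tangent_iff hp).1 hs'
  have h1 := ((contMDiffWithinAt_iff_chart (f := fun τ => (ξ τ).1) hp).1 h.1).2
  have d1 := (h1.differentiableWithinAt (by simp)).hasDerivWithinAt
  have d2 := (h.2.differentiableWithinAt (by simp)).hasDerivWithinAt
  have e := pathVelocity_tangent hs' hu
  have eb := readVec_pathVelocity h.1 hu ht hp
  rw [readVec_self] at eb
  -- K is the kernel of 1 - P and H the kernel of P, so the same description of the tangent set
  -- serves for both.
  rw [mem_inter_iff, mem_image_canonicalFlip_iff,
    mem_tangentSet_totalSet_iff (N := K) (R := fun p x => ContinuousLinearMap.id ℝ E -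
      chartProj H K hHK p x) (fun p => (hP p).compl) (fun p η hη => by
        rw [← chartProj_readVec_eq_self_iff (hHK := hHK) hη, eq_comm (b := readVec p _)]
        exact sub_eq_zero),
    mem_tangentSet_totalSet_iff (N := H) (R := chartProj H K hHK) hP (fun p η hη =>
      chartProj_readVec_eq_zero_iff hη _)]
  let y : E := (ξ t).2
  have ey : readVec (ξ t).1 (ξ t) = y := readVec_self _ _
  change (((ξ t).2 ∈ K (ξ t).1) ∧ fderiv ℝ (fun x => ContinuousLinearMap.id ℝ E -
      chartProj H K hHK (ξ t).1 x) (extChartAt 𝓘(ℝ, E) (ξ t).1 (ξ t).1)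
        (show E × E from pathVelocity 𝓘(ℝ, E).tangent ξ (Icc a b) t).1 y +
        (ContinuousLinearMap.id ℝ E - chartProj H K hHK (ξ t).1
          (extChartAt 𝓘(ℝ, E) (ξ t).1 (ξ t).1))
        (show E × E from pathVelocity 𝓘(ℝ, E).tangent ξ (Icc a b) t).2 = 0) ∧
      ((show TangentSpace 𝓘(ℝ, E) (ξ t).1 from
        (show E × E from pathVelocity 𝓘(ℝ, E).tangent ξ (Icc a b) t).1) ∈ H (ξ t).1) ∧
      fderiv ℝ (chartProj H K hHK (ξ t).1) (extChartAt 𝓘(ℝ, E) (ξ t).1 (ξ t).1)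
        y (show E × E from pathVelocity 𝓘(ℝ, E).tangent ξ (Icc a b) t).1 +
      chartProj H K hHK (ξ t).1 (extChartAt 𝓘(ℝ, E) (ξ t).1 (ξ t).1)
        (show E × E from pathVelocity 𝓘(ℝ, E).tangent ξ (Icc a b) t).2 = 0 ↔ _
  rw [e]
  dsimp only
  rw [← ey, IsProjectionField.fderiv_compl]
  -- After the flip, membership in TH says that x' is in H and DP[k]x' + P k' = 0; the latter is the
  -- linearised constraint. The other conditions are automatic: x' is in H by hypothesis, and
  -- tangency to K is the derivative of P k = k.
  constructor
  · exact fun hh => (add_comm _ _).trans hh.2.2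
  · refine fun hh => ⟨⟨hξK t, ?_⟩, ?_, (add_comm _ _).trans hh⟩
    · have d3 := hasDerivWithinAt_field_apply ((hP (ξ t).1).differentiableAt
        (mem_extChartAt_target (I := 𝓘(ℝ, E)) (ξ t).1)) d1 d2
      have hev : (fun τ => readVec (ξ t).1 (ξ τ)) =ᶠ[𝓝[Icc a b] t] fun τ =>
          chartProj H K hHK (ξ t).1 (extChartAt 𝓘(ℝ, E) (ξ t).1 (ξ τ).1)
            (readVec (ξ t).1 (ξ τ)) := by
        filter_upwards [h.1.continuousWithinAt
          ((isOpen_extChartAt_source (ξ t).1).mem_nhds hp)] with τ hτ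
        exact ((chartProj_readVec_eq_self_iff (hHK := hHK) hτ _).2 (hξK τ)).symm
      have e2 := hu.eq_deriv _ d2 (d3.congr_of_eventuallyEq_of_mem hev ht)
      rw [sub_apply, ContinuousLinearMap.id_apply, neg_apply, neg_apply, neg_add_eq_zero,
        eq_sub_iff_add_eq]
      exact e2.symm
    · exact (congrArg (fun v : E => (show TangentSpace 𝓘(ℝ, E) (ξ t).1 from v) ∈ H (ξ t).1) eb).mp
        hξH

end Connection

/-! ### The Lie bracket and the curvature tensor in a chart. -/

section Curvature

open Filter

variable {E : Type*} [NormedAddCommGroup E] [NormedSpace ℝ E]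
  {M : Type*} [TopologicalSpace M] [ChartedSpace E M] [IsManifold 𝓘(ℝ, E) ∞ M]

theorem mfderivWithin_extChartAt_symm_eq {p : M} {y : E}
    (hy : y ∈ (extChartAt 𝓘(ℝ, E) p).target) :
    (mfderivWithin 𝓘(ℝ, E) 𝓘(ℝ, E) (extChartAt 𝓘(ℝ, E) p).symm (range 𝓘(ℝ, E)) y : E →L[ℝ] E) =
      tangentCoordChange 𝓘(ℝ, E) p ((extChartAt 𝓘(ℝ, E) p).symm y)
        ((extChartAt 𝓘(ℝ, E) p).symm y) := by
  set φ := extChartAt 𝓘(ℝ, E) p with hφ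
  have hs := φ.map_target hy
  have hd : MDifferentiableWithinAt 𝓘(ℝ, E) 𝓘(ℝ, E) φ.symm (range 𝓘(ℝ, E)) y :=
    ((contMDiffOn_extChartAt_symm (n := ∞) p).contMDiffAt
      ((isOpen_extChartAt_target p).mem_nhds hy)).mdifferentiableAt
        (by simp) |>.mdifferentiableWithinAt
  have h : mfderivWithin 𝓘(ℝ, E) 𝓘(ℝ, E) φ.symm (range 𝓘(ℝ, E)) y =
      fderivWithin ℝ (writtenInExtChartAt 𝓘(ℝ, E) 𝓘(ℝ, E) y φ.symm)
        ((extChartAt 𝓘(ℝ, E) y).symm ⁻¹' (range 𝓘(ℝ, E)) ∩ range 𝓘(ℝ, E))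
        (extChartAt 𝓘(ℝ, E) y y) := if_pos hd
  have h' : (extChartAt 𝓘(ℝ, E) y).symm ⁻¹' (range 𝓘(ℝ, E)) ∩ range 𝓘(ℝ, E) = univ := by
    simp
  rw [h', fderivWithin_univ] at h
  refine h.trans ?_
  have h2 := (hasFDerivAt_transition hs (mem_extChartAt_source (I := 𝓘(ℝ, E)) (φ.symm y))).fderiv
  rw [← hφ, φ.right_inv hy] at h2
  exact h2

/-- Identifies the pullback of vector fields inside `VectorField.mlieBracket` with their reading in
the chart. -/
theorem inverse_mfderivWithin_extChartAt_symm {p : M} {y : E}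
    (hy : y ∈ (extChartAt 𝓘(ℝ, E) p).target)
    (w : TangentSpace 𝓘(ℝ, E) ((extChartAt 𝓘(ℝ, E) p).symm y)) :
    (show E from (mfderivWithin 𝓘(ℝ, E) 𝓘(ℝ, E) (extChartAt 𝓘(ℝ, E) p).symm
      (range 𝓘(ℝ, E)) y).inverse w) =
      readVec p (⟨(extChartAt 𝓘(ℝ, E) p).symm y, w⟩ : TangentBundle 𝓘(ℝ, E) M) := by
  have hs := (extChartAt 𝓘(ℝ, E) p).map_target hy
  have h1 : (tangentCoordChange 𝓘(ℝ, E) p ((extChartAt 𝓘(ℝ, E) p).symm y)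
      ((extChartAt 𝓘(ℝ, E) p).symm y)).inverse =
      tangentCoordChange 𝓘(ℝ, E) ((extChartAt 𝓘(ℝ, E) p).symm y) p
        ((extChartAt 𝓘(ℝ, E) p).symm y) :=
    ContinuousLinearMap.inverse_eq (ContinuousLinearMap.ext (mkVecₗ_readVecₗ hs))
      (ContinuousLinearMap.ext (readVecₗ_mkVecₗ hs))
  exact congrArg (fun L : E →L[ℝ] E => L w)
    ((congrArg ContinuousLinearMap.inverse (mfderivWithin_extChartAt_symm_eq hy)).trans h1)

/-- In the trivialisation used at `p`, the derivative of the preferred chart is the identity, so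
transporting a bracket back to `M` at that point does nothing. -/
theorem inverse_mfderiv_extChartAt (p : M) (w : E) :
    (show E from (mfderiv 𝓘(ℝ, E) 𝓘(ℝ, E) (extChartAt 𝓘(ℝ, E) p) p).inverse w) = w := by
  have hp := mem_extChartAt_source (I := 𝓘(ℝ, E)) p
  have hd : MDifferentiableAt 𝓘(ℝ, E) 𝓘(ℝ, E) (extChartAt 𝓘(ℝ, E) p) p :=
    (contMDiffAt_extChartAt (n := ∞)).mdifferentiableAt (by simp)
  have h : mfderiv 𝓘(ℝ, E) 𝓘(ℝ, E) (extChartAt 𝓘(ℝ, E) p) p =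
      fderivWithin ℝ (writtenInExtChartAt 𝓘(ℝ, E) 𝓘(ℝ, E) p (extChartAt 𝓘(ℝ, E) p))
        (range 𝓘(ℝ, E)) (extChartAt 𝓘(ℝ, E) p p) := if_pos hd
  have h' : range 𝓘(ℝ, E) = univ := by simp
  rw [h', fderivWithin_univ] at h
  have h2 : (mfderiv 𝓘(ℝ, E) 𝓘(ℝ, E) (extChartAt 𝓘(ℝ, E) p) p : E →L[ℝ] E) =
      ContinuousLinearMap.id ℝ E := by
    refine h.trans ((hasFDerivAt_transition hp hp).fderiv.trans ?_)
    exact ContinuousLinearMap.ext fun v => tangentCoordChange_self hp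
  exact congrArg (fun L : E →L[ℝ] E => L w)
    ((congrArg ContinuousLinearMap.inverse h2).trans ContinuousLinearMap.inverse_id)

theorem lieBracketWithin_univ_congr {V V' W W' : E → E} {x : E} (hV : V =ᶠ[𝓝 x] V')
    (hW : W =ᶠ[𝓝 x] W') : VectorField.lieBracketWithin ℝ V W univ x =
      fderiv ℝ W' x (V' x) - fderiv ℝ V' x (W' x) := by
  rw [VectorField.lieBracketWithin_univ, VectorField.lieBracket, hV.fderiv_eq, hW.fderiv_eq,
    hV.eq_of_nhds, hW.eq_of_nhds]

/-- A vector field, read in the preferred chart at `p`. -/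
def chartField (p : M) (X : ∀ q : M, TangentSpace 𝓘(ℝ, E) q) (y : E) : E :=
  readVec p (⟨(extChartAt 𝓘(ℝ, E) p).symm y, X ((extChartAt 𝓘(ℝ, E) p).symm y)⟩ :
    TangentBundle 𝓘(ℝ, E) M)

theorem chartField_self (p : M) (X : ∀ q : M, TangentSpace 𝓘(ℝ, E) q) :
    chartField p X (extChartAt 𝓘(ℝ, E) p p) =
      readVec p (⟨p, X p⟩ : TangentBundle 𝓘(ℝ, E) M) := by
  rw [chartField, (extChartAt 𝓘(ℝ, E) p).left_inv (mem_extChartAt_source p)]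

/-- The Lie bracket in the preferred chart. -/
theorem readVec_mlieBracket (X Y : ∀ q : M, TangentSpace 𝓘(ℝ, E) q) (p : M) :
    readVec p (⟨p, VectorField.mlieBracket 𝓘(ℝ, E) X Y p⟩ : TangentBundle 𝓘(ℝ, E) M) =
      fderiv ℝ (chartField p Y) (extChartAt 𝓘(ℝ, E) p p)
        (readVec p (⟨p, X p⟩ : TangentBundle 𝓘(ℝ, E) M)) -
      fderiv ℝ (chartField p X) (extChartAt 𝓘(ℝ, E) p p)
        (readVec p (⟨p, Y p⟩ : TangentBundle 𝓘(ℝ, E) M)) := by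
  have hx0 := mem_extChartAt_target (I := 𝓘(ℝ, E)) p
  have hV : ∀ X : ∀ q : M, TangentSpace 𝓘(ℝ, E) q,
      (VectorField.mpullbackWithin 𝓘(ℝ, E) 𝓘(ℝ, E) (extChartAt 𝓘(ℝ, E) p).symm X
        (range 𝓘(ℝ, E)) : E → E) =ᶠ[𝓝 (extChartAt 𝓘(ℝ, E) p p)] chartField p X := fun X => by
    filter_upwards [(isOpen_extChartAt_target p).mem_nhds hx0] with y hy
    exact inverse_mfderivWithin_extChartAt_symm hy _
  have hset : (extChartAt 𝓘(ℝ, E) p).symm ⁻¹' univ ∩ range 𝓘(ℝ, E) = univ := by simp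
  have h1 := inverse_mfderiv_extChartAt p (VectorField.lieBracketWithin ℝ
      (VectorField.mpullbackWithin 𝓘(ℝ, E) 𝓘(ℝ, E) (extChartAt 𝓘(ℝ, E) p).symm X
        (range 𝓘(ℝ, E)) : E → E)
      (VectorField.mpullbackWithin 𝓘(ℝ, E) 𝓘(ℝ, E) (extChartAt 𝓘(ℝ, E) p).symm Y
        (range 𝓘(ℝ, E)) : E → E)
      ((extChartAt 𝓘(ℝ, E) p).symm ⁻¹' univ ∩ range 𝓘(ℝ, E)) (extChartAt 𝓘(ℝ, E) p p))
  refine (readVec_self p _).trans (h1.trans ?_)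
  rw [hset]
  refine (lieBracketWithin_univ_congr (hV X) (hV Y)).trans ?_
  rw [chartField_self, chartField_self]

variable [FiniteDimensional ℝ E] {H K : ∀ p : M, Submodule ℝ (TangentSpace 𝓘(ℝ, E) p)}
  (hHK : ∀ p, IsCompl (H p) (K p))

/-- Project to H the vector field that is constant in the chart. -/
theorem exists_isSectionNear (hHK : ∀ p, IsCompl (H p) (K p)) (hH : IsSmoothSubbundle H)
    (hK : IsSmoothSubbundle K) {p : M}
    {u : TangentSpace 𝓘(ℝ, E) p} (hu : u ∈ H p) :
    ∃ X : ∀ q : M, TangentSpace 𝓘(ℝ, E) q, IsSectionNear H p X ∧ X p = u := by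
  set φ := extChartAt 𝓘(ℝ, E) p with hφ
  have hP := isProjectionField_chartProj (hHK := hHK) hH hK p
  have hp := mem_extChartAt_source (I := 𝓘(ℝ, E)) p
  let u' : E := readVec p (⟨p, u⟩ : TangentBundle 𝓘(ℝ, E) M)
  let Z : E → E := fun x => u' - chartProj H K hHK p x u'
  have hZ : ContDiffOn ℝ ∞ Z φ.target :=
    contDiffOn_const.sub (hP.contDiffOn.clm_apply contDiffOn_const)
  have hX : ∀ q ∈ φ.source, (⟨q, mkVecₗ p q (Z (φ q))⟩ : TangentBundle 𝓘(ℝ, E) M) =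
      mkVec p (φ q) (Z (φ q)) := by
    intro q hq
    rw [mkVec, ← hφ, φ.left_inv hq]
    rfl
  refine ⟨fun q => mkVecₗ p q (Z (φ q)), ⟨φ.source, isOpen_extChartAt_source p, hp, ?_, ?_⟩, ?_⟩
  · refine ContMDiffOn.congr ?_ hX
    refine (contMDiffOn_mkVec contDiffOn_id hZ fun x hx => hx).comp ?_ fun q hq => φ.map_source hq
    exact (contMDiffOn_extChartAt (n := ∞)).mono (by rw [hφ, extChartAt_source])
  · intro q hq
    rw [← chartProj_readVec_eq_zero_iff (hHK := hHK) hq]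
    change chartProj H K hHK p (φ q) (readVecₗ p q (mkVecₗ p q (Z (φ q)))) = 0
    rw [readVecₗ_mkVecₗ hq]
    change chartProj H K hHK p (φ q) (u' - chartProj H K hHK p (φ q) u') = 0
    rw [map_sub, hP.idem _ (φ.map_source hq), sub_self]
  · have h1 : Z (φ p) = readVecₗ p p u := by
      change u' - chartProj H K hHK p (φ p) u' = _
      rw [(chartProj_readVec_eq_zero_iff (hHK := hHK) hp u).2 hu, sub_zero]
      rfl
    change mkVecₗ p p (Z (φ p)) = u
    rw [h1, mkVecₗ_readVecₗ hp]

/-- Differentiate P X = 0: modulo H, the derivative of a section of H depends only on the value of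
the section. -/
theorem chartProj_fderiv_chartField (hH : IsSmoothSubbundle H) (hK : IsSmoothSubbundle K) {p : M}
    {X : ∀ q : M, TangentSpace 𝓘(ℝ, E) q} (hX : IsSectionNear H p X) (z : E) :
    chartProj H K hHK p (extChartAt 𝓘(ℝ, E) p p)
      (fderiv ℝ (chartField p X) (extChartAt 𝓘(ℝ, E) p p) z) =
      -fderiv ℝ (chartProj H K hHK p) (extChartAt 𝓘(ℝ, E) p p) z
        (readVec p (⟨p, X p⟩ : TangentBundle 𝓘(ℝ, E) M)) := by
  obtain ⟨U, hU, hpU, hXs, hXH⟩ := hX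
  have hP := isProjectionField_chartProj (hHK := hHK) hH hK p
  have hx0 := mem_extChartAt_target (I := 𝓘(ℝ, E)) p
  have hφp := (extChartAt 𝓘(ℝ, E) p).left_inv (mem_extChartAt_source p)
  have hXd : HasFDerivAt (chartField p X) _ (extChartAt 𝓘(ℝ, E) p p) :=
    ((contDiffAt_readVec_section hU hXs hx0 (by rw [hφp]; exact hpU)).differentiableAt
      (by simp)).hasFDerivAt
  have h2 := (hP.differentiableAt hx0).hasFDerivAt.clm_apply hXd
  have hev : (fun y => chartProj H K hHK p y (chartField p X y))
      =ᶠ[𝓝 (extChartAt 𝓘(ℝ, E) p p)] fun _ => (0 : E) := by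
    have hc : ContinuousAt (extChartAt 𝓘(ℝ, E) p).symm (extChartAt 𝓘(ℝ, E) p p) :=
      continuousAt_extChartAt_symm p
    have hn : U ∈ 𝓝 ((extChartAt 𝓘(ℝ, E) p).symm (extChartAt 𝓘(ℝ, E) p p)) := by
      rw [hφp]; exact hU.mem_nhds hpU
    filter_upwards [(isOpen_extChartAt_target p).mem_nhds hx0, hc hn] with y hy hy'
    have := (chartProj_readVec_eq_zero_iff (hHK := hHK)
      ((extChartAt 𝓘(ℝ, E) p).map_target hy) _).2 (hXH _ hy')
    rwa [(extChartAt 𝓘(ℝ, E) p).right_inv hy] at this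
  have h3 := congrArg (fun L : E →L[ℝ] E => L z)
    (h2.unique ((hasFDerivAt_const (0 : E) _).congr_of_eventuallyEq hev))
  simp only [add_apply, ContinuousLinearMap.comp_apply, ContinuousLinearMap.flip_apply,
    zero_apply, chartField_self] at h3
  exact eq_neg_of_add_eq_zero_left h3

/-- For sections X, Y of H with values u, v at the point, P(DY[u] - DX[v]) = DP[v]u - DP[u]v. The
right-hand side involves only u and v, so the arbitrary choice in the definition is harmless. -/
theorem curvature_eq (hH : IsSmoothSubbundle H) (hK : IsSmoothSubbundle K) {p : M}
    {u v : TangentSpace 𝓘(ℝ, E) p} (hu : u ∈ H p) (hv : v ∈ H p) :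
    curvature H p u v = (H p).mkQ (mkVecₗ p p
      (fderiv ℝ (chartProj H K hHK p) (extChartAt 𝓘(ℝ, E) p p)
        (readVec p (⟨p, v⟩ : TangentBundle 𝓘(ℝ, E) M))
        (readVec p (⟨p, u⟩ : TangentBundle 𝓘(ℝ, E) M)) -
      fderiv ℝ (chartProj H K hHK p) (extChartAt 𝓘(ℝ, E) p p)
        (readVec p (⟨p, u⟩ : TangentBundle 𝓘(ℝ, E) M))
        (readVec p (⟨p, v⟩ : TangentBundle 𝓘(ℝ, E) M)))) := by
  have hP := isProjectionField_chartProj (hHK := hHK) hH hK p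
  have hp := mem_extChartAt_source (I := 𝓘(ℝ, E)) p
  have hx0 := mem_extChartAt_target (I := 𝓘(ℝ, E)) p
  obtain ⟨X, hX, hXu⟩ := exists_isSectionNear hHK hH hK hu
  obtain ⟨Y, hY, hYv⟩ := exists_isSectionNear hHK hH hK hv
  have hex : ∃ XY : (∀ q : M, TangentSpace 𝓘(ℝ, E) q) × (∀ q : M, TangentSpace 𝓘(ℝ, E) q),
      IsSectionNear H p XY.1 ∧ IsSectionNear H p XY.2 ∧ XY.1 p = u ∧ XY.2 p = v :=
    ⟨(X, Y), hX, hY, hXu, hYv⟩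
  -- These sections only serve to show that the definition takes its first branch; the computation
  -- is for the chosen ones.
  clear hX hXu hY hYv X Y
  rw [curvature, dif_pos hex]
  obtain ⟨hX, hY, hXu, hYv⟩ := hex.choose_spec
  generalize hex.choose.1 = X at *
  generalize hex.choose.2 = Y at *
  refine (Submodule.Quotient.eq _).2 ((chartProj_readVec_eq_zero_iff (hHK := hHK) hp _).1 ?_)
  have hb : chartProj H K hHK p (extChartAt 𝓘(ℝ, E) p p)
      (readVecₗ p p (VectorField.mlieBracket 𝓘(ℝ, E) X Y p)) = _ :=
    (congrArg _ (readVec_mlieBracket X Y p)).trans (map_sub _ _ _)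
  rw [chartProj_fderiv_chartField hHK hH hK hX, chartProj_fderiv_chartField hHK hH hK hY, hXu, hYv,
    neg_sub_neg] at hb
  refine (congrArg _ (map_sub (readVecₗ p p) _ _)).trans ?_
  rw [map_sub, readVecₗ_mkVecₗ hp, ← hb, hP.idem _ hx0, sub_self]

end Curvature

/-! ### Existence and uniqueness of parallel sections along the whole path. -/

section ParallelTransport

open Filter

variable {E : Type*} [NormedAddCommGroup E] [NormedSpace ℝ E]
  {M : Type*} [TopologicalSpace M] [ChartedSpace E M] [IsManifold 𝓘(ℝ, E) ∞ M]
  [FiniteDimensional ℝ E] {H K : ∀ p : M, Submodule ℝ (TangentSpace 𝓘(ℝ, E) p)}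
  {hHK : ∀ p, IsCompl (H p) (K p)}

theorem linearizedConstraint_subset {P : E → E →L[ℝ] E} {x X : ℝ → E} {J J' : Set ℝ} {t : ℝ}
    (hJ : J' ⊆ J) (hu : UniqueDiffWithinAt ℝ J' t) (hx : DifferentiableWithinAt ℝ x J t)
    (hX : DifferentiableWithinAt ℝ X J t) :
    linearizedConstraint P x X J' t = linearizedConstraint P x X J t := by
  rw [linearizedConstraint, linearizedConstraint, derivWithin_subset hJ hu hx,
    derivWithin_subset hJ hu hX]

/-- The vector field `ξ` along a path is smooth and satisfies the linearised constraint at `t`. -/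
def SatisfiesConstraintAt (H K : ∀ p : M, Submodule ℝ (TangentSpace 𝓘(ℝ, E) p))
    (hHK : ∀ p, IsCompl (H p) (K p)) (J : Set ℝ) (ξ : ℝ → TangentBundle 𝓘(ℝ, E) M) (t : ℝ) : Prop :=
  ContMDiffWithinAt 𝓘(ℝ, ℝ) 𝓘(ℝ, E).tangent ∞ ξ J t ∧
    chartConstraint H K hHK (ξ t).1 ξ J t = 0

namespace SatisfiesConstraintAt

variable {J J' : Set ℝ} {ξ ξ' : ℝ → TangentBundle 𝓘(ℝ, E) M} {t : ℝ}

theorem mono (h : SatisfiesConstraintAt H K hHK J ξ t) (hJ : J' ⊆ J)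
    (hu : UniqueDiffWithinAt ℝ J' t) : SatisfiesConstraintAt H K hHK J' ξ t := by
  refine ⟨h.1.mono hJ, Eq.trans ?_ h.2⟩
  have hp := mem_extChartAt_source (I := 𝓘(ℝ, E)) (ξ t).1
  have h1 := (contMDiffWithinAt_tangent_iff hp).1 h.1
  have h2 := (contMDiffWithinAt_iff_chart (f := fun τ => (ξ τ).1) hp).1 h1.1
  exact linearizedConstraint_subset hJ hu (h2.2.differentiableWithinAt (by simp))
    (h1.2.differentiableWithinAt (by simp))

theorem congr (h : SatisfiesConstraintAt H K hHK J ξ t) (ht : t ∈ J) (hJ : J =ᶠ[𝓝 t] J')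
    (hξ : ξ =ᶠ[𝓝[J] t] ξ') : SatisfiesConstraintAt H K hHK J' ξ' t := by
  have e := hξ.eq_of_nhdsWithin ht
  have hn : 𝓝[J'] t = 𝓝[J] t := (nhdsWithin_eq_iff_eventuallyEq.2 hJ).symm
  constructor
  · have h1 := h.1.congr_of_eventuallyEq hξ.symm e.symm
    exact (contMDiffWithinAt_congr_set hJ).1 h1
  · rw [← h.2, ← e]
    refine (linearizedConstraint_congr_set hJ.symm).trans (linearizedConstraint_congr ht ?_ ?_
      EventuallyEq.rfl)
    · filter_upwards [hξ] with τ hτ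
      rw [hτ]
    · filter_upwards [hξ] with τ hτ
      rw [hτ]

end SatisfiesConstraintAt

variable {β₀ : ℝ → M} {a b c d s t : ℝ}

/-- A vector field along a path. -/
def along (β₀ : ℝ → M) (X : ∀ t : ℝ, TangentSpace 𝓘(ℝ, E) (β₀ t)) (t : ℝ) :
    TangentBundle 𝓘(ℝ, E) M :=
  ⟨β₀ t, X t⟩

theorem isParallel_iff_satisfiesConstraintAt (hH : IsSmoothSubbundle H) (hK : IsSmoothSubbundle K)
    (hab : a < b) (hβ₀H : IsTangentPath H a b β₀) (σ : ∀ t : ℝ, K (β₀ t)) :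
    IsParallel H K a b β₀ σ ↔
      ∀ t ∈ Icc a b, SatisfiesConstraintAt H K hHK (Icc a b) (along β₀ fun t => (σ t).1) t :=
  (isParallel_iff hHK hH hK hab hβ₀H σ).trans
    ⟨fun h t ht => ⟨h.1 t ht, h.2 t ht⟩, fun h => ⟨fun t ht => (h t ht).1, fun t ht => (h t ht).2⟩⟩

theorem IsTangentPath.mono (hβ₀ : ContMDiffOn 𝓘(ℝ, ℝ) 𝓘(ℝ, E) ∞ β₀ (Icc a b))
    (h : IsTangentPath H a b β₀) (hac : a ≤ c) (hcd : c < d) (hdb : d ≤ b) :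
    IsTangentPath H c d β₀ := by
  intro t ht
  have hu := uniqueDiffOn_Icc hcd t ht
  have ht' := Icc_subset_Icc hac hdb ht
  have hm := (hβ₀ t ht').mdifferentiableWithinAt (by simp)
  have e : pathVelocity 𝓘(ℝ, E) β₀ (Icc c d) t = pathVelocity 𝓘(ℝ, E) β₀ (Icc a b) t :=
    congrArg (fun L : ℝ →L[ℝ] E => L 1)
      (mfderivWithin_subset (Icc_subset_Icc hac hdb) hu.uniqueMDiffWithinAt hm)
  rw [e]
  exact h t ht'

/-- The chart at `p` sees a section of `K` satisfying the linearised constraint as a solution of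
the linearised constraint. -/
theorem chart_solution (hH : IsSmoothSubbundle H) (hK : IsSmoothSubbundle K) (hcd : c < d)
    (hβ₀H : IsTangentPath H c d β₀) {p : M}
    (hp : ∀ t ∈ Icc c d, β₀ t ∈ (extChartAt 𝓘(ℝ, E) p).source)
    {X : ∀ t : ℝ, TangentSpace 𝓘(ℝ, E) (β₀ t)}
    (hX : ∀ t ∈ Icc c d, SatisfiesConstraintAt H K hHK (Icc c d) (along β₀ X) t) :
    ContDiffOn ℝ ∞ (fun t => readVec p (along β₀ X t)) (Icc c d) ∧
      ∀ t ∈ Icc c d, linearizedConstraint (chartProj H K hHK p)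
        (fun τ => extChartAt 𝓘(ℝ, E) p (β₀ τ)) (fun t => readVec p (along β₀ X t)) (Icc c d) t = 0 :=
  ⟨fun t ht => ((contMDiffWithinAt_tangent_iff (c := along β₀ X) (hp t ht)).1 (hX t ht).1).2,
    fun t ht => (chartConstraint_eq_zero_iff (ξ := along β₀ X) hH hK (uniqueDiffOn_Icc hcd t ht) ht
      (hX t ht).1 (hβ₀H t ht) (mem_extChartAt_source (β₀ t)) (hp t ht)).1 (hX t ht).2⟩

theorem contDiffOn_chart_path (hβ₀ : ContMDiffOn 𝓘(ℝ, ℝ) 𝓘(ℝ, E) ∞ β₀ (Icc c d)) {p : M}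
    (hp : ∀ t ∈ Icc c d, β₀ t ∈ (extChartAt 𝓘(ℝ, E) p).source) :
    ContDiffOn ℝ ∞ (fun t => extChartAt 𝓘(ℝ, E) p (β₀ t)) (Icc c d) := fun t ht =>
  ((contMDiffWithinAt_iff_chart (hp t ht)).1 (hβ₀ t ht)).2

theorem chartProj_chart_path (hcd : c < d) (hβ₀ : ContMDiffOn 𝓘(ℝ, ℝ) 𝓘(ℝ, E) ∞ β₀ (Icc c d))
    (hβ₀H : IsTangentPath H c d β₀) {p : M}
    (ht : t ∈ Icc c d) (hp : β₀ t ∈ (extChartAt 𝓘(ℝ, E) p).source) :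
    chartProj H K hHK p (extChartAt 𝓘(ℝ, E) p (β₀ t))
      (derivWithin (fun τ => extChartAt 𝓘(ℝ, E) p (β₀ τ)) (Icc c d) t) = 0 := by
  rw [← readVec_pathVelocity (hβ₀ t ht) (uniqueDiffOn_Icc hcd t ht) ht hp]
  exact (chartProj_readVec_eq_zero_iff hp _).2 (hβ₀H t ht)

theorem exists_chart_nhd (hβ₀ : ContMDiffOn 𝓘(ℝ, ℝ) 𝓘(ℝ, E) ∞ β₀ (Icc a b)) (ht : t ∈ Icc a b) :
    ∃ δ > 0, ∀ τ ∈ Icc a b, t - δ < τ → τ < t + δ →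
      β₀ τ ∈ (extChartAt 𝓘(ℝ, E) (β₀ t)).source := by
  have h := (hβ₀ t ht).continuousWithinAt.preimage_mem_nhdsWithin
    ((isOpen_extChartAt_source (I := 𝓘(ℝ, E)) (β₀ t)).mem_nhds (mem_extChartAt_source (β₀ t)))
  obtain ⟨δ, hδ, hball⟩ := Metric.mem_nhdsWithin_iff.1 h
  refine ⟨δ, hδ, fun τ hτ h1 h2 => hball ⟨?_, hτ⟩⟩
  rw [Real.ball_eq_Ioo]
  exact ⟨h1, h2⟩

/-- On short intervals this is uniqueness for a linear equation in one chart. Letting the base time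
`s` vary in the inductive property allows agreement to spread across an overlap in either direction.
-/
theorem eqOn_of_satisfiesConstraint (hH : IsSmoothSubbundle H) (hK : IsSmoothSubbundle K)
    (hab : a < b) (hβ₀ : ContMDiffOn 𝓘(ℝ, ℝ) 𝓘(ℝ, E) ∞ β₀ (Icc a b))
    (hβ₀H : IsTangentPath H a b β₀) {σ σ' : ∀ t : ℝ, K (β₀ t)}
    (hσ : ∀ t ∈ Icc a b, SatisfiesConstraintAt H K hHK (Icc a b) (along β₀ fun t => (σ t).1) t)
    (hσ' : ∀ t ∈ Icc a b, SatisfiesConstraintAt H K hHK (Icc a b) (along β₀ fun t => (σ' t).1) t)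
    (hs : s ∈ Icc a b) (h : σ s = σ' s) : ∀ t ∈ Icc a b, σ t = σ' t := by
  suffices hW : ∀ s ∈ Icc a b, σ s = σ' s → ∀ t ∈ Icc a b, σ t = σ' t from hW s hs h
  refine interval_induction (W := fun c d => ∀ s ∈ Icc c d, σ s = σ' s → ∀ t ∈ Icc c d, σ t = σ' t)
    hab (fun t ht => ?_) ?_
  · obtain ⟨δ, hδ, hp⟩ := exists_chart_nhd hβ₀ ht
    refine ⟨δ, hδ, fun c d hac hcd hdb h1 h2 s hs h τ hτ => ?_⟩
    have hsub := Icc_subset_Icc hac hdb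
    have hp' : ∀ τ ∈ Icc c d, β₀ τ ∈ (extChartAt 𝓘(ℝ, E) (β₀ t)).source := fun τ hτ =>
      hp τ (hsub hτ) (h1.trans_le hτ.1) (hτ.2.trans_lt h2)
    have hT := hβ₀H.mono hβ₀ hac hcd hdb
    have r1 := chart_solution hH hK hcd hT hp' fun τ hτ =>
      (hσ τ (hsub hτ)).mono hsub (uniqueDiffOn_Icc hcd τ hτ)
    have r2 := chart_solution hH hK hcd hT hp' fun τ hτ =>
      (hσ' τ (hsub hτ)).mono hsub (uniqueDiffOn_Icc hcd τ hτ)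
    have key := (isProjectionField_chartProj (hHK := hHK) hH hK (β₀ t)).eqOn_of_parallel hcd hs
      (contDiffOn_chart_path (hβ₀.mono hsub) hp') (fun τ hτ => (extChartAt 𝓘(ℝ, E) _).map_source
        (hp' τ hτ)) (r1.1.differentiableOn (by simp))
      (fun τ hτ => (chartProj_readVec_eq_self_iff (hp' τ hτ) _).2 (σ τ).2) r1.2
      (r2.1.differentiableOn (by simp))
      (fun τ hτ => (chartProj_readVec_eq_self_iff (hp' τ hτ) _).2 (σ' τ).2) r2.2 (by
        simp only [along]; rw [h]) hτ
    exact Subtype.ext (readVec_injective (hp' τ hτ) key)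
  · intro c c' d d' hac hcc' hc'd hdd' hd'b h1 h2 s hs h
    have hboth : ∀ s ∈ Icc c d, σ s = σ' s → ∀ t ∈ Icc c d', σ t = σ' t := by
      intro s hs h t ht
      rcases le_total t d with htd | htd
      · exact h1 s hs h t ⟨ht.1, htd⟩
      · exact h2 d ⟨hc'd.le, hdd'⟩ (h1 s hs h d ⟨hcc'.trans hc'd.le, le_rfl⟩) t
          ⟨hc'd.le.trans htd, ht.2⟩
    rcases le_total s d with hsd | hsd
    · exact hboth s ⟨hs.1, hsd⟩ h
    · exact hboth d ⟨hcc'.trans hc'd.le, le_rfl⟩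
        (h2 s ⟨hc'd.le.trans hsd, hs.2⟩ h d ⟨hc'd.le, hdd'⟩)

theorem exists_satisfiesConstraint (hH : IsSmoothSubbundle H) (hK : IsSmoothSubbundle K)
    (hab : a < b) (hβ₀ : ContMDiffOn 𝓘(ℝ, ℝ) 𝓘(ℝ, E) ∞ β₀ (Icc a b))
    (hβ₀H : IsTangentPath H a b β₀) : ∀ s ∈ Icc a b, ∀ k : K (β₀ s), ∃ σ : ∀ t : ℝ, K (β₀ t),
      σ s = k ∧ ∀ t ∈ Icc a b,
        SatisfiesConstraintAt H K hHK (Icc a b) (along β₀ fun t => (σ t).1) t := by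
  refine interval_induction (W := fun c d => ∀ s ∈ Icc c d, ∀ k : K (β₀ s),
    ∃ σ : ∀ t : ℝ, K (β₀ t), σ s = k ∧ ∀ t ∈ Icc c d,
      SatisfiesConstraintAt H K hHK (Icc c d) (along β₀ fun t => (σ t).1) t) hab (fun t ht => ?_) ?_
  · obtain ⟨δ, hδ, hp⟩ := exists_chart_nhd hβ₀ ht
    refine ⟨δ, hδ, fun c d hac hcd hdb h1 h2 s hs k₀ => ?_⟩
    have hsub := Icc_subset_Icc hac hdb
    have hp' : ∀ τ ∈ Icc c d, β₀ τ ∈ (extChartAt 𝓘(ℝ, E) (β₀ t)).source := fun τ hτ =>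
      hp τ (hsub hτ) (h1.trans_le hτ.1) (hτ.2.trans_lt h2)
    have hT := hβ₀H.mono hβ₀ hac hcd hdb
    obtain ⟨k, hks, hkd, hk⟩ := (isProjectionField_chartProj (hHK := hHK) hH hK
      (β₀ t)).exists_parallel hcd hs (contDiffOn_chart_path (hβ₀.mono hsub) hp')
      (fun τ hτ => (extChartAt 𝓘(ℝ, E) _).map_source (hp' τ hτ))
      (fun τ hτ => chartProj_chart_path hcd (hβ₀.mono hsub) hT hτ (hp' τ hτ))
      ((chartProj_readVec_eq_self_iff (hp' s hs) _).2 k₀.2)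
    -- Projecting makes σ a section of K at all times, also outside the interval; inside, k is
    -- already in K and nothing changes.
    let σ : ∀ τ : ℝ, K (β₀ τ) := fun τ =>
      ⟨tangentProj H K hHK (β₀ τ) (mkVecₗ (β₀ t) (β₀ τ) (k τ)), tangentProj_mem _⟩
    have hσk : ∀ τ ∈ Icc c d, readVec (β₀ t) (along β₀ (fun τ => (σ τ).1) τ) = k τ := by
      intro τ hτ
      refine (chartProj_readVec (hHK := hHK) (hp' τ hτ) (mkVecₗ (β₀ t) (β₀ τ) (k τ))).symm.trans ?_
      rw [← readVecₗ_apply, readVecₗ_mkVecₗ (hp' τ hτ)]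
      exact (hk τ hτ).1
    have hσs : ∀ τ ∈ Icc c d, ContMDiffWithinAt 𝓘(ℝ, ℝ) 𝓘(ℝ, E).tangent ∞
        (along β₀ fun τ => (σ τ).1) (Icc c d) τ := fun τ hτ =>
      (contMDiffWithinAt_tangent_iff (c := along β₀ fun τ => (σ τ).1) (hp' τ hτ)).2
        ⟨(hβ₀.mono hsub) τ hτ, (hkd τ hτ).congr hσk (hσk τ hτ)⟩
    refine ⟨σ, Subtype.ext (readVec_injective (hp' s hs) ((hσk s hs).trans hks)),
      fun τ hτ => ⟨hσs τ hτ, ?_⟩⟩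
    refine (chartConstraint_eq_zero_iff (ξ := along β₀ fun τ => (σ τ).1) hH hK
      (uniqueDiffOn_Icc hcd τ hτ) hτ (hσs τ hτ) (hT τ hτ) (hp' τ hτ)
      (mem_extChartAt_source (β₀ τ))).1 (Eq.trans ?_ (hk τ hτ).2)
    exact linearizedConstraint_congr hτ EventuallyEq.rfl
      (eventually_nhdsWithin_of_forall hσk) EventuallyEq.rfl
  · intro c c' d d' hac hcc' hc'd hdd' hd'b h1 h2
    have hcd := hcc'.trans_lt hc'd
    -- Equality at one time of the overlap gives equality on all of it by uniqueness, so near each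
    -- time the glued section coincides with one of the two solutions.
    have hglue : ∀ σ₁ σ₂ : ∀ t : ℝ, K (β₀ t), σ₁ c' = σ₂ c' →
        (∀ t ∈ Icc c d,
          SatisfiesConstraintAt H K hHK (Icc c d) (along β₀ fun t => (σ₁ t).1) t) →
        (∀ t ∈ Icc c' d',
          SatisfiesConstraintAt H K hHK (Icc c' d') (along β₀ fun t => (σ₂ t).1) t) →
        ∃ σ : ∀ t : ℝ, K (β₀ t), (∀ t ∈ Icc c d, σ t = σ₁ t) ∧ (∀ t ∈ Icc c' d', σ t = σ₂ t) ∧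
          ∀ t ∈ Icc c d',
            SatisfiesConstraintAt H K hHK (Icc c d') (along β₀ fun t => (σ t).1) t := by
      intro σ₁ σ₂ h hσ₁ hσ₂
      have hsub1 : Icc c' d ⊆ Icc c d := Icc_subset_Icc_left hcc'
      have hsub2 : Icc c' d ⊆ Icc c' d' := Icc_subset_Icc_right hdd'
      have hac' := hac.trans hcc'
      have heq := eqOn_of_satisfiesConstraint hH hK hc'd
        (hβ₀.mono (Icc_subset_Icc hac' (hdd'.trans hd'b)))
        (hβ₀H.mono hβ₀ hac' hc'd (hdd'.trans hd'b))
        (fun t ht => (hσ₁ t (hsub1 ht)).mono hsub1 (uniqueDiffOn_Icc hc'd t ht))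
        (fun t ht => (hσ₂ t (hsub2 ht)).mono hsub2 (uniqueDiffOn_Icc hc'd t ht))
        ⟨le_rfl, hc'd.le⟩ h
      let σ : ∀ t : ℝ, K (β₀ t) := fun t => if t ≤ d then σ₁ t else σ₂ t
      have e1 : ∀ t ∈ Icc c d, σ t = σ₁ t := fun t ht => if_pos ht.2
      have e2 : ∀ t ∈ Icc c' d', σ t = σ₂ t := fun t ht => by
        by_cases htd : t ≤ d
        · exact (if_pos htd).trans (heq t ⟨ht.1, htd⟩)
        · exact if_neg htd
      refine ⟨σ, e1, e2, fun t ht => ?_⟩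
      rcases lt_or_ge t d with htd | htd
      · refine (hσ₁ t ⟨ht.1, htd.le⟩).congr ⟨ht.1, htd.le⟩ ?_ ?_
        · filter_upwards [Iio_mem_nhds htd] with τ hτ
          exact propext ⟨fun h => ⟨h.1, h.2.trans hdd'⟩, fun h => ⟨h.1, le_of_lt hτ⟩⟩
        · filter_upwards [self_mem_nhdsWithin] with τ hτ
          rw [along, along, e1 τ hτ]
      · refine (hσ₂ t ⟨hc'd.le.trans htd, ht.2⟩).congr ⟨hc'd.le.trans htd, ht.2⟩ ?_ ?_
        · filter_upwards [Ioi_mem_nhds (hc'd.trans_le htd)] with τ hτ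
          exact propext ⟨fun h => ⟨hcc'.trans h.1, h.2⟩, fun h => ⟨le_of_lt hτ, h.2⟩⟩
        · filter_upwards [self_mem_nhdsWithin] with τ hτ
          rw [along, along, e2 τ hτ]
    intro s hs k
    rcases le_total s d with hsd | hsd
    · obtain ⟨σ₁, hσ₁s, hσ₁⟩ := h1 s ⟨hs.1, hsd⟩ k
      obtain ⟨σ₂, hσ₂s, hσ₂⟩ := h2 c' ⟨le_rfl, hc'd.le.trans hdd'⟩ (σ₁ c')
      obtain ⟨σ, e1, e2, hσ⟩ := hglue σ₁ σ₂ hσ₂s.symm hσ₁ hσ₂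
      exact ⟨σ, (e1 s ⟨hs.1, hsd⟩).trans hσ₁s, hσ⟩
    · have hs' : s ∈ Icc c' d' := ⟨hc'd.le.trans hsd, hs.2⟩
      obtain ⟨σ₂, hσ₂s, hσ₂⟩ := h2 s hs' k
      obtain ⟨σ₁, hσ₁s, hσ₁⟩ := h1 c' ⟨hcc', hc'd.le⟩ (σ₂ c')
      obtain ⟨σ, e1, e2, hσ⟩ := hglue σ₁ σ₂ hσ₁s hσ₁ hσ₂
      exact ⟨σ, (e2 s hs').trans hσ₂s, hσ⟩

end ParallelTransport

/-! ### Algebra of the linearised constraint. -/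

section LinearizedConstraint

open Filter

variable {E : Type*} [NormedAddCommGroup E] [NormedSpace ℝ E] {P : E → E →L[ℝ] E} {V : Set E}
  {x X : ℝ → E} {J : Set ℝ} {t : ℝ} {n : ℕ}

theorem hasDerivWithinAt_sum_smul {F : Type*} [NormedAddCommGroup F] [NormedSpace ℝ F]
    {κ : Fin n → ℝ → ℝ} {κ' : Fin n → ℝ} {s : Fin n → ℝ → F} {s' : Fin n → F}
    (hκ : ∀ i, HasDerivWithinAt (κ i) (κ' i) J t) (hs : ∀ i, HasDerivWithinAt (s i) (s' i) J t) :
    HasDerivWithinAt (fun τ => ∑ i, κ i τ • s i τ) (∑ i, κ i t • s' i + ∑ i, κ' i • s i t) J t := by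
  rw [← Finset.sum_add_distrib]
  exact HasDerivWithinAt.fun_sum fun i _ => (hκ i).smul (hs i)

theorem derivWithin_eq_sum_smul {F : Type*} [NormedAddCommGroup F] [NormedSpace ℝ F]
    {κ : Fin n → ℝ → ℝ} {κ' : Fin n → ℝ} {v : Fin n → F} {f : ℝ → F}
    (hf : ∀ τ, f τ = ∑ i, κ i τ • v i) (hu : UniqueDiffWithinAt ℝ J t)
    (hκ : ∀ i, HasDerivWithinAt (κ i) (κ' i) J t) :
    derivWithin f J t = ∑ i, κ' i • v i := by
  rw [funext hf]
  refine (HasDerivWithinAt.fun_sum fun i _ => ?_).derivWithin hu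
  exact (hκ i).smul_const (v i)

/-- The coefficients of a differentiable vector with respect to differentiable independent vectors
are differentiable. -/
theorem differentiableWithinAt_coeff [FiniteDimensional ℝ E] {s : Fin n → ℝ → E} {κ : Fin n → ℝ → ℝ} {k : ℝ → E}
    (ht : t ∈ J)
    (hs : ∀ i, DifferentiableWithinAt ℝ (s i) J t) (hk : DifferentiableWithinAt ℝ k J t)
    (hli : LinearIndependent ℝ fun i => s i t) (h : ∀ᶠ τ in 𝓝[J] t, k τ = ∑ i, κ i τ • s i τ)
    (i : Fin n) : DifferentiableWithinAt ℝ (κ i) J t := by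
  let A : ℝ → (Fin n → ℝ) →L[ℝ] E := fun τ =>
    ∑ i, (ContinuousLinearMap.proj (R := ℝ) (φ := fun _ : Fin n => ℝ) i).smulRight (s i τ)
  have hA : ∀ τ c, A τ c = ∑ i, c i • s i τ := fun τ c => by simp [A, sum_apply]
  have hAd : DifferentiableWithinAt ℝ A J t := by
    refine DifferentiableWithinAt.fun_sum fun i _ => ?_
    exact ((ContinuousLinearMap.smulRightL ℝ (Fin n → ℝ) E
      (ContinuousLinearMap.proj (R := ℝ) (φ := fun _ : Fin n => ℝ)
        i)).differentiableAt.comp_differentiableWithinAt t (hs i))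
  have hker : (A t : (Fin n → ℝ) →ₗ[ℝ] E).ker = ⊥ := by
    rw [LinearMap.ker_eq_bot']
    intro c hc
    exact funext (Fintype.linearIndependent_iff.1 hli c ((hA t c).symm.trans hc))
  -- With a left inverse `R` of `A t`, the square maps R A(τ) are invertible near `t`, and the
  -- coefficients are (R A)⁻¹ R k.
  obtain ⟨R, hR⟩ : ∃ R : E →L[ℝ] (Fin n → ℝ), R ∘L A t = ContinuousLinearMap.id ℝ _ := by
    obtain ⟨g, hg⟩ := LinearMap.exists_leftInverse_of_injective _ hker
    exact ⟨LinearMap.toContinuousLinearMap g, ContinuousLinearMap.ext fun c =>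
      congrArg (fun L : (Fin n → ℝ) →ₗ[ℝ] (Fin n → ℝ) => L c) hg⟩
  have hBd : DifferentiableWithinAt ℝ (fun τ => R ∘L A τ) J t :=
    (differentiableWithinAt_const R).clm_comp hAd
  have hinv : DifferentiableAt ℝ (ContinuousLinearMap.inverse :
      ((Fin n → ℝ) →L[ℝ] (Fin n → ℝ)) → _) (R ∘L A t) := by
    rw [hR]
    exact (contDiffAt_map_inverse (n := 1) (ContinuousLinearEquiv.refl ℝ
      (Fin n → ℝ))).differentiableAt one_ne_zero
  have hev : ∀ᶠ τ in 𝓝[J] t, ∃ e : (Fin n → ℝ) ≃L[ℝ] (Fin n → ℝ),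
      (e : (Fin n → ℝ) →L[ℝ] (Fin n → ℝ)) = R ∘L A τ := by
    have hn : range (ContinuousLinearEquiv.toContinuousLinearMap (R₁ := ℝ) (M₁ := Fin n → ℝ)
        (M₂ := Fin n → ℝ)) ∈ 𝓝 (R ∘L A t) := by
      rw [hR]
      exact ContinuousLinearEquiv.nhds (ContinuousLinearEquiv.refl ℝ (Fin n → ℝ))
    exact hBd.continuousWithinAt hn
  have hmain : (fun τ => fun i => κ i τ) =ᶠ[𝓝[J] t]
      fun τ => (R ∘L A τ).inverse (R (k τ)) := by
    filter_upwards [hev, h] with τ hτ hτ'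
    obtain ⟨e, he⟩ := hτ
    rw [hτ', ← hA τ fun i => κ i τ]
    change _ = (R ∘L A τ).inverse ((R ∘L A τ) fun i => κ i τ)
    rw [← he, ContinuousLinearMap.inverse_equiv]
    simp
  have hd : DifferentiableWithinAt ℝ (fun τ => (R ∘L A τ).inverse (R (k τ))) J t :=
    (hinv.comp_differentiableWithinAt t hBd).clm_apply (R.differentiableAt.comp_differentiableWithinAt
      t hk)
  exact differentiableWithinAt_pi.1 (hd.congr_of_eventuallyEq_of_mem hmain ht) i

theorem linearizedConstraint_sum_smul {κ : Fin n → ℝ → ℝ} {s : Fin n → ℝ → E}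
    (hu : UniqueDiffWithinAt ℝ J t) (hκ : ∀ i, DifferentiableWithinAt ℝ (κ i) J t)
    (hs : ∀ i, DifferentiableWithinAt ℝ (s i) J t) :
    linearizedConstraint P x (fun τ => ∑ i, κ i τ • s i τ) J t =
      ∑ i, κ i t • linearizedConstraint P x (s i) J t +
        P (x t) (∑ i, derivWithin (κ i) J t • s i t) := by
  rw [linearizedConstraint, (hasDerivWithinAt_sum_smul (fun i => (hκ i).hasDerivWithinAt)
    fun i => (hs i).hasDerivWithinAt).derivWithin hu]
  simp only [linearizedConstraint, map_add, map_sum, map_smul, sum_apply, smul_apply, smul_add,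
    Finset.sum_add_distrib]
  abel

/-- The term P X' is in the image of P, and so is DP[X]x', because DP maps ker P into im P. -/
theorem IsProjectionField.apply_linearizedConstraint (hP : IsProjectionField P V) (hx : x t ∈ V)
    (hw : P (x t) (derivWithin x J t) = 0) :
    P (x t) (linearizedConstraint P x X J t) = linearizedConstraint P x X J t := by
  have h := hP.fderiv_idem hx (derivWithin x J t) (X t)
  rw [hw, map_zero, zero_add] at h
  rw [linearizedConstraint, map_add, hP.idem _ hx, h]

/-- Splits X into its K-part and its H-part; what is subtracted is the chart expression of the
curvature on the H-part of X and x'. The computation is the derivative of P² = P. -/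
theorem IsProjectionField.linearizedConstraint_proj (hP : IsProjectionField P V) (hxV : x t ∈ V)
    (hu : UniqueDiffWithinAt ℝ J t) (hx : DifferentiableWithinAt ℝ x J t)
    (hX : DifferentiableWithinAt ℝ X J t) :
    linearizedConstraint P x X J t =
      linearizedConstraint P x (fun τ => P (x τ) (X τ)) J t -
        (fderiv ℝ P (x t) (derivWithin x J t) (X t - P (x t) (X t)) -
          fderiv ℝ P (x t) (X t - P (x t) (X t)) (derivWithin x J t)) := by
  have h := hP.fderiv_idem hxV (X t) (derivWithin x J t)
  rw [← eq_sub_iff_add_eq'] at h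
  rw [linearizedConstraint, linearizedConstraint, (hasDerivWithinAt_field_apply
    (hP.differentiableAt hxV) hx.hasDerivWithinAt hX.hasDerivWithinAt).derivWithin hu, map_add, h,
    hP.idem _ hxV]
  simp only [map_sub, sub_apply]
  abel

end LinearizedConstraint

/-! ### The operator of infinitesimal variation in a parallel frame. -/

section Operator

open Filter

variable {E : Type*} [NormedAddCommGroup E] [NormedSpace ℝ E]
  {M : Type*} [TopologicalSpace M] [ChartedSpace E M] [IsManifold 𝓘(ℝ, E) ∞ M]
  [FiniteDimensional ℝ E] {H K : ∀ p : M, Submodule ℝ (TangentSpace 𝓘(ℝ, E) p)}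
  {hHK : ∀ p, IsCompl (H p) (K p)} {β₀ : ℝ → M} {a b s t t₀ : ℝ}

theorem SatisfiesConstraintAt.sum_smul {n : ℕ} {J : Set ℝ} (hu : UniqueDiffWithinAt ℝ J t)
    (hβ₀ : ContMDiffWithinAt 𝓘(ℝ, ℝ) 𝓘(ℝ, E) ∞ β₀ J t) (c : Fin n → ℝ) {F : Fin n → ∀ t, K (β₀ t)}
    (hF : ∀ i, SatisfiesConstraintAt H K hHK J (along β₀ fun t => (F i t).1) t) :
    SatisfiesConstraintAt H K hHK J (along β₀ fun t => (∑ i, c i • F i t : K (β₀ t)).1) t := by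
  have hp := mem_extChartAt_source (I := 𝓘(ℝ, E)) (β₀ t)
  have hd : ∀ i, ContDiffWithinAt ℝ ∞
      (fun τ => readVec (β₀ t) (along β₀ (fun t => (F i t).1) τ)) J t := fun i =>
    ((contMDiffWithinAt_tangent_iff (c := along β₀ fun t => (F i t).1) hp).1 (hF i).1).2
  have he : ∀ τ, readVec (β₀ t) (along β₀ (fun t => (∑ i, c i • F i t : K (β₀ t)).1) τ) =
      ∑ i, c i • readVec (β₀ t) (along β₀ (fun t => (F i t).1) τ) := by
    intro τ
    change readVecₗ (β₀ t) (β₀ τ) ((K (β₀ τ)).subtype (∑ i, c i • F i τ)) = _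
    rw [map_sum, map_sum]
    refine Finset.sum_congr rfl fun i _ => ?_
    rw [map_smul, map_smul]
    rfl
  constructor
  · refine (contMDiffWithinAt_tangent_iff
      (c := along β₀ fun t => (∑ i, c i • F i t : K (β₀ t)).1) hp).2 ⟨hβ₀, ?_⟩
    rw [funext he]
    exact ContDiffWithinAt.sum fun i _ => contDiffWithinAt_const.smul (hd i)
  · refine (congrArg (fun k => linearizedConstraint (chartProj H K hHK (β₀ t)) (fun τ =>
      extChartAt 𝓘(ℝ, E) (β₀ t) (β₀ τ)) k J t) (funext he)).trans ?_
    rw [linearizedConstraint_sum_smul hu (κ := fun i _ => c i)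
      (fun i => differentiableWithinAt_const _) fun i => (hd i).differentiableWithinAt (by simp)]
    have h0 : ∀ i, linearizedConstraint (chartProj H K hHK (β₀ t)) (fun τ =>
      extChartAt 𝓘(ℝ, E) (β₀ t) (β₀ τ))
        (fun τ => readVec (β₀ t) (along β₀ (fun t => (F i t).1) τ)) J t = 0 := fun i => (hF i).2
    refine (congrArg₂ (· + ·) (Finset.sum_eq_zero fun i _ => ?_) ?_).trans (add_zero 0)
    · rw [h0, smul_zero]
    · simp

theorem transport_eq (hHK : ∀ p, IsCompl (H p) (K p)) (hH : IsSmoothSubbundle H)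
    (hK : IsSmoothSubbundle K)
    (hab : a < b) (hβ₀ : ContMDiffOn 𝓘(ℝ, ℝ) 𝓘(ℝ, E) ∞ β₀ (Icc a b))
    (hβ₀H : IsTangentPath H a b β₀) {σ : ∀ t : ℝ, K (β₀ t)}
    (hσ : ∀ t ∈ Icc a b, SatisfiesConstraintAt H K hHK (Icc a b) (along β₀ fun t => (σ t).1) t)
    (hs : s ∈ Icc a b) (ht : t ∈ Icc a b) : transport H K a b β₀ s t (σ s) = σ t := by
  have hiff := isParallel_iff_satisfiesConstraintAt (hHK := hHK) hH hK hab hβ₀H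
  have hex : ∃ σ' : ∀ t : ℝ, K (β₀ t), IsParallel H K a b β₀ σ' ∧ σ' s = σ s :=
    ⟨σ, (hiff σ).2 hσ, rfl⟩
  rw [transport, dif_pos hex]
  exact eqOn_of_satisfiesConstraint hH hK hab hβ₀ hβ₀H ((hiff _).1 hex.choose_spec.1) hσ hs
    hex.choose_spec.2 t ht

/-- Transport a basis from `t₀`. By uniqueness, a constant combination that vanishes at one time
vanishes at `t₀`, which gives independence; comparison at `t₀` also shows that the coordinates of a
vector are those of its transport to `t₀`. -/
theorem exists_parallel_frame (hHK : ∀ p, IsCompl (H p) (K p)) (hH : IsSmoothSubbundle H)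
    (hK : IsSmoothSubbundle K)
    (hab : a < b) (hβ₀ : ContMDiffOn 𝓘(ℝ, ℝ) 𝓘(ℝ, E) ∞ β₀ (Icc a b))
    (hβ₀H : IsTangentPath H a b β₀) (ht₀ : t₀ ∈ Icc a b) :
    ∃ (n : ℕ) (e : Module.Basis (Fin n) ℝ (K (β₀ t₀))) (F : Fin n → ∀ t, K (β₀ t)),
      (∀ i, ∀ t ∈ Icc a b,
        SatisfiesConstraintAt H K hHK (Icc a b) (along β₀ fun t => (F i t).1) t) ∧
      (∀ t ∈ Icc a b, LinearIndependent ℝ fun i => F i t) ∧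
      (∀ t ∈ Icc a b, ∀ c : Fin n → ℝ,
        transport H K a b β₀ t₀ t (∑ i, c i • e i) = ∑ i, c i • F i t) ∧
      ∀ t ∈ Icc a b, ∀ k : K (β₀ t),
        k = ∑ i, e.repr (transport H K a b β₀ t t₀ k) i • F i t := by
  have : FiniteDimensional ℝ (TangentSpace 𝓘(ℝ, E) (β₀ t₀)) :=
    inferInstanceAs (FiniteDimensional ℝ E)
  let e := Module.finBasis ℝ (K (β₀ t₀))
  have hex := exists_satisfiesConstraint (hHK := hHK) hH hK hab hβ₀ hβ₀H
  choose F hF0 hF using fun i => hex t₀ ht₀ (e i)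
  have hsum : ∀ c : Fin _ → ℝ, ∀ t ∈ Icc a b, SatisfiesConstraintAt H K hHK (Icc a b)
      (along β₀ fun t => (∑ i, c i • F i t : K (β₀ t)).1) t := fun c t ht =>
    SatisfiesConstraintAt.sum_smul (uniqueDiffOn_Icc hab t ht) (hβ₀ t ht) c fun i => hF i t ht
  have hc0 : ∀ c : Fin _ → ℝ, ∑ i, c i • F i t₀ = ∑ i, c i • e i := fun c => by
    simp only [hF0]
  refine ⟨_, e, F, hF, fun t ht => Fintype.linearIndependent_iff.2 fun c hc => ?_,
    fun t ht c => ?_, fun t ht k => ?_⟩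
  · have h := eqOn_of_satisfiesConstraint hH hK hab hβ₀ hβ₀H (hsum c) (hsum fun _ => 0) ht
      (by simp only [hc, zero_smul, Finset.sum_const_zero]) t₀ ht₀
    simp only [hF0, zero_smul, Finset.sum_const_zero] at h
    exact Fintype.linearIndependent_iff.1 e.linearIndependent c h
  · rw [← hc0]
    exact transport_eq hHK hH hK hab hβ₀ hβ₀H (hsum c) ht₀ ht
  · obtain ⟨σ, hσt, hσ⟩ := hex t ht k
    have h1 : transport H K a b β₀ t t₀ k = σ t₀ := by
      rw [← hσt]; exact transport_eq hHK hH hK hab hβ₀ hβ₀H hσ ht ht₀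
    rw [h1, ← hσt]
    refine eqOn_of_satisfiesConstraint hH hK hab hβ₀ hβ₀H hσ (hsum _) ht₀ ?_ t ht
    rw [hc0, e.sum_repr]

theorem quotientTransport_mkQ (v : TangentSpace 𝓘(ℝ, E) (β₀ s)) :
    quotientTransport H K hHK a b β₀ s t ((H (β₀ s)).mkQ v) =
      (H (β₀ t)).mkQ (transport H K a b β₀ s t ⟨tangentProj H K hHK (β₀ s) v, tangentProj_mem v⟩) :=
  rfl

/-- Both sides are computed in a parallel frame. The operator is the class modulo H of ∑ κᵢ' Fᵢ
minus the curvature term, and the constraint is the image under P of the same vector read in the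
chart. -/
theorem variationOperator_eq_zero_iff (hH : IsSmoothSubbundle H) (hK : IsSmoothSubbundle K)
    (hab : a < b) (hβ₀ : ContMDiffOn 𝓘(ℝ, ℝ) 𝓘(ℝ, E) ∞ β₀ (Icc a b))
    (hβ₀H : IsTangentPath H a b β₀) (ht₀ : t₀ ∈ Icc a b)
    {X : ∀ t : ℝ, TangentSpace 𝓘(ℝ, E) (β₀ t)} (hX : IsSmoothAlong a b β₀ X) (ht : t ∈ Icc a b) :
    variationOperator H K hHK a b β₀ t₀ X t = 0 ↔
      chartConstraint H K hHK (β₀ t) (along β₀ X) (Icc a b) t = 0 := by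
  obtain ⟨n, e, F, hF, hli, htr, hrepr⟩ := exists_parallel_frame hHK hH hK hab hβ₀ hβ₀H ht₀
  have hu := uniqueDiffOn_Icc hab t ht
  have hp := mem_extChartAt_source (I := 𝓘(ℝ, E)) (β₀ t)
  have hP := isProjectionField_chartProj (hHK := hHK) hH hK (β₀ t)
  let P := chartProj H K hHK (β₀ t)
  let x : ℝ → E := fun τ => extChartAt 𝓘(ℝ, E) (β₀ t) (β₀ τ)
  let Z : ℝ → E := fun τ => readVec (β₀ t) (along β₀ X τ)
  let f : Fin n → ℝ → E := fun i τ => readVec (β₀ t) (along β₀ (fun t => (F i t).1) τ)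
  -- Coordinates at `t₀` of the transported K-part of X; they are also its coordinates in the
  -- parallel frame at time τ.
  let κ : Fin n → ℝ → ℝ := fun i τ => e.repr (transport H K a b β₀ τ t₀
    ⟨tangentProj H K hHK (β₀ τ) (X τ), tangentProj_mem (X τ)⟩) i
  let w : E := derivWithin x (Icc a b) t
  have hxV : x t ∈ (extChartAt 𝓘(ℝ, E) (β₀ t)).target := mem_extChartAt_target (β₀ t)
  have hxd : DifferentiableWithinAt ℝ x (Icc a b) t :=
    ((contMDiffWithinAt_iff_chart hp).1 (hβ₀ t ht)).2.differentiableWithinAt (by simp)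
  have hZd : DifferentiableWithinAt ℝ Z (Icc a b) t :=
    ((contMDiffWithinAt_tangent_iff (c := along β₀ X) hp).1 (hX t ht)).2.differentiableWithinAt
      (by simp)
  have hfd : ∀ i, DifferentiableWithinAt ℝ (f i) (Icc a b) t := fun i =>
    ((contMDiffWithinAt_tangent_iff (c := along β₀ fun t => (F i t).1) hp).1
      (hF i t ht).1).2.differentiableWithinAt (by simp)
  have hw0 : P (x t) w = 0 := chartProj_chart_path hab hβ₀ hβ₀H ht hp
  have hkd : DifferentiableWithinAt ℝ (fun τ => P (x τ) (Z τ)) (Icc a b) t :=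
    (hasDerivWithinAt_field_apply (hP.differentiableAt hxV) hxd.hasDerivWithinAt
      hZd.hasDerivWithinAt).differentiableWithinAt
  have hrd : ∀ τ, ∀ c : Fin n → ℝ, readVecₗ (β₀ t) (β₀ τ) (∑ i, c i • F i τ : K (β₀ τ)).1 =
      ∑ i, c i • f i τ := by
    intro τ c
    change readVecₗ (β₀ t) (β₀ τ) ((K (β₀ τ)).subtype (∑ i, c i • F i τ)) = _
    rw [map_sum, map_sum]
    refine Finset.sum_congr rfl fun i _ => ?_
    rw [map_smul, map_smul]
    rfl
  have hsum : (fun τ => P (x τ) (Z τ)) =ᶠ[𝓝[Icc a b] t] fun τ => ∑ i, κ i τ • f i τ := by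
    filter_upwards [self_mem_nhdsWithin, (hβ₀ t ht).continuousWithinAt.preimage_mem_nhdsWithin
      ((isOpen_extChartAt_source (I := 𝓘(ℝ, E)) (β₀ t)).mem_nhds hp)] with τ hτ hτ'
    refine (chartProj_readVec hτ' (X τ)).trans ((congrArg (fun k : K (β₀ τ) =>
      readVecₗ (β₀ t) (β₀ τ) k.1) (hrepr τ hτ ⟨tangentProj H K hHK (β₀ τ) (X τ),
        tangentProj_mem (X τ)⟩)).trans (hrd τ _))
  have hlif : LinearIndependent ℝ fun i => f i t :=
    (hli t ht).map' (readVecₗ (β₀ t) (β₀ t) ∘ₗ (K (β₀ t)).subtype) (LinearMap.ker_eq_bot.2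
      ((readVecEquiv hp).injective.comp Subtype.val_injective))
  have hκ : ∀ i, DifferentiableWithinAt ℝ (κ i) (Icc a b) t :=
    differentiableWithinAt_coeff ht hfd hkd hlif hsum
  let c : Fin n → ℝ := fun i => derivWithin (κ i) (Icc a b) t
  have hPf : ∀ i, P (x t) (f i t) = f i t := fun i =>
    (chartProj_readVec_eq_self_iff hp _).2 (F i t).2
  have hLk : linearizedConstraint P x (fun τ => P (x τ) (Z τ)) (Icc a b) t =
      ∑ i, c i • f i t := by
    rw [linearizedConstraint_congr ht EventuallyEq.rfl hsum EventuallyEq.rfl,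
      linearizedConstraint_sum_smul hu hκ hfd, map_sum]
    have h0 : ∀ i, linearizedConstraint P x (f i) (Icc a b) t = 0 := fun i => (hF i t ht).2
    simp only [h0, smul_zero, Finset.sum_const_zero, zero_add, map_smul, hPf, c]
  have hL := hP.linearizedConstraint_proj hxV hu hxd hZd
  have hder : derivWithin (fun τ => quotientTransport H K hHK a b β₀ τ t₀
      ((H (β₀ τ)).mkQ (X τ))) (Icc a b) t = (H (β₀ t₀)).mkQ (∑ i, c i • e i : K (β₀ t₀)).1 := by
    have hsm : ∀ c : Fin n → ℝ, (H (β₀ t₀)).mkQ (∑ i, c i • e i : K (β₀ t₀)).1 =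
        ∑ i, c i • (H (β₀ t₀)).mkQ (e i).1 := by
      intro c
      change (H (β₀ t₀)).mkQ ((K (β₀ t₀)).subtype (∑ i, c i • e i)) = _
      simp only [map_sum, map_smul, Submodule.subtype_apply]
    let S : Submodule ℝ E := H (β₀ t₀)
    -- Closedness makes the quotient a normed space, where the derivative can be computed termwise.
    have hS : IsClosed (S : Set E) := S.closed_of_finiteDimensional
    refine Eq.trans (derivWithin_eq_sum_smul (F := E ⧸ S)
      (κ := κ) (v := fun i => (H (β₀ t₀)).mkQ (e i).1) (fun τ => ?_) hu
      fun i => (hκ i).hasDerivWithinAt) (hsm c).symm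
    rw [quotientTransport_mkQ]
    refine Eq.trans ?_ (hsm fun i => κ i τ)
    rw [e.sum_repr]
  have hmain : variationOperator H K hHK a b β₀ t₀ X t = (H (β₀ t)).mkQ
      ((∑ i, c i • F i t : K (β₀ t)).1 - mkVecₗ (β₀ t) (β₀ t)
        (fderiv ℝ P (x t) w (Z t - P (x t) (Z t)) - fderiv ℝ P (x t) (Z t - P (x t) (Z t)) w)) := by
    have hZ : readVec (β₀ t) (⟨β₀ t, ((H (β₀ t)).projectionOnto (K (β₀ t)) (hHK (β₀ t)) (X t) :
        TangentSpace 𝓘(ℝ, E) (β₀ t))⟩ : TangentBundle 𝓘(ℝ, E) M) = Z t - P (x t) (Z t) := by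
      have h1 : ((H (β₀ t)).projectionOnto (K (β₀ t)) (hHK (β₀ t)) (X t) :
          TangentSpace 𝓘(ℝ, E) (β₀ t)) = X t - tangentProj H K hHK (β₀ t) (X t) := by
        rw [eq_sub_iff_add_eq, Submodule.coe_projectionOnto_apply, tangentProj,
          Submodule.projection_add_projection_eq_self]
      rw [h1]
      exact (map_sub (readVecₗ (β₀ t) (β₀ t)) _ _).trans
        (congrArg (fun v => Z t - v) (chartProj_readVec hp (X t)).symm)
    have hwv := readVec_pathVelocity (hβ₀ t ht) hu ht hp
    rw [variationOperator, hder, quotientTransport_mkQ, curvature_eq hHK hH hK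
      (Submodule.coe_mem _) (hβ₀H t ht), hZ, hwv, ← map_sub]
    have hself : (⟨tangentProj H K hHK (β₀ t₀) (∑ i, c i • e i : K (β₀ t₀)).1,
        tangentProj_mem _⟩ : K (β₀ t₀)) = ∑ i, c i • e i :=
      Subtype.ext (tangentProj_eq_self_iff.2 (Submodule.coe_mem _))
    rw [hself, htr t ht]
  rw [hmain, Submodule.mkQ_apply, Submodule.Quotient.mk_eq_zero,
    ← chartProj_readVec_eq_zero_iff (hHK := hHK) hp, ← readVecₗ_apply, map_sub,
    readVecₗ_mkVecₗ hp, hrd t c]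
  change P (x t) _ = 0 ↔ linearizedConstraint P x Z (Icc a b) t = 0
  rw [← hLk, ← hL, hP.apply_linearizedConstraint hxV hw0]

end Operator

/-! ### Variations at a given time and their form in charts. -/

section Variations

open Filter

variable {E : Type*} [NormedAddCommGroup E] [NormedSpace ℝ E]
  {M : Type*} [TopologicalSpace M] [ChartedSpace E M] [IsManifold 𝓘(ℝ, E) ∞ M]

/-- The velocity of a path, with its base point. -/
def velocity (c : ℝ → M) (S : Set ℝ) (t : ℝ) : TangentBundle 𝓘(ℝ, E) M :=
  ⟨c t, pathVelocity 𝓘(ℝ, E) c S t⟩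

theorem velocity_congr {c c' : ℝ → M} {S S' : Set ℝ} {t : ℝ} (ht : t ∈ S) (hS : S =ᶠ[𝓝 t] S')
    (h : c =ᶠ[𝓝[S] t] c') : velocity (E := E) c S t = velocity c' S' t := by
  have h0 := h.eq_of_nhdsWithin ht
  refine tangentBundle_ext h0 ?_
  have h1 : (mfderivWithin 𝓘(ℝ, ℝ) 𝓘(ℝ, E) c S t : ℝ →L[ℝ] E) =
      mfderivWithin 𝓘(ℝ, ℝ) 𝓘(ℝ, E) c' S t := h.mfderivWithin_eq h0
  have h2 : (mfderivWithin 𝓘(ℝ, ℝ) 𝓘(ℝ, E) c' S t : ℝ →L[ℝ] E) =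
      mfderivWithin 𝓘(ℝ, ℝ) 𝓘(ℝ, E) c' S' t := mfderivWithin_congr_set hS
  exact congrArg (fun L : ℝ →L[ℝ] E => L 1) (h1.trans h2)

theorem velocity_subset {c : ℝ → M} {S S' : Set ℝ} {t : ℝ} (hS : S' ⊆ S)
    (hu : UniqueDiffWithinAt ℝ S' t) (hc : ContMDiffWithinAt 𝓘(ℝ, ℝ) 𝓘(ℝ, E) ∞ c S t) :
    velocity (E := E) c S' t = velocity c S t :=
  tangentBundle_ext rfl (congrArg (fun L : ℝ →L[ℝ] E => L 1)
    (mfderivWithin_subset hS hu.uniqueMDiffWithinAt (hc.mdifferentiableWithinAt (by simp))))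

/-- At the time `t`, the map `β` is a smooth variation through paths tangent to `H` with variation
vector field `ξ`. -/
structure IsVariationAt (H : ∀ p : M, Submodule ℝ (TangentSpace 𝓘(ℝ, E) p))
    (ξ : ℝ → TangentBundle 𝓘(ℝ, E) M) (J : Set ℝ) (ε : ℝ) (β : ℝ × ℝ → M) (t : ℝ) : Prop where
  smooth : ∀ s ∈ Ioo (-ε) ε, ContMDiffWithinAt 𝓘(ℝ, ℝ × ℝ) 𝓘(ℝ, E) ∞ β (Ioo (-ε) ε ×ˢ J) (s, t)
  tangent : ∀ s ∈ Ioo (-ε) ε, velocity (fun τ => β (s, τ)) J t ∈ totalSet H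
  initial : velocity (fun s => β (s, t)) (Ioo (-ε) ε) 0 = ξ t

theorem contMDiffWithinAt_fst_slice {β : ℝ × ℝ → M} {S J : Set ℝ} {s t : ℝ} (ht : t ∈ J)
    (h : ContMDiffWithinAt 𝓘(ℝ, ℝ × ℝ) 𝓘(ℝ, E) ∞ β (S ×ˢ J) (s, t)) :
    ContMDiffWithinAt 𝓘(ℝ, ℝ) 𝓘(ℝ, E) ∞ (fun s => β (s, t)) S s :=
  ContMDiffWithinAt.comp s h ((contDiff_id.prodMk contDiff_const).contDiffWithinAt.contMDiffWithinAt
    (s := S)) fun _ hs => ⟨hs, ht⟩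

theorem contMDiffWithinAt_snd_slice {β : ℝ × ℝ → M} {S J : Set ℝ} {s t : ℝ} (hs : s ∈ S)
    (h : ContMDiffWithinAt 𝓘(ℝ, ℝ × ℝ) 𝓘(ℝ, E) ∞ β (S ×ˢ J) (s, t)) :
    ContMDiffWithinAt 𝓘(ℝ, ℝ) 𝓘(ℝ, E) ∞ (fun t => β (s, t)) J t :=
  ContMDiffWithinAt.comp t h ((contDiff_const.prodMk contDiff_id).contDiffWithinAt.contMDiffWithinAt
    (s := J)) fun _ ht => ⟨hs, ht⟩

namespace IsVariationAt

variable {H : ∀ p : M, Submodule ℝ (TangentSpace 𝓘(ℝ, E) p)} {ξ : ℝ → TangentBundle 𝓘(ℝ, E) M}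
  {J J' : Set ℝ} {ε ε' : ℝ} {β β' : ℝ × ℝ → M} {t : ℝ}

theorem apply_zero (h : IsVariationAt H ξ J ε β t) : β (0, t) = (ξ t).1 :=
  congrArg Bundle.TotalSpace.proj h.initial

theorem mono (h : IsVariationAt H ξ J ε β t) (hJ : J' ⊆ J) (hu : UniqueDiffWithinAt ℝ J' t) :
    IsVariationAt H ξ J' ε β t where
  smooth s hs := (h.smooth s hs).mono (prod_mono subset_rfl hJ)
  tangent s hs := by
    rw [velocity_subset hJ hu (contMDiffWithinAt_snd_slice hs (h.smooth s hs))]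
    exact h.tangent s hs
  initial := h.initial

theorem mono_eps (h : IsVariationAt H ξ J ε β t) (hε : 0 < ε') (hεε : ε' ≤ ε) :
    IsVariationAt H ξ J ε' β t where
  smooth s hs := (h.smooth s (Ioo_subset_Ioo (neg_le_neg hεε) hεε hs)).mono
    (prod_mono (Ioo_subset_Ioo (neg_le_neg hεε) hεε) subset_rfl)
  tangent s hs := h.tangent s (Ioo_subset_Ioo (neg_le_neg hεε) hεε hs)
  initial := by
    rw [← h.initial]
    refine velocity_congr ⟨neg_lt_zero.2 hε, hε⟩ ?_ EventuallyEq.rfl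
    have h1 : Ioo (-ε') ε' ∈ 𝓝 (0 : ℝ) := Ioo_mem_nhds (neg_lt_zero.2 hε) hε
    filter_upwards [h1] with s hs
    exact propext ⟨fun h => Ioo_subset_Ioo (neg_le_neg hεε) hεε h, fun _ => hs⟩

theorem congr (h : IsVariationAt H ξ J ε β t) (hε : 0 < ε) (ht : t ∈ J) (hJ : J =ᶠ[𝓝 t] J')
    (hβ : ∀ᶠ τ in 𝓝[J] t, ∀ s ∈ Ioo (-ε) ε, β (s, τ) = β' (s, τ)) :
    IsVariationAt H ξ J' ε β' t where
  smooth s hs := by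
    have hset : (Ioo (-ε) ε ×ˢ J : Set (ℝ × ℝ)) =ᶠ[𝓝 (s, t)] (Ioo (-ε) ε ×ˢ J' : Set (ℝ × ℝ)) := by
      filter_upwards [continuousAt_snd.eventually hJ] with q hq
      exact propext (and_congr_right fun _ => hq.to_iff)
    refine (contMDiffWithinAt_congr_set hset).1 ((h.smooth s hs).congr_of_eventuallyEq_of_mem ?_
      ⟨hs, ht⟩)
    rw [nhdsWithin_prod_eq]
    filter_upwards [prod_mem_prod self_mem_nhdsWithin hβ] with q hq
    exact (hq.2 q.1 hq.1).symm
  tangent s hs := by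
    rw [← velocity_congr ht hJ (hβ.mono fun τ hτ => hτ s hs)]
    exact h.tangent s hs
  initial := by
    have h0 := hβ.self_of_nhdsWithin ht
    rw [← h.initial]
    have h1 : (0 : ℝ) ∈ Ioo (-ε) ε := ⟨neg_lt_zero.2 hε, hε⟩
    exact (velocity_congr h1 EventuallyEq.rfl (eventually_nhdsWithin_of_forall h0)).symm

end IsVariationAt

variable [FiniteDimensional ℝ E] {H K : ∀ p : M, Submodule ℝ (TangentSpace 𝓘(ℝ, E) p)}
  (hHK : ∀ p, IsCompl (H p) (K p)) {ξ : ℝ → TangentBundle 𝓘(ℝ, E) M}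
  {ε a b c d : ℝ} {β : ℝ × ℝ → M} {p : M}

/-- Variations stay in a neighbourhood of the initial path. -/
theorem exists_forall_mem_of_isVariation (hε : 0 < ε)
    (h : ∀ t ∈ Icc c d, IsVariationAt H ξ (Icc c d) ε β t) {U : Set M} (hU : IsOpen U)
    (hξU : ∀ t ∈ Icc c d, (ξ t).1 ∈ U) :
    ∃ η > 0, η ≤ ε ∧ ∀ s ∈ Ioo (-η) η, ∀ t ∈ Icc c d, β (s, t) ∈ U := by
  have hc : ContinuousOn β (Ioo (-ε) ε ×ˢ Icc c d) := fun q hq =>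
    ((h q.2 hq.2).smooth q.1 hq.1).continuousWithinAt
  obtain ⟨O, hO, hOU⟩ := continuousOn_iff'.1 hc U hU
  have h0 : (0 : ℝ) ∈ Ioo (-ε) ε := ⟨neg_lt_zero.2 hε, hε⟩
  have hsub : ({0} : Set ℝ) ×ˢ Icc c d ⊆ O := by
    rintro ⟨s, t⟩ ⟨hs, ht⟩
    obtain rfl : s = 0 := hs
    have : ((0 : ℝ), t) ∈ β ⁻¹' U ∩ Ioo (-ε) ε ×ˢ Icc c d :=
      ⟨by rw [mem_preimage, (h t ht).apply_zero]; exact hξU t ht, h0, ht⟩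
    rw [hOU] at this
    exact this.1
  obtain ⟨u, v, hu, -, h0u, hv, huv⟩ :=
    generalized_tube_lemma isCompact_singleton isCompact_Icc hO hsub
  obtain ⟨η, hη, hball⟩ := Metric.isOpen_iff.1 hu 0 (h0u rfl)
  rw [Real.ball_eq_Ioo, zero_sub, zero_add] at hball
  refine ⟨min η ε, lt_min hη hε, min_le_right _ _, fun s hs t ht => ?_⟩
  have hs1 : s ∈ Ioo (-η) η := Ioo_subset_Ioo (neg_le_neg (min_le_left _ _)) (min_le_left _ _) hs
  have hs2 : s ∈ Ioo (-ε) ε := Ioo_subset_Ioo (neg_le_neg (min_le_right _ _)) (min_le_right _ _) hs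
  have : (s, t) ∈ O ∩ Ioo (-ε) ε ×ˢ Icc c d := ⟨huv ⟨hball hs1, hv ht⟩, hs2, ht⟩
  rw [← hOU] at this
  exact this.1

/-- A variation that stays in a chart domain, seen in that chart. -/
theorem chart_of_isVariation (hε : 0 < ε) (hcd : c < d)
    (h : ∀ t ∈ Icc c d, IsVariationAt H ξ (Icc c d) ε β t)
    (hp : ∀ s ∈ Ioo (-ε) ε, ∀ t ∈ Icc c d, β (s, t) ∈ (extChartAt 𝓘(ℝ, E) p).source) :
    ContDiffOn ℝ ∞ (fun q => extChartAt 𝓘(ℝ, E) p (β q)) (Ioo (-ε) ε ×ˢ Icc c d) ∧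
      (∀ t ∈ Icc c d, HasDerivAt (fun s => extChartAt 𝓘(ℝ, E) p (β (s, t))) (readVec p (ξ t)) 0) ∧
      ∀ s ∈ Ioo (-ε) ε, ∀ t ∈ Icc c d,
        chartProj H K hHK p (extChartAt 𝓘(ℝ, E) p (β (s, t)))
          (derivWithin (fun t => extChartAt 𝓘(ℝ, E) p (β (s, t))) (Icc c d) t) = 0 := by
  have h0 : (0 : ℝ) ∈ Ioo (-ε) ε := ⟨neg_lt_zero.2 hε, hε⟩
  refine ⟨fun q hq => ((contMDiffWithinAt_iff_chart (hp q.1 hq.1 q.2 hq.2)).1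
    ((h q.2 hq.2).smooth q.1 hq.1)).2, fun t ht => ?_, fun s hs t ht => ?_⟩
  · have h1 := contMDiffWithinAt_fst_slice ht ((h t ht).smooth 0 h0)
    have h2 := (((contMDiffWithinAt_iff_chart (f := fun s => β (s, t)) (hp 0 h0 t ht)).1 h1).2.differentiableWithinAt
      (by simp)).hasDerivWithinAt
    have h3 := readVec_pathVelocity h1 (isOpen_Ioo.uniqueDiffWithinAt h0) h0 (hp 0 h0 t ht)
    have h4 : readVec p (ξ t) = readVec p (velocity (fun s => β (s, t)) (Ioo (-ε) ε) 0) := by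
      rw [(h t ht).initial]
    rw [h4]
    exact (h2.congr_deriv h3.symm).hasDerivAt (isOpen_Ioo.mem_nhds h0)
  · have h1 := contMDiffWithinAt_snd_slice hs ((h t ht).smooth s hs)
    have h3 := readVec_pathVelocity h1 (uniqueDiffOn_Icc hcd t ht) ht (hp s hs t ht)
    rw [← h3]
    exact (chartProj_readVec_eq_zero_iff (hp s hs t ht) _).2 ((h t ht).tangent s hs)

theorem isVariation_of_chart (hε : 0 < ε) (hcd : c < d) {γ : ℝ × ℝ → E}
    (hγ : ContDiffOn ℝ ∞ γ (Ioo (-ε) ε ×ˢ Icc c d))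
    (hγp : ∀ s ∈ Ioo (-ε) ε, ∀ t ∈ Icc c d, γ (s, t) ∈ (extChartAt 𝓘(ℝ, E) p).target)
    (hξ : ∀ t ∈ Icc c d, (ξ t).1 ∈ (extChartAt 𝓘(ℝ, E) p).source)
    (hγ0 : ∀ t ∈ Icc c d, γ (0, t) = extChartAt 𝓘(ℝ, E) p (ξ t).1)
    (hγX : ∀ t ∈ Icc c d, HasDerivAt (fun s => γ (s, t)) (readVec p (ξ t)) 0)
    (hγH : ∀ s ∈ Ioo (-ε) ε, ∀ t ∈ Icc c d,
      chartProj H K hHK p (γ (s, t)) (derivWithin (fun t => γ (s, t)) (Icc c d) t) = 0) :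
    ∀ t ∈ Icc c d, IsVariationAt H ξ (Icc c d) ε
      (fun q => (extChartAt 𝓘(ℝ, E) p).symm (γ q)) t := by
  have h0 : (0 : ℝ) ∈ Ioo (-ε) ε := ⟨neg_lt_zero.2 hε, hε⟩
  set φ := extChartAt 𝓘(ℝ, E) p with hφ
  have hsm := contMDiffOn_symm_comp hγ fun q hq => hγp q.1 hq.1 q.2 hq.2
  have hr : ∀ s ∈ Ioo (-ε) ε, ∀ t ∈ Icc c d, φ (φ.symm (γ (s, t))) = γ (s, t) := fun s hs t ht =>
    φ.right_inv (hγp s hs t ht)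
  have hsrc : ∀ s ∈ Ioo (-ε) ε, ∀ t ∈ Icc c d, φ.symm (γ (s, t)) ∈ φ.source := fun s hs t ht =>
    φ.map_target (hγp s hs t ht)
  intro t ht
  refine ⟨fun s hs => hsm (s, t) ⟨hs, ht⟩, fun s hs => ?_, ?_⟩
  · have h1 := contMDiffWithinAt_snd_slice hs (hsm (s, t) ⟨hs, ht⟩)
    have h3 := readVec_pathVelocity h1 (uniqueDiffOn_Icc hcd t ht) ht (hsrc s hs t ht)
    refine (chartProj_readVec_eq_zero_iff (hHK := hHK) (hsrc s hs t ht) _).1 ?_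
    refine (congrArg (fun v => chartProj H K hHK p (φ (φ.symm (γ (s, t)))) v) h3).trans ?_
    rw [derivWithin_congr (fun τ hτ => hr s hs τ hτ) (hr s hs t ht), hr s hs t ht]
    exact hγH s hs t ht
  · have h1 := contMDiffWithinAt_fst_slice ht (hsm (0, t) ⟨h0, ht⟩)
    have h3 := readVec_pathVelocity h1 (isOpen_Ioo.uniqueDiffWithinAt h0) h0 (hsrc 0 h0 t ht)
    have h4 : derivWithin (fun s => φ (φ.symm (γ (s, t)))) (Ioo (-ε) ε) 0 = readVec p (ξ t) := by
      rw [derivWithin_congr (fun s hs => hr s hs t ht) (hr 0 h0 t ht)]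
      exact (hγX t ht).hasDerivWithinAt.derivWithin (isOpen_Ioo.uniqueDiffWithinAt h0)
    have h5 : readVec p (velocity (E := E) (fun s => φ.symm (γ (s, t))) (Ioo (-ε) ε) 0) = readVec p (ξ t) :=
      h3.trans h4
    have h6 : (velocity (E := E) (fun s => φ.symm (γ (s, t))) (Ioo (-ε) ε) 0).1 = (ξ t).1 := by
      change φ.symm (γ (0, t)) = _
      rw [hγ0 t ht, φ.left_inv (hξ t ht)]
    have h7 := mkVec_readVec (p := p)
      (ξ := velocity (E := E) (fun s => φ.symm (γ (s, t))) (Ioo (-ε) ε) 0) (by rw [h6]; exact hξ t ht)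
    rw [h5, h6, mkVec_readVec (hξ t ht)] at h7
    exact h7.symm

end Variations

/-! ### Local variations, their prolongation and gluing. -/

section Extension

open Filter Metric

variable {E : Type*} [NormedAddCommGroup E] [NormedSpace ℝ E]
  {M : Type*} [TopologicalSpace M] [ChartedSpace E M] [IsManifold 𝓘(ℝ, E) ∞ M]
  [FiniteDimensional ℝ E] {H K : ∀ p : M, Submodule ℝ (TangentSpace 𝓘(ℝ, E) p)}
  {hHK : ∀ p, IsCompl (H p) (K p)} {ξ : ℝ → TangentBundle 𝓘(ℝ, E) M}
  {ε a b c c' d d' e e' : ℝ} {β : ℝ × ℝ → M} {p : M}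

/-- Correction of a family of paths in a chart to a variation through tangent paths. -/
theorem exists_isVariation_of_chart (hH : IsSmoothSubbundle H) (hK : IsSmoothSubbundle K)
    (hcd : c < d) (hξH : IsTangentPath H c d fun τ => (ξ τ).1)
    (hξ : ∀ t ∈ Icc c d, SatisfiesConstraintAt H K hHK (Icc c d) ξ t)
    (hp : ∀ t ∈ Icc c d, (ξ t).1 ∈ (extChartAt 𝓘(ℝ, E) p).source) {x₀ : E} {r : ℝ} (hr : 0 < r)
    (hV : closedBall x₀ (3 * r) ⊆ (extChartAt 𝓘(ℝ, E) p).target)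
    (hx : ∀ t ∈ Icc c d, extChartAt 𝓘(ℝ, E) p (ξ t).1 ∈ ball x₀ r) {ζ : ℝ × ℝ → E} {S : Set ℝ}
    (hS : IsOpen S) (hS0 : 0 ∈ S) (hζ : ContDiffOn ℝ ∞ ζ (S ×ˢ Icc c d))
    (hζ0 : ∀ t ∈ Icc c d, ζ (0, t) = extChartAt 𝓘(ℝ, E) p (ξ t).1)
    (hζX : ∀ t ∈ Icc c d, HasDerivAt (fun s => ζ (s, t)) (readVec p (ξ t)) 0) :
    ∃ ε > 0, Ioo (-ε) ε ⊆ S ∧ ∃ β : ℝ × ℝ → M,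
      (∀ t ∈ Icc c d, IsVariationAt H ξ (Icc c d) ε β t) ∧
      ∀ e ∈ Icc c d, (∀ s ∈ S, ∀ t ∈ Icc c e, ζ (s, t) ∈ ball x₀ (2 * r) ∧
          chartProj H K hHK p (ζ (s, t)) (derivWithin (fun t => ζ (s, t)) (Icc c d) t) = 0) →
        ∀ s ∈ Ioo (-ε) ε, ∀ t ∈ Icc c e, β (s, t) = (extChartAt 𝓘(ℝ, E) p).symm (ζ (s, t)) := by
  have hP := isProjectionField_chartProj (hHK := hHK) hH hK p
  have hb : ContMDiffOn 𝓘(ℝ, ℝ) 𝓘(ℝ, E) ∞ (fun τ => (ξ τ).1) (Icc c d) := fun t ht =>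
    ((contMDiffWithinAt_tangent_iff (hp t ht)).1 (hξ t ht).1).1
  have hsol := chart_solution (β₀ := fun τ => (ξ τ).1) (X := fun τ => (ξ τ).2) hH hK hcd hξH hp hξ
  have hζ0' : ∀ t ∈ Icc c d, (fun t => ζ (0, t)) =ᶠ[𝓝[Icc c d] t]
      fun τ => extChartAt 𝓘(ℝ, E) p (ξ τ).1 := fun t _ => eventually_nhdsWithin_of_forall hζ0
  have hX : ∀ t ∈ Icc c d, fderivWithin ℝ ζ (S ×ˢ Icc c d) (0, t) (1, 0) = readVec p (ξ t) :=
    fun t ht => (hasDerivAt_fst_of_prod hS (hζ.differentiableOn (by simp) (0, t)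
      ⟨hS0, ht⟩).hasFDerivWithinAt ⟨hS0, ht⟩).unique (hζX t ht)
  have key := hP.exists_tangent_variation hcd hS hS0 hr hV hζ
    (fun t ht => by rw [hζ0 t ht]; exact hx t ht)
    (fun t ht => by
      rw [(hζ0' t ht).derivWithin_eq_of_mem ht, hζ0 t ht]
      exact chartProj_chart_path hcd hb hξH ht (hp t ht))
    (fun t ht => by
      rw [linearizedConstraint_congr ht (hζ0' t ht) (eventually_nhdsWithin_of_forall hX)
        EventuallyEq.rfl]
      exact hsol.2 t ht)
  obtain ⟨ε, hε, hεS, γ, hγ, hγb, hγ0, hγX, hγH, hγe⟩ := key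
  have hbV : ball x₀ (2 * r) ⊆ (extChartAt 𝓘(ℝ, E) p).target :=
    (ball_subset_closedBall.trans (closedBall_subset_closedBall (by linarith))).trans hV
  refine ⟨ε, hε, hεS, _, isVariation_of_chart hHK hε hcd hγ (fun s hs t ht => hbV (hγb s hs t ht))
    hp (fun t ht => (hγ0 t ht).trans (hζ0 t ht)) (fun t ht => ?_) hγH, fun e he h s hs t ht => ?_⟩
  · rw [← hX t ht]
    exact hγX t ht
  · exact congrArg _ (hγe e he h s hs t ht)

/-- A variation on `[c, d]` exists, and variations on shorter intervals `[c, e]` extend to `[c, d]`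
after modification near `e`. -/
def VariationsExtend (H : ∀ p : M, Submodule ℝ (TangentSpace 𝓘(ℝ, E) p))
    (ξ : ℝ → TangentBundle 𝓘(ℝ, E) M) (c d : ℝ) : Prop :=
  (∃ ε > 0, ∃ β : ℝ × ℝ → M, ∀ t ∈ Icc c d, IsVariationAt H ξ (Icc c d) ε β t) ∧
  ∀ e ∈ Ioo c d, ∀ ε > 0, ∀ β : ℝ × ℝ → M, (∀ t ∈ Icc c e, IsVariationAt H ξ (Icc c e) ε β t) →
    ∃ ε' > 0, ε' ≤ ε ∧ ∃ β' : ℝ × ℝ → M, (∀ t ∈ Icc c d, IsVariationAt H ξ (Icc c d) ε' β' t) ∧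
      ∃ e' ∈ Ioo c e, ∀ s ∈ Ioo (-ε') ε', ∀ t ∈ Icc c e', β' (s, t) = β (s, t)

/-- For existence, correct the affine family x + sX. For prolongation, blend the given variation
into the affine family before correcting. The family is already tangent before the blending starts,
so the correction leaves it unchanged there. -/
theorem variationsExtend_of_chart (hH : IsSmoothSubbundle H) (hK : IsSmoothSubbundle K)
    (hcd : c < d) (hξH : IsTangentPath H c d fun τ => (ξ τ).1)
    (hξ : ∀ t ∈ Icc c d, SatisfiesConstraintAt H K hHK (Icc c d) ξ t)
    (hp : ∀ t ∈ Icc c d, (ξ t).1 ∈ (extChartAt 𝓘(ℝ, E) p).source) {x₀ : E} {r : ℝ} (hr : 0 < r)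
    (hV : closedBall x₀ (3 * r) ⊆ (extChartAt 𝓘(ℝ, E) p).target)
    (hx : ∀ t ∈ Icc c d, extChartAt 𝓘(ℝ, E) p (ξ t).1 ∈ ball x₀ r) : VariationsExtend H ξ c d := by
  have hb : ContMDiffOn 𝓘(ℝ, ℝ) 𝓘(ℝ, E) ∞ (fun τ => (ξ τ).1) (Icc c d) := fun t ht =>
    ((contMDiffWithinAt_tangent_iff (hp t ht)).1 (hξ t ht).1).1
  have hxd := contDiffOn_chart_path hb hp
  have hXd : ContDiffOn ℝ ∞ (fun t => readVec p (ξ t)) (Icc c d) := fun t ht =>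
    ((contMDiffWithinAt_tangent_iff (hp t ht)).1 (hξ t ht).1).2
  constructor
  · have key := exists_isVariation_of_chart hH hK hcd hξH hξ hp hr hV hx (S := univ)
      (ζ := fun q => extChartAt 𝓘(ℝ, E) p (ξ q.2).1 + q.1 • readVec p (ξ q.2)) isOpen_univ
      (mem_univ _) ?_ (fun t _ => by simp) (fun t _ => ?_)
    · obtain ⟨ε, hε, -, β, hβ, -⟩ := key
      exact ⟨ε, hε, β, hβ⟩
    · exact (hxd.comp contDiffOn_snd fun q hq => hq.2).add
        (contDiffOn_fst.smul (hXd.comp contDiffOn_snd fun q hq => hq.2))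
    · simpa using ((hasDerivAt_id (0 : ℝ)).smul_const (readVec p (ξ t))).const_add
        (extChartAt 𝓘(ℝ, E) p (ξ t).1)
  · intro e he ε hε β hβ
    have hsub : Icc c e ⊆ Icc c d := Icc_subset_Icc_right he.2.le
    -- Shrinking the parameter keeps the given variation in the ball of radius 2r, as is required
    -- for the correction not to alter it.
    obtain ⟨η, hη, hηε, hηU⟩ := exists_forall_mem_of_isVariation hε hβ
      (isOpen_extChartAt_preimage (I := 𝓘(ℝ, E)) p (isOpen_ball (x := x₀) (ε := 2 * r)))
      (fun t ht => ⟨by simpa using hp t (hsub ht),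
        ball_subset_ball (by linarith) (hx t (hsub ht))⟩)
    have hsrc : ∀ s ∈ Ioo (-η) η, ∀ t ∈ Icc c e, β (s, t) ∈ (extChartAt 𝓘(ℝ, E) p).source :=
      fun s hs t ht => by simpa using (hηU s hs t ht).1
    have hβη : ∀ t ∈ Icc c e, IsVariationAt H ξ (Icc c e) η β t := fun t ht =>
      (hβ t ht).mono_eps hη hηε
    obtain ⟨hγ, hγX, hγH⟩ := chart_of_isVariation hHK hη he.1 hβη hsrc
    obtain ⟨e₁, hce₁, he₁e⟩ := exists_between he.1
    obtain ⟨ζ, hζ, hζγ, hζ0, hζX⟩ := exists_blend he₁e hγ hxd hXd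
      (fun t ht => by rw [(hβη t ht).apply_zero]) hγX
    have key := exists_isVariation_of_chart hH hK hcd hξH hξ hp hr hV hx isOpen_Ioo
      ⟨neg_lt_zero.2 hη, hη⟩ hζ hζ0 hζX
    obtain ⟨ε', hε', hsubε, β', hβ', hagree⟩ := key
    have hε'η : ε' ≤ η :=
      ((Ioo_subset_Ioo_iff (neg_lt_self hε')).1 hsubε).2
    refine ⟨ε', hε', hε'η.trans hηε, β', hβ', e₁, ⟨hce₁, he₁e⟩, fun s hs t ht => ?_⟩
    have he₁d := he₁e.trans he.2
    have hsub₁ : Icc c e₁ ⊆ Icc c e := Icc_subset_Icc_right he₁e.le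
    rw [hagree e₁ ⟨hce₁.le, he₁d.le⟩ ?_ s hs t ht, hζγ s t ht.2]
    · exact (extChartAt 𝓘(ℝ, E) p).left_inv (hsrc s (hsubε hs) t (hsub₁ ht))
    · intro s hs t ht
      have hu := uniqueDiffOn_Icc hce₁ t ht
      have h1 : derivWithin (fun t => ζ (s, t)) (Icc c d) t =
          derivWithin (fun t => extChartAt 𝓘(ℝ, E) p (β (s, t))) (Icc c e) t := by
        have d1 := (hasDerivWithinAt_snd_of_prod (hζ.differentiableOn (by simp) (s, t)
          ⟨hs, hsub (hsub₁ ht)⟩).hasFDerivWithinAt hs).differentiableWithinAt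
        have d2 := (hasDerivWithinAt_snd_of_prod (hγ.differentiableOn (by simp) (s, t)
          ⟨hs, hsub₁ ht⟩).hasFDerivWithinAt hs).differentiableWithinAt
        rw [← derivWithin_subset (hsub₁.trans hsub) hu d1, ← derivWithin_subset hsub₁ hu d2]
        exact derivWithin_congr (fun τ hτ => hζγ s τ hτ.2) (hζγ s t ht.2)
      rw [h1, hζγ s t ht.2]
      exact ⟨(hηU s hs t (hsub₁ ht)).2, hγH s hs t (hsub₁ ht)⟩

/-- Gluing of variations that agree on an overlap. -/
theorem exists_glued_variation {β₁ β₂ : ℝ × ℝ → M} (hε : 0 < ε) (hcc' : c ≤ c') (hc'e' : c' < e')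
    (he'e : e' < e) (hed' : e ≤ d')
    (h₁ : ∀ t ∈ Icc c e, IsVariationAt H ξ (Icc c e) ε β₁ t)
    (h₂ : ∀ t ∈ Icc c' d', IsVariationAt H ξ (Icc c' d') ε β₂ t)
    (h : ∀ s ∈ Ioo (-ε) ε, ∀ t ∈ Icc c' e', β₂ (s, t) = β₁ (s, t)) :
    ∃ β : ℝ × ℝ → M, (∀ t ∈ Icc c d', IsVariationAt H ξ (Icc c d') ε β t) ∧
      ∀ s, ∀ t ≤ e', β (s, t) = β₁ (s, t) := by
  let β : ℝ × ℝ → M := fun q => if q.2 ≤ e' then β₁ q else β₂ q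
  have e1 : ∀ s, ∀ t ≤ e', β (s, t) = β₁ (s, t) := fun s t ht => if_pos ht
  have e2 : ∀ s ∈ Ioo (-ε) ε, ∀ t, c' ≤ t → β (s, t) = β₂ (s, t) := fun s hs t ht => by
    by_cases h' : t ≤ e'
    · exact (if_pos h').trans (h s hs t ⟨ht, h'⟩).symm
    · exact if_neg h'
  refine ⟨β, fun t ht => ?_, e1⟩
  rcases lt_or_ge t e' with hte | hte
  · refine (h₁ t ⟨ht.1, (hte.trans he'e).le⟩).congr hε ⟨ht.1, (hte.trans he'e).le⟩ ?_ ?_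
    · filter_upwards [Iio_mem_nhds hte] with τ hτ
      exact propext ⟨fun h => ⟨h.1, h.2.trans hed'⟩, fun h => ⟨h.1, (lt_trans hτ he'e).le⟩⟩
    · filter_upwards [nhdsWithin_le_nhds (Iio_mem_nhds hte)] with τ hτ s _
      exact (e1 s τ (le_of_lt hτ)).symm
  · have hc't := hc'e'.trans_le hte
    refine (h₂ t ⟨hc't.le, ht.2⟩).congr hε ⟨hc't.le, ht.2⟩ ?_ ?_
    · filter_upwards [Ioi_mem_nhds hc't] with τ hτ
      exact propext ⟨fun h => ⟨hcc'.trans h.1, h.2⟩, fun h => ⟨le_of_lt hτ, h.2⟩⟩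
    · filter_upwards [nhdsWithin_le_nhds (Ioi_mem_nhds hc't)] with τ hτ s hs
      exact (e2 s hs τ (le_of_lt hτ)).symm

/-- Restrict the variation to the overlap [c', e], prolong it from there to [c', d'], and glue with
the original on the part of the overlap where it was not modified. -/
theorem VariationsExtend.extend (h : VariationsExtend H ξ c' d') (hε : 0 < ε) (hcc' : c ≤ c')
    (hc'e : c' < e) (hed' : e < d') (hβ : ∀ t ∈ Icc c e, IsVariationAt H ξ (Icc c e) ε β t) :
    ∃ ε' > 0, ε' ≤ ε ∧ ∃ β' : ℝ × ℝ → M, (∀ t ∈ Icc c d', IsVariationAt H ξ (Icc c d') ε' β' t) ∧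
      ∃ e' ∈ Ioo c' e, ∀ s ∈ Ioo (-ε') ε', ∀ t ∈ Icc c e', β' (s, t) = β (s, t) := by
  obtain ⟨ε', hε', hεε, β₂, hβ₂, e', he', hagree⟩ := h.2 e ⟨hc'e, hed'⟩ ε hε β fun t ht =>
    (hβ t ⟨hcc'.trans ht.1, ht.2⟩).mono (Icc_subset_Icc_left hcc') (uniqueDiffOn_Icc hc'e t ht)
  obtain ⟨β', hβ', h'⟩ := exists_glued_variation hε' hcc' he'.1 he'.2 hed'.le
    (fun t ht => (hβ t ht).mono_eps hε' hεε) hβ₂ hagree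
  exact ⟨ε', hε', hεε, β', hβ', e', he', fun s _ t ht => h' s t ht.2⟩

theorem VariationsExtend.glue (hcc' : c ≤ c') (hc'd : c' < d) (hdd' : d ≤ d')
    (h₁ : VariationsExtend H ξ c d) (h₂ : VariationsExtend H ξ c' d') :
    VariationsExtend H ξ c d' := by
  rcases hdd'.eq_or_lt with rfl | hdd'
  · exact h₁
  constructor
  · obtain ⟨ε, hε, β, hβ⟩ := h₁.1
    obtain ⟨ε', hε', -, β', hβ', -⟩ := h₂.extend hε hcc' hc'd hdd' hβ
    exact ⟨ε', hε', β', hβ'⟩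
  · intro e he ε hε β hβ
    -- If e < d, prolong first to d and then to d', keeping the stretch untouched by both
    -- modifications. Otherwise e already lies beyond c' and one prolongation suffices.
    rcases lt_or_ge e d with hed | hde
    · obtain ⟨ε₁, hε₁, hε₁ε, β₁, hβ₁, e₁, he₁, hag₁⟩ := h₁.2 e ⟨he.1, hed⟩ ε hε β hβ
      obtain ⟨ε', hε', hε'ε, β', hβ', e', he', hag⟩ := h₂.extend hε₁ hcc' hc'd hdd' hβ₁
      refine ⟨ε', hε', hε'ε.trans hε₁ε, β', hβ', min e₁ e', ⟨lt_min he₁.1 (hcc'.trans_lt he'.1),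
        (min_le_left _ _).trans_lt he₁.2⟩, fun s hs t ht => ?_⟩
      rw [hag s hs t ⟨ht.1, ht.2.trans (min_le_right _ _)⟩]
      exact hag₁ s (Ioo_subset_Ioo (neg_le_neg hε'ε) hε'ε hs) t
        ⟨ht.1, ht.2.trans (min_le_left _ _)⟩
    · obtain ⟨ε', hε', hε'ε, β', hβ', e', he', hag⟩ :=
        h₂.extend hε hcc' (hc'd.trans_le hde) he.2 hβ
      exact ⟨ε', hε', hε'ε, β', hβ', e', ⟨hcc'.trans_lt he'.1, he'.2⟩, hag⟩

theorem exists_isVariation (hH : IsSmoothSubbundle H) (hK : IsSmoothSubbundle K)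
    (hab : a < b) (hξH : IsTangentPath H a b fun τ => (ξ τ).1)
    (hξ : ∀ t ∈ Icc a b, SatisfiesConstraintAt H K hHK (Icc a b) ξ t) :
    ∃ ε > 0, ∃ β : ℝ × ℝ → M, ∀ t ∈ Icc a b, IsVariationAt H ξ (Icc a b) ε β t := by
  have hb : ContMDiffOn 𝓘(ℝ, ℝ) 𝓘(ℝ, E) ∞ (fun τ => (ξ τ).1) (Icc a b) := fun t ht =>
    ((contMDiffWithinAt_tangent_iff (mem_extChartAt_source (ξ t).1)).1 (hξ t ht).1).1
  refine (interval_induction (W := VariationsExtend H ξ) hab (fun t ht => ?_)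
    fun c c' d d' _ hcc' hc'd hdd' _ => VariationsExtend.glue hcc' hc'd hdd').1
  obtain ⟨p, hp⟩ : ∃ p, p = (ξ t).1 := ⟨_, rfl⟩
  have hsrc : (ξ t).1 ∈ (extChartAt 𝓘(ℝ, E) p).source := by rw [hp]; exact mem_extChartAt_source _
  obtain ⟨R, hR, hball⟩ := Metric.isOpen_iff.1 (isOpen_extChartAt_target (I := 𝓘(ℝ, E)) p) _
    ((extChartAt 𝓘(ℝ, E) p).map_source hsrc)
  -- The cut-off in the correction lives on the closed ball of radius 3r, which must lie in the
  -- chart target.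
  obtain ⟨r, hr, hrR⟩ : ∃ r > 0, 3 * r < R := ⟨R / 6, by positivity, by linarith⟩
  have hU := isOpen_extChartAt_preimage (I := 𝓘(ℝ, E)) p
    (isOpen_ball (x := extChartAt 𝓘(ℝ, E) p (ξ t).1) (ε := r))
  have hn := (hb t ht).continuousWithinAt.preimage_mem_nhdsWithin
    (hU.mem_nhds ⟨by simpa using hsrc, mem_ball_self hr⟩)
  obtain ⟨δ, hδ, hδU⟩ := Metric.mem_nhdsWithin_iff.1 hn
  refine ⟨δ, hδ, fun c d hac hcd hdb h1 h2 => ?_⟩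
  have hsub := Icc_subset_Icc hac hdb
  have hball' : Icc c d ⊆ ball t δ := fun τ hτ => by
    rw [Real.ball_eq_Ioo]; exact ⟨h1.trans_le hτ.1, hτ.2.trans_lt h2⟩
  have hτ := fun τ (hτ : τ ∈ Icc c d) => hδU ⟨hball' hτ, hsub hτ⟩
  exact variationsExtend_of_chart hH hK hcd (hξH.mono hb hac hcd hdb)
    (fun τ hτ => (hξ τ (hsub hτ)).mono hsub (uniqueDiffOn_Icc hcd τ hτ))
    (fun τ h => by simpa using (hτ τ h).1) hr
    ((closedBall_subset_ball hrR).trans hball) fun τ h => (hτ τ h).2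

/-- The variation vector field of a variation through tangent paths satisfies the linearised
constraint. -/
theorem chartConstraint_eq_zero_of_isVariation (hH : IsSmoothSubbundle H)
    (hK : IsSmoothSubbundle K) (hab : a < b) (hε : 0 < ε)
    (hξ : ContMDiffOn 𝓘(ℝ, ℝ) 𝓘(ℝ, E).tangent ∞ ξ (Icc a b))
    (hβ : ∀ t ∈ Icc a b, IsVariationAt H ξ (Icc a b) ε β t) {t : ℝ} (ht : t ∈ Icc a b) :
    chartConstraint H K hHK (ξ t).1 ξ (Icc a b) t = 0 := by
  obtain ⟨p, hp⟩ : ∃ p, p = (ξ t).1 := ⟨_, rfl⟩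
  have hsrc : (ξ t).1 ∈ (extChartAt 𝓘(ℝ, E) p).source := by rw [hp]; exact mem_extChartAt_source _
  have h1 := (contMDiffWithinAt_tangent_iff hsrc).1 (hξ t ht)
  have h2 := (contMDiffWithinAt_iff_chart (f := fun τ => (ξ τ).1) hsrc).1 h1.1
  have hn := h1.1.continuousWithinAt.preimage_mem_nhdsWithin
    ((isOpen_extChartAt_source (I := 𝓘(ℝ, E)) p).mem_nhds hsrc)
  obtain ⟨δ, hδ, hδU⟩ := Metric.mem_nhdsWithin_iff.1 hn
  -- A nondegenerate closed interval around `t` on which the path stays in one chart, truncated at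
  -- `a` and `b` so that the end points are covered; one-sided derivatives are unaffected.
  obtain ⟨c, d, hcd, htcd, hsub, hδcd⟩ : ∃ c d, c < d ∧ t ∈ Icc c d ∧ Icc c d ⊆ Icc a b ∧
      Icc c d ⊆ ball t δ := by
    refine ⟨max a (t - δ / 2), min b (t + δ / 2), ?_, ?_, ?_, ?_⟩
    · exact max_lt (lt_min hab (by linarith [ht.1])) (lt_min (by linarith [ht.2]) (by linarith))
    · exact ⟨max_le ht.1 (by linarith), le_min ht.2 (by linarith)⟩
    · exact Icc_subset_Icc (le_max_left _ _) (min_le_left _ _)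
    · intro τ hτ
      rw [Real.ball_eq_Ioo]
      have h1 := (le_max_right _ _).trans hτ.1
      have h2 := hτ.2.trans (min_le_right _ _)
      exact ⟨by linarith, by linarith⟩
  have hβcd : ∀ τ ∈ Icc c d, IsVariationAt H ξ (Icc c d) ε β τ := fun τ hτ =>
    (hβ τ (hsub hτ)).mono hsub (uniqueDiffOn_Icc hcd τ hτ)
  obtain ⟨η, hη, hηε, hηU⟩ := exists_forall_mem_of_isVariation hε hβcd
    (isOpen_extChartAt_source (I := 𝓘(ℝ, E)) p) fun τ hτ => hδU ⟨hδcd hτ, hsub hτ⟩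
  have hβη : ∀ τ ∈ Icc c d, IsVariationAt H ξ (Icc c d) η β τ := fun τ hτ =>
    (hβcd τ hτ).mono_eps hη hηε
  obtain ⟨hγ, hγX, hγH⟩ := chart_of_isVariation hHK hη hcd hβη hηU
  have h0 : (0 : ℝ) ∈ Ioo (-η) η := ⟨neg_lt_zero.2 hη, hη⟩
  have hP := isProjectionField_chartProj (hHK := hHK) hH hK p
  have key := hP.linearizedConstraint_eq_zero hcd isOpen_Ioo h0 hγ htcd
    ((extChartAt 𝓘(ℝ, E) p).map_source (hηU 0 h0 t htcd)) fun s hs => hγH s hs t htcd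
  rw [← hp, chartConstraint, ← linearizedConstraint_subset hsub (uniqueDiffOn_Icc hcd t htcd)
    (h2.2.differentiableWithinAt (by simp)) (h1.2.differentiableWithinAt (by simp))]
  refine Eq.trans (linearizedConstraint_congr htcd (eventually_nhdsWithin_of_forall fun τ hτ => ?_)
    (eventually_nhdsWithin_of_forall fun τ hτ => ?_) EventuallyEq.rfl) key
  · rw [(hβη τ hτ).apply_zero]
  · exact ((hasDerivAt_fst_of_prod isOpen_Ioo (hγ.differentiableOn (by simp) (0, τ)
      ⟨h0, hτ⟩).hasFDerivWithinAt ⟨h0, hτ⟩).unique (hγX τ hτ)).symm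

end Extension

end TangentPaths

end

theorem theorem12 {E : Type*} [NormedAddCommGroup E] [NormedSpace ℝ E] [FiniteDimensional ℝ E]
    {M : Type*} [TopologicalSpace M] [T2Space M] [ChartedSpace E M] [IsManifold 𝓘(ℝ, E) ∞ M]
    (H K : ∀ p : M, Submodule ℝ (TangentSpace 𝓘(ℝ, E) p))
    (hH : TangentPaths.IsSmoothSubbundle H) (hK : TangentPaths.IsSmoothSubbundle K)
    (hHK : ∀ p, IsCompl (H p) (K p))
    (a b : ℝ) (hab : a < b) (t₀ : ℝ) (ht₀ : t₀ ∈ Icc a b)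
    (β₀ : ℝ → M) (hβ₀ : ContMDiffOn 𝓘(ℝ, ℝ) 𝓘(ℝ, E) ∞ β₀ (Icc a b))
    (hβ₀H : TangentPaths.IsTangentPath H a b β₀)
    (X : ∀ t : ℝ, TangentSpace 𝓘(ℝ, E) (β₀ t)) (hX : TangentPaths.IsSmoothAlong a b β₀ X) :
    (∀ t ∈ Icc a b, TangentPaths.variationOperator H K hHK a b β₀ t₀ X t = 0) ↔
      ∃ ε > (0 : ℝ), ∃ β : ℝ × ℝ → M, TangentPaths.IsTangentVariation H a b β₀ ε β ∧
        ∀ t ∈ Icc a b,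
          (⟨β₀ t, X t⟩ : TangentBundle 𝓘(ℝ, E) M) =
            ⟨β (0, t), TangentPaths.pathVelocity 𝓘(ℝ, E) (fun s => β (s, t)) (Ioo (-ε) ε) 0⟩ := by
  have hiff : ∀ t ∈ Icc a b, _ := fun t ht => TangentPaths.variationOperator_eq_zero_iff
    (t := t) (hHK := hHK) hH hK hab hβ₀ hβ₀H ht₀ hX ht
  refine (forall₂_congr hiff).trans ?_
  constructor
  · intro h
    obtain ⟨ε, hε, β, hβ⟩ := TangentPaths.exists_isVariation (hHK := hHK)
      (ξ := TangentPaths.along β₀ X) hH hK hab hβ₀H fun t ht => ⟨hX t ht, h t ht⟩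
    exact ⟨ε, hε, β, ⟨fun q hq => (hβ q.2 hq.2).smooth q.1 hq.1, fun t ht => (hβ t ht).apply_zero,
      fun s hs t ht => (hβ t ht).tangent s hs⟩, fun t ht => (hβ t ht).initial.symm⟩
  · rintro ⟨ε, hε, β, hβ, hβX⟩ t ht
    exact TangentPaths.chartConstraint_eq_zero_of_isVariation (ξ := TangentPaths.along β₀ X)
      (hHK := hHK) hH hK hab hε hX (fun t ht => ⟨fun s hs => hβ.smooth (s, t) ⟨hs, ht⟩,
        fun s hs => hβ.tangent s hs t ht, (hβX t ht).symm⟩) ht
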